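/- Let $p$ be a prime and let $(K,\mathcal O,k)$, $(K',\mathcal O',k')$ be $p$-modular systems: $\mathcal O$, $\mathcal O'$ are complete discrete valuation rings with residue fields $k$, $k'$ of characteristic $p$ and fields of fractions $K$, $K'$ of characteristic $0$. Suppose that $\mathcal O$ is a subring of $\mathcal O'$ with $J(\mathcal O)\subseteq J(\mathcal O')$, that $k$ and $k'$ are finite, and that $\mathcal O$ and $\mathcal O'$ are absolutely unramified, that is, $J(\mathcal O)=p\mathcal O$ and $J(\mathcal O')=p\mathcal O'$. Let $G$, $H$ be finite groups. A block of a group algebra is a primitive idempotent of its center. Let $b$, $c$ be blocks of $\mathcal OG$, $\mathcal OH$, and let $b'$, $c'$ be blocks of $\mathcal O'G$, $\mathcal O'H$ such that $bb'\neq 0$ and $cc'\neq 0$. Suppose that $k'=k[b']=k[c']$, where $k[a]$ denotes the subfield of $k'$ generated by $k$ and the images in $k'$ of the coefficients of $a$. Terminology, for $\mathcal O$ and likewise for $\mathcal O'$. An $(\mathcal OGb,\mathcal OHc)$-bimodule is regarded as an $\mathcal O(G\times H)$-module via $(g,h)\cdot m=gmh^{-1}$. Let $A$, $B$ be block algebras;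 write $X^\vee=\mathrm{Hom}_{\mathcal O}(X,\mathcal O)$, and call an $(A,B)$-bimodule biprojective if it is finitely generated projective as a left $A$-module and as a right $B$-module. $A$ and $B$ are Morita equivalent via a biprojective bimodule $M$ if $M\otimes_B-$ is an equivalence from left $B$-modules to left $A$-modules. A Rickard complex of $(A,B)$-bimodules is a bounded complex $X$ of biprojective bimodules such that $X\otimes_BX^\vee\cong A\oplus Y$ and $X^\vee\otimes_AX\cong B\oplus Z$ as complexes of bimodules, with $Y$, $Z$ contractible; it is splendid if its terms are $p$-permutation modules, that is, finitely generated $\mathcal O(G\times H)$-modules having a $P$-stable $\mathcal O$-basis for every $p$-subgroup $P$ of $G\times H$. Let $\mathcal R(A,B)$ be the Grothendieck group of finitely generated $(A,B)$-bimodules with respect to split exact sequences, with the product $[X]\cdot_B[Y]=[X\otimes_BY]$ and the dual $[X]^\vee=[X^\vee]$, and let $\mathcal P(A,B)$ be its subgroup generated by the classes of biprojective bimodules. A virtual Morita equivalence between $A$ and $B$ is given by $M\in\mathcal P(A,B)$ and $N\in\mathcal P(B,A)$ with $M\cdot_BN=[A]$ and $N\cdot_AM=[B]$; a $p$-permutation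 equivalence is a virtual Morita equivalence given by some $M$ and $M^\vee$, where $M=[M_0]-[M_1]$ with $M_0$, $M_1$ biprojective $p$-permutation bimodules. A finitely generated indecomposable module $U$ for a group algebra has trivial source if, for some vertex $P$ of $U$ (a $p$-subgroup minimal such that $U$ is relatively $P$-projective), $U$ is isomorphic to a direct summand of the module induced from the trivial module of $P$. Then the following hold. (a) If $\mathcal O'Gb'$ and $\mathcal O'Hc'$ are Morita equivalent via an $(\mathcal O'Gb',\mathcal O'Hc')$-bimodule $M'$, then $\mathcal OGb$ and $\mathcal OHc$ are Morita equivalent via an $(\mathcal OGb,\mathcal OHc)$-bimodule $M$ such that $M'$ is isomorphic to a direct summand of $\mathcal O'\otimes_{\mathcal O}M$ and such that, if $M'$ has trivial source, then $M$ has trivial source. (b) If $X'$ is a Rickard complex of $(\mathcal O'Gb',\mathcal O'Hc')$-bimodules, then there is a Rickard complex $X$ of $(\mathcal OGb,\mathcal OHc)$-bimodules such that $X'$ is isomorphic to a direct summand of $\mathcal O'\otimes_{\mathcal O}X$ and such that, if $X'$ is splendid, then $X$ is splendid. (c) If there is a virtual Morita equivalence (respectively, a $p$-permutation equivalence) between $\mathcal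 O'Gb'$ and $\mathcal O'Hc'$, then there is a virtual Morita equivalence (respectively, a $p$-permutation equivalence) between $\mathcal OGb$ and $\mathcal OHc$. -/

import Mathlib

open CategoryTheory CategoryTheory.Limits TensorProduct

universe u

noncomputable section

namespace BlockDescent

/-! ### Blocks and block algebras -/

/-- A block of a ring `R` (in the application: of a group algebra) is a primitive idempotent
of the center of `R`. -/
structure IsBlock {R : Type u} [Ring R] (b : R) : Prop where
  central : b ∈ Subring.center R
  idem : IsIdempotentElem b
  ne_zero : b ≠ 0
  primitive : ∀ e ∈ Subring.center R, IsIdempotentElem e → e * b = e → e = 0 ∨ e = b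

section Corner

variable {O R : Type u} [CommRing O] [Ring R] [Algebra O R] {e : R}

/-- The corner `e R e` (with identity `e`) of an `O`-algebra `R` is an `O`-module. -/
instance cornerModule (he : IsIdempotentElem e) : Module O he.Corner where
  smul r x := ⟨r • x.1, by
    obtain ⟨y, hy⟩ := x.2
    exact ⟨r • y, by simp only at hy; simp [hy]⟩⟩
  one_smul x := Subtype.ext (one_smul O x.1)
  mul_smul r s x := Subtype.ext (mul_smul r s x.1)
  smul_zero r := Subtype.ext (smul_zero r)
  smul_add r x y := Subtype.ext (smul_add r x.1 y.1)
  add_smul r s x := Subtype.ext (add_smul r s x.1)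
  zero_smul x := Subtype.ext (zero_smul O x.1)

/-- The corner `e R e` of an `O`-algebra `R` is an `O`-algebra. -/
instance cornerAlgebra (he : IsIdempotentElem e) : Algebra O he.Corner :=
  Algebra.ofModule
    (fun r x y => Subtype.ext (smul_mul_assoc r x.1 y.1))
    (fun r x y => Subtype.ext (mul_smul_comm r x.1 y.1))

instance cornerFinite (he : IsIdempotentElem e) [Module.Finite O R] :
    Module.Finite O he.Corner :=
  Module.Finite.of_surjective (M := R)
    ({ toFun := fun r => ⟨e * r * e, r, rfl⟩
       map_add' := fun x y => Subtype.ext (by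
        change e * (x + y) * e = e * x * e + e * y * e
        rw [mul_add, add_mul])
       map_smul' := fun r x => Subtype.ext (by
        change e * (r • x) * e = r • (e * x * e)
        rw [mul_smul_comm, smul_mul_assoc]) } : R →ₗ[O] he.Corner)
    (by rintro ⟨_, r, rfl⟩; exact ⟨r, rfl⟩)

end Corner

/-- For a block `b` of `R`, the block algebra `R b = b R b`, with identity element `b`. -/
abbrev IsBlock.Alg {R : Type u} [Ring R] {b : R} (hb : IsBlock b) : Type u := hb.idem.Corner

/-- The multiplicative map underlying the ring homomorphism `R → R b`, `r ↦ b r b = r b`. -/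
def IsBlock.proj {R : Type u} [Ring R] {b : R} (hb : IsBlock b) : R →* hb.Alg where
  toFun r := ⟨b * r * b, r, rfl⟩
  map_one' := Subtype.ext (by
    change b * 1 * b = b
    rw [mul_one, hb.idem.eq])
  map_mul' x y := Subtype.ext (by
    have hc := Subring.mem_center_iff.1 hb.central
    change b * (x * y) * b = b * x * b * (b * y * b)
    have h : b * x * b * (b * y * b) = b * x * (b * b) * y * b := by simp only [mul_assoc]
    rw [h, hb.idem.eq, mul_assoc b x b, hc x, ← mul_assoc b b x, hb.idem.eq, ← mul_assoc])

/-- The multiplicative map `G → OGb`, `g ↦ g b`. -/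
def IsBlock.ofGroup {O G : Type u} [CommRing O] [Group G] {b : MonoidAlgebra O G}
    (hb : IsBlock b) : G →* hb.Alg :=
  hb.proj.comp (MonoidAlgebra.of O G)

instance monoidAlgebraFinite {O G : Type u} [CommRing O] [Group G] [Finite G] :
    Module.Finite O (MonoidAlgebra O G) :=
  Module.Finite.equiv (MonoidAlgebra.coeffLinearEquiv O).symm

/-! ### Bimodules, tensor products and duals -/

section Bimodules

variable (O : Type u) [CommRing O]

/-- The category of `(A, B)`-bimodules over `O` (on which the two actions of `O` agree), that is,
of left modules over `A ⊗_O Bᵒᵖ`. -/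
abbrev Bimod (A B : Type u) [Ring A] [Algebra O A] [Ring B] [Algebra O B] : Type (u + 1) :=
  ModuleCat.{u} (A ⊗[O] Bᵐᵒᵖ)

variable {O}
variable {A B C : Type u} [Ring A] [Algebra O A] [Ring B] [Algebra O B] [Ring C] [Algebra O C]

instance Bimod.moduleBase (X : Bimod O A B) : Module O X :=
  Module.restrictScalars O (A ⊗[O] Bᵐᵒᵖ) X

instance Bimod.towerBase (X : Bimod O A B) : IsScalarTower O (A ⊗[O] Bᵐᵒᵖ) X :=
  IsScalarTower.restrictScalars O (A ⊗[O] Bᵐᵒᵖ) X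

/-- The action of `A ⊗_O Bᵒᵖ` on an `(A, B)`-bimodule. -/
def Bimod.act (X : Bimod O A B) : A ⊗[O] Bᵐᵒᵖ →ₐ[O] Module.End O X :=
  Algebra.lsmul O O X

/-- The left action of `A` on an `(A, B)`-bimodule. -/
def Bimod.left (X : Bimod O A B) : A →ₐ[O] Module.End O X :=
  X.act.comp Algebra.TensorProduct.includeLeft

/-- The right action of `B` on an `(A, B)`-bimodule. -/
def Bimod.right (X : Bimod O A B) : Bᵐᵒᵖ →ₐ[O] Module.End O X :=
  X.act.comp Algebra.TensorProduct.includeRight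

lemma Bimod.left_right_commute (X : Bimod O A B) (a : A) (b : Bᵐᵒᵖ) :
    Commute (X.left a) (X.right b) := by
  unfold Bimod.left Bimod.right
  simp only [AlgHom.comp_apply]
  refine Commute.map ?_ X.act
  simp [Commute, SemiconjBy]

lemma Bimod.hom_left {X Y : Bimod O A B} (f : X ⟶ Y) (a : A) (x : X) :
    f.hom (X.left a x) = Y.left a (f.hom x) :=
  f.hom.map_smul _ _

lemma Bimod.hom_right {X Y : Bimod O A B} (f : X ⟶ Y) (b : Bᵐᵒᵖ) (x : X) :
    f.hom (X.right b x) = Y.right b (f.hom x) :=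
  f.hom.map_smul _ _

lemma Bimod.tmul_smul (X : Bimod O A B) (a : A) (b : Bᵐᵒᵖ) (x : X) :
    (a ⊗ₜ[O] b) • x = X.left a (X.right b x) := by
  change (a ⊗ₜ[O] b) • x = (a ⊗ₜ[O] (1 : Bᵐᵒᵖ)) • ((1 : A) ⊗ₜ[O] b) • x
  rw [smul_smul]
  simp

/-- The `O`-linear map underlying a bimodule homomorphism. -/
def Bimod.linear {X Y : Bimod O A B} (f : X ⟶ Y) : X →ₗ[O] Y :=
  { f.hom with map_smul' := fun r x => f.hom.map_smul (algebraMap O (A ⊗[O] Bᵐᵒᵖ) r) x }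

/-- The left `A`-module underlying a bimodule. -/
def Bimod.leftModule (X : Bimod O A B) : ModuleCat.{u} A :=
  (ModuleCat.restrictScalars
    (Algebra.TensorProduct.includeLeft : A →ₐ[O] A ⊗[O] Bᵐᵒᵖ).toRingHom).obj X

/-- The right `B`-module underlying a bimodule. -/
def Bimod.rightModule (X : Bimod O A B) : ModuleCat.{u} Bᵐᵒᵖ :=
  (ModuleCat.restrictScalars
    (Algebra.TensorProduct.includeRight : Bᵐᵒᵖ →ₐ[O] A ⊗[O] Bᵐᵒᵖ).toRingHom).obj X

/-- The bimodule `X` is finitely generated projective as a left module and as a right module. -/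
structure Bimod.IsBiprojective (X : Bimod O A B) : Prop where
  left_finite : Module.Finite A X.leftModule
  left_projective : Module.Projective A X.leftModule
  right_finite : Module.Finite Bᵐᵒᵖ X.rightModule
  right_projective : Module.Projective Bᵐᵒᵖ X.rightModule

variable (O A) in
/-- The regular bimodule: `A` as an `(A, A)`-bimodule. -/
def Bimod.regular : Bimod O A A :=
  letI : Module (A ⊗[O] Aᵐᵒᵖ) A := TensorProduct.Algebra.module
  ModuleCat.of (A ⊗[O] Aᵐᵒᵖ) A

/-- The `O`-module `X ⊗_O Y`, for an `(A, B)`-bimodule `X` and a `(B, C)`-bimodule `Y`. -/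
def PreTensor (X : Bimod O A B) (Y : Bimod O B C) : Type u := X ⊗[O] Y

instance (X : Bimod O A B) (Y : Bimod O B C) : AddCommGroup (PreTensor X Y) :=
  inferInstanceAs (AddCommGroup (X ⊗[O] Y))

instance (X : Bimod O A B) (Y : Bimod O B C) : Module O (PreTensor X Y) :=
  inferInstanceAs (Module O (X ⊗[O] Y))

lemma PreTensor.commute (X : Bimod O A B) (Y : Bimod O B C) (a : A) (c : Cᵐᵒᵖ) :
    Commute (((Module.End.rTensorAlgHom O X Y).comp X.left) a)
      (((Module.End.lTensorAlgHom O Y X).comp Y.right) c) := by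
  refine LinearMap.ext fun t => ?_
  induction t with
  | zero => simp
  | tmul x y => rfl
  | add s t hs ht => simp only [map_add, hs, ht]

/-- The action of `A ⊗_O Cᵒᵖ` on `X ⊗_O Y`: `A` acts on `X` and `C` on `Y`. -/
def PreTensor.action (X : Bimod O A B) (Y : Bimod O B C) :
    A ⊗[O] Cᵐᵒᵖ →ₐ[O] Module.End O (X ⊗[O] Y) :=
  Algebra.TensorProduct.lift
    ((Module.End.rTensorAlgHom O X Y).comp X.left)
    ((Module.End.lTensorAlgHom O Y X).comp Y.right)
    (PreTensor.commute X Y)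

lemma PreTensor.action_tmul (X : Bimod O A B) (Y : Bimod O B C) (a : A) (c : Cᵐᵒᵖ) (x : X)
    (y : Y) : PreTensor.action X Y (a ⊗ₜ[O] c) (x ⊗ₜ[O] y) = X.left a x ⊗ₜ[O] Y.right c y := by
  rw [PreTensor.action, Algebra.TensorProduct.lift_tmul]
  rfl

instance (X : Bimod O A B) (Y : Bimod O B C) : Module (A ⊗[O] Cᵐᵒᵖ) (PreTensor X Y) :=
  Module.compHom (X ⊗[O] Y) (PreTensor.action X Y).toRingHom

lemma PreTensor.smul_def (X : Bimod O A B) (Y : Bimod O B C) (r : A ⊗[O] Cᵐᵒᵖ)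
    (t : PreTensor X Y) : r • t = PreTensor.action X Y r t := rfl

/-- The sub-bimodule of `X ⊗_O Y` generated by the elements `x b ⊗ y - x ⊗ b y`. These elements
are permuted by the actions of `a ∈ A` and `c ∈ C`, so it is also the additive subgroup that they
generate. -/
def PreTensor.relations (X : Bimod O A B) (Y : Bimod O B C) :
    Submodule (A ⊗[O] Cᵐᵒᵖ) (PreTensor X Y) :=
  Submodule.span (A ⊗[O] Cᵐᵒᵖ)
    {t : X ⊗[O] Y | ∃ (x : X) (b : B) (y : Y),
      t = X.right (MulOpposite.op b) x ⊗ₜ[O] y - x ⊗ₜ[O] Y.left b y}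

/-- The `(A, C)`-bimodule `X ⊗_B Y`. -/
def tensorObj (X : Bimod O A B) (Y : Bimod O B C) : Bimod O A C :=
  ModuleCat.of (A ⊗[O] Cᵐᵒᵖ) (PreTensor X Y ⧸ PreTensor.relations X Y)

/-- The bimodule homomorphism `X ⊗_O Y → X' ⊗_O Y'` induced by `f` and `g`. -/
def PreTensor.map {X X' : Bimod O A B} {Y Y' : Bimod O B C} (f : X ⟶ X') (g : Y ⟶ Y') :
    PreTensor X Y →ₗ[A ⊗[O] Cᵐᵒᵖ] PreTensor X' Y' where
  toFun := TensorProduct.map (Bimod.linear f) (Bimod.linear g)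
  map_add' := map_add _
  map_smul' r t := by
    change X ⊗[O] Y at t
    change TensorProduct.map (Bimod.linear f) (Bimod.linear g) (PreTensor.action X Y r t) =
      PreTensor.action X' Y' r (TensorProduct.map (Bimod.linear f) (Bimod.linear g) t)
    induction r with
    | zero => rw [map_zero, map_zero, LinearMap.zero_apply, LinearMap.zero_apply, map_zero]
    | add r s hr hs =>
      rw [map_add, map_add, LinearMap.add_apply, LinearMap.add_apply, map_add, hr, hs]
    | tmul a c =>
      induction t with
      | zero => simp only [map_zero]
      | add s t hs ht => simp only [map_add, hs, ht]
      | tmul x y =>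
        rw [PreTensor.action_tmul, TensorProduct.map_tmul, TensorProduct.map_tmul,
          PreTensor.action_tmul]
        exact congrArg₂ (fun x y => x ⊗ₜ[O] y) (Bimod.hom_left f a x) (Bimod.hom_right g c y)

/-- The bimodule homomorphism `X ⊗_B Y → X' ⊗_B Y'` induced by `f` and `g`. -/
def tensorMap {X X' : Bimod O A B} {Y Y' : Bimod O B C} (f : X ⟶ X') (g : Y ⟶ Y') :
    tensorObj X Y ⟶ tensorObj X' Y' :=
  ModuleCat.ofHom (Submodule.mapQ _ _ (PreTensor.map f g) (by
    rw [PreTensor.relations, Submodule.span_le]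
    rintro _ ⟨x, b, y, rfl⟩
    refine Submodule.subset_span ⟨f.hom x, b, g.hom y, ?_⟩
    change TensorProduct.map (Bimod.linear f) (Bimod.linear g) _ = _
    rw [map_sub, TensorProduct.map_tmul, TensorProduct.map_tmul]
    change f.hom _ ⊗ₜ[O] g.hom _ - f.hom _ ⊗ₜ[O] g.hom _ = _
    rw [Bimod.hom_right, Bimod.hom_left]))

/-- A pure tensor in `X ⊗_O Y`. -/
def PreTensor.tmul (X : Bimod O A B) (Y : Bimod O B C) (x : X) (y : Y) : PreTensor X Y :=
  x ⊗ₜ[O] y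

/-- The class in `X ⊗_B Y` of a pure tensor. -/
def tensorMk (X : Bimod O A B) (Y : Bimod O B C) (x : X) (y : Y) : tensorObj X Y :=
  (PreTensor.relations X Y).mkQ (PreTensor.tmul X Y x y)

lemma tensorMap_mk {X X' : Bimod O A B} {Y Y' : Bimod O B C} (f : X ⟶ X') (g : Y ⟶ Y')
    (x : X) (y : Y) :
    (tensorMap f g).hom (tensorMk X Y x y) = tensorMk X' Y' (f.hom x) (g.hom y) := rfl

lemma tensor_hom_ext {X : Bimod O A B} {Y : Bimod O B C} {Z : Bimod O A C}
    {f g : tensorObj X Y ⟶ Z}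
    (h : ∀ x y, f.hom (tensorMk X Y x y) = g.hom (tensorMk X Y x y)) : f = g := by
  refine ModuleCat.hom_ext (Submodule.linearMap_qext _ (LinearMap.ext fun t => ?_))
  change X ⊗[O] Y at t
  induction t with
  | zero => exact (map_zero _).trans (map_zero _).symm
  | tmul x y => exact h x y
  | add s t hs ht => exact (map_add _ s t).trans ((congrArg₂ (· + ·) hs ht).trans
      (map_add _ s t).symm)

lemma tensorMk_add_left (X : Bimod O A B) (Y : Bimod O B C) (x x' : X) (y : Y) :
    tensorMk X Y (x + x') y = tensorMk X Y x y + tensorMk X Y x' y := by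
  unfold tensorMk PreTensor.tmul
  rw [TensorProduct.add_tmul]
  exact map_add _ _ _

lemma tensorMk_add_right (X : Bimod O A B) (Y : Bimod O B C) (x : X) (y y' : Y) :
    tensorMk X Y x (y + y') = tensorMk X Y x y + tensorMk X Y x y' := by
  unfold tensorMk PreTensor.tmul
  rw [TensorProduct.tmul_add]
  exact map_add _ _ _

variable (O A B C) in
/-- The tensor product over `B`, as a functor in two variables. -/
def tensorFunctor : Bimod O A B ⥤ Bimod O B C ⥤ Bimod O A C where
  obj X :=
    { obj := fun Y => tensorObj X Y
      map := fun g => tensorMap (𝟙 X) g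
      map_id := fun Y => tensor_hom_ext fun x y => rfl
      map_comp := fun f g => tensor_hom_ext fun x y => rfl }
  map f :=
    { app := fun Y => tensorMap f (𝟙 Y)
      naturality := fun Y Y' g => tensor_hom_ext fun x y => rfl }
  map_id X := by
    ext Y : 2
    exact tensor_hom_ext fun x y => rfl
  map_comp f g := by
    ext Y : 2
    exact tensor_hom_ext fun x y => rfl

instance : (tensorFunctor O A B C).Additive where
  map_add {X X' f g} := by
    ext Y : 2
    exact tensor_hom_ext fun x y => tensorMk_add_left X' Y (f.hom x) (g.hom x) y

instance (X : Bimod O A B) : ((tensorFunctor O A B C).obj X).Additive where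
  map_add {Y Y' f g} := tensor_hom_ext fun x y => tensorMk_add_right X Y' x (f.hom y) (g.hom y)

instance (Y : Bimod O B C) : ((tensorFunctor O A B C).flip.obj Y).Additive where
  map_add {X X' f g} := tensor_hom_ext fun x y => tensorMk_add_left X' Y (f.hom x) (g.hom x) y

/-- The `O`-module `Hom_O(X, O)`. -/
def DualSpace (X : Bimod O A B) : Type u := X →ₗ[O] O

instance (X : Bimod O A B) : AddCommGroup (DualSpace X) :=
  inferInstanceAs (AddCommGroup (X →ₗ[O] O))

/-- The action of `B` on `Hom_O(X, O)`: `(b φ)(x) = φ (x b)`. -/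
def DualSpace.left (X : Bimod O A B) : B →ₐ[O] Module.End O (X →ₗ[O] O) :=
  AlgHom.ofLinearMap
    { toFun := fun b => LinearMap.lcomp O O (X.right (MulOpposite.op b))
      map_add' := fun b b' => by ext φ x; simp
      map_smul' := fun r b => by ext φ x; simp }
    (by ext φ x; simp)
    (fun b b' => by ext φ x; simp)

/-- The action of `Aᵒᵖ` on `Hom_O(X, O)`: `(φ a)(x) = φ (a x)`. -/
def DualSpace.right (X : Bimod O A B) : Aᵐᵒᵖ →ₐ[O] Module.End O (X →ₗ[O] O) :=
  AlgHom.ofLinearMap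
    { toFun := fun a => LinearMap.lcomp O O (X.left (MulOpposite.unop a))
      map_add' := fun b b' => by ext φ x; simp
      map_smul' := fun r b => by ext φ x; simp }
    (by ext φ x; simp)
    (fun b b' => by ext φ x; simp)

lemma DualSpace.commute (X : Bimod O A B) (b : B) (a : Aᵐᵒᵖ) :
    Commute (DualSpace.left X b) (DualSpace.right X a) := by
  refine LinearMap.ext fun φ => LinearMap.ext fun x => ?_
  exact congrArg φ (LinearMap.congr_fun
    (X.left_right_commute a.unop (MulOpposite.op b)).eq x)

/-- The action of `B ⊗_O Aᵒᵖ` on `Hom_O(X, O)`: `(b φ a)(x) = φ (a x b)`. -/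
def DualSpace.action (X : Bimod O A B) : B ⊗[O] Aᵐᵒᵖ →ₐ[O] Module.End O (X →ₗ[O] O) :=
  Algebra.TensorProduct.lift (DualSpace.left X) (DualSpace.right X) (DualSpace.commute X)

instance (X : Bimod O A B) : Module (B ⊗[O] Aᵐᵒᵖ) (DualSpace X) :=
  Module.compHom (X →ₗ[O] O) (DualSpace.action X).toRingHom

/-- The `O`-dual `X^∨ = Hom_O(X, O)` of an `(A, B)`-bimodule, as a `(B, A)`-bimodule. -/
def dualObj (X : Bimod O A B) : Bimod O B A := ModuleCat.of (B ⊗[O] Aᵐᵒᵖ) (DualSpace X)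

/-- The homomorphism `Y^∨ → X^∨` dual to a bimodule homomorphism `X → Y`. -/
def dualMap {X Y : Bimod O A B} (f : X ⟶ Y) : dualObj Y ⟶ dualObj X :=
  ModuleCat.ofHom (X := DualSpace Y) (Y := DualSpace X)
    { toFun := fun φ => LinearMap.comp (show Y →ₗ[O] O from φ) (Bimod.linear f)
      map_add' := fun φ ψ => LinearMap.add_comp _ _ _
      map_smul' := fun r φ => by
        change Y →ₗ[O] O at φ
        change (DualSpace.action Y r φ).comp (Bimod.linear f) =
          DualSpace.action X r (φ.comp (Bimod.linear f))
        induction r with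
        | zero => simp
        | add r s hr hs => simp only [map_add, LinearMap.add_apply, LinearMap.add_comp, hr, hs]
        | tmul b a =>
          refine LinearMap.ext fun x => ?_
          change φ (Y.left a.unop (Y.right (MulOpposite.op b) (f.hom x))) =
            φ (f.hom (X.left a.unop (X.right (MulOpposite.op b) x)))
          rw [Bimod.hom_left, Bimod.hom_right] }

variable (O A B) in
/-- The `O`-dual, as a contravariant functor. -/
def dualFunctor : (Bimod O A B)ᵒᵖ ⥤ Bimod O B A where
  obj X := dualObj X.unop
  map f := dualMap f.unop
  map_id X := rfl
  map_comp f g := rfl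

instance : (dualFunctor O A B).Additive where
  map_add {X Y f g} := by
    refine ModuleCat.hom_ext (LinearMap.ext fun φ => ?_)
    change X.unop →ₗ[O] O at φ
    refine LinearMap.ext fun x => ?_
    exact map_add φ (f.unop.hom x) (g.unop.hom x)

/-! ### Morita equivalences -/

/-- The `(A, B)`-bimodule `M` induces a Morita equivalence between `A` and `B`: it is finitely
generated projective on either side, and `M ⊗_B -` is an equivalence from the category of left
`B`-modules to that of left `A`-modules. Here left `B`-modules with their `O`-module structure are
written as `(B, O)`-bimodules. -/
structure IsMorita (M : Bimod O A B) : Prop where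
  biprojective : M.IsBiprojective
  equivalence : ((tensorFunctor O A B O).obj M).IsEquivalence

/-! ### Rickard equivalences -/

/-- The dual complex `X^∨ = Hom_O(X, O)`, with `(X^∨)^n = (X^{-n})^∨`. -/
def dualComplex (X : CochainComplex (Bimod O A B) ℤ) : CochainComplex (Bimod O B A) ℤ where
  X n := dualObj (X.X (-n))
  d i j := dualMap (X.d (-j) (-i))
  shape i j h := by
    have h' : X.d (-j) (-i) = 0 := X.shape _ _ (fun h' => h (by
      simp only [ComplexShape.up_Rel] at h' ⊢
      omega))
    rw [h']
    exact (dualFunctor O A B).map_zero (Opposite.op (X.X (-i))) (Opposite.op (X.X (-j)))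
  d_comp_d' i j k _ _ := by
    have h : X.d (-k) (-j) ≫ X.d (-j) (-i) = 0 := X.d_comp_d _ _ _
    have h2 : dualMap (X.d (-j) (-i)) ≫ dualMap (X.d (-k) (-j)) =
      dualMap (X.d (-k) (-j) ≫ X.d (-j) (-i)) := rfl
    rw [h2, h]
    exact (dualFunctor O A B).map_zero (Opposite.op (X.X (-i))) (Opposite.op (X.X (-k)))

/-- The complex `X ⊗_B Y`: the total complex of the double complex of the `X^i ⊗_B Y^j`. -/
def tensorComplex (X : CochainComplex (Bimod O A B) ℤ) (Y : CochainComplex (Bimod O B C) ℤ) :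
    CochainComplex (Bimod O A C) ℤ :=
  HomologicalComplex.mapBifunctor X Y (tensorFunctor O A B C) (ComplexShape.up ℤ)

/-- A complex of bimodules is contractible: its identity map is homotopic to zero. -/
def IsContractible (X : CochainComplex (Bimod O A B) ℤ) : Prop :=
  Nonempty (Homotopy (𝟙 X) 0)

variable (O A) in
/-- The `(A, A)`-bimodule `A`, as a complex concentrated in degree zero. -/
def regularComplex : CochainComplex (Bimod O A A) ℤ :=
  (HomologicalComplex.single (Bimod O A A) (ComplexShape.up ℤ) 0).obj (Bimod.regular O A)

/-- A Rickard complex of `(A, B)`-bimodules: a bounded complex of bimodules that are finitely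
generated projective on either side, such that `X ⊗_B X^∨ ≅ A ⊕ Y` and `X^∨ ⊗_A X ≅ B ⊕ Z` as
complexes of bimodules, with `Y` and `Z` contractible. -/
structure IsRickard (X : CochainComplex (Bimod O A B) ℤ) : Prop where
  bounded : ∃ m n : ℤ, ∀ i, i < m ∨ n < i → IsZero (X.X i)
  biprojective : ∀ i, (X.X i).IsBiprojective
  left : ∃ Y : CochainComplex (Bimod O A A) ℤ, IsContractible Y ∧
    Nonempty (tensorComplex X (dualComplex X) ≅ regularComplex O A ⊞ Y)
  right : ∃ Z : CochainComplex (Bimod O B B) ℤ, IsContractible Z ∧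
    Nonempty (tensorComplex (dualComplex X) X ≅ regularComplex O B ⊞ Z)

end Bimodules

/-! ### Grothendieck groups with respect to split exact sequences -/

section Grothendieck

/-- Finitely generated left modules over `R`. -/
abbrev FGMod (R : Type u) [Ring R] : Type (u + 1) := {M : ModuleCat.{u} R // Module.Finite R M}

/-- The relations `[S₂] = [S₁] + [S₃]`, for all split short exact sequences
`0 → S₁ → S₂ → S₃ → 0` of finitely generated modules. -/
def splitRelations (R : Type u) [Ring R] : Set (FreeAbelianGroup (FGMod R)) :=
  {x | ∃ (S : ShortComplex (ModuleCat.{u} R)) (h₁ : Module.Finite R S.X₁)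
    (h₂ : Module.Finite R S.X₂) (h₃ : Module.Finite R S.X₃), Nonempty S.Splitting ∧
    x = FreeAbelianGroup.of (⟨S.X₂, h₂⟩ : FGMod R) -
      FreeAbelianGroup.of (⟨S.X₁, h₁⟩ : FGMod R) -
      FreeAbelianGroup.of (⟨S.X₃, h₃⟩ : FGMod R)}

/-- The Grothendieck group of the category of finitely generated left `R`-modules, with respect
to split exact sequences. -/
def SplitK0 (R : Type u) [Ring R] : Type (u + 1) :=
  FreeAbelianGroup (FGMod R) ⧸ AddSubgroup.closure (splitRelations R)

instance (R : Type u) [Ring R] : AddCommGroup (SplitK0 R) :=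
  inferInstanceAs (AddCommGroup (_ ⧸ AddSubgroup.closure (splitRelations R)))

/-- The element `[M]` of the Grothendieck group. -/
def SplitK0.cls {R : Type u} [Ring R] (M : FGMod R) : SplitK0 R :=
  QuotientAddGroup.mk' (AddSubgroup.closure (splitRelations R)) (FreeAbelianGroup.of M)

lemma SplitK0.cls_split {R : Type u} [Ring R] (S : ShortComplex (ModuleCat.{u} R))
    (h₁ : Module.Finite R S.X₁) (h₂ : Module.Finite R S.X₂) (h₃ : Module.Finite R S.X₃)
    (s : S.Splitting) :
    SplitK0.cls (⟨S.X₂, h₂⟩ : FGMod R) =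
      SplitK0.cls (⟨S.X₁, h₁⟩ : FGMod R) + SplitK0.cls (⟨S.X₃, h₃⟩ : FGMod R) := by
  have h : QuotientAddGroup.mk' (AddSubgroup.closure (splitRelations R))
      (FreeAbelianGroup.of (⟨S.X₂, h₂⟩ : FGMod R) -
      FreeAbelianGroup.of (⟨S.X₁, h₁⟩ : FGMod R) -
      FreeAbelianGroup.of (⟨S.X₃, h₃⟩ : FGMod R)) = 0 :=
    (QuotientAddGroup.eq_zero_iff _).2
      (AddSubgroup.subset_closure ⟨S, h₁, h₂, h₃, ⟨s⟩, rfl⟩)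
  rw [map_sub, map_sub, sub_sub, sub_eq_zero] at h
  exact h

/-- A function on finitely generated modules that is additive on split exact sequences induces a
homomorphism on the Grothendieck group. -/
def SplitK0.lift {R : Type u} [Ring R] {T : Type*} [AddCommGroup T] (f : FGMod R → T)
    (hf : ∀ (S : ShortComplex (ModuleCat.{u} R)) (h₁ : Module.Finite R S.X₁)
      (h₂ : Module.Finite R S.X₂) (h₃ : Module.Finite R S.X₃), S.Splitting →
      f ⟨S.X₂, h₂⟩ = f ⟨S.X₁, h₁⟩ + f ⟨S.X₃, h₃⟩) : SplitK0 R →+ T :=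
  QuotientAddGroup.lift _ (FreeAbelianGroup.lift f) (by
    rw [AddSubgroup.closure_le]
    rintro _ ⟨S, h₁, h₂, h₃, ⟨s⟩, rfl⟩
    simp only [SetLike.mem_coe, AddMonoidHom.mem_ker, map_sub, FreeAbelianGroup.lift_apply_of]
    rw [hf S h₁ h₂ h₃ s]
    abel)

@[simp] lemma SplitK0.lift_cls {R : Type u} [Ring R] {T : Type*} [AddCommGroup T] (f : FGMod R → T)
    (hf) (M : FGMod R) : SplitK0.lift f hf (SplitK0.cls M) = f M :=
  FreeAbelianGroup.lift_apply_of f M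

lemma SplitK0.hom_ext {R : Type u} [Ring R] {T : Type*} [AddCommGroup T] {f g : SplitK0 R →+ T}
    (h : ∀ M, f (SplitK0.cls M) = g (SplitK0.cls M)) : f = g :=
  QuotientAddGroup.addMonoidHom_ext _ (FreeAbelianGroup.lift_ext _ _ h)

variable {O : Type u} [CommRing O]
variable {A B C : Type u} [Ring A] [Algebra O A] [Ring B] [Algebra O B] [Ring C] [Algebra O C]

variable (O A B) in
/-- The group `R(A, B)`: the Grothendieck group, with respect to split exact sequences, of
finitely generated `(A, B)`-bimodules. -/
abbrev BimodK0 : Type (u + 1) := SplitK0 (A ⊗[O] Bᵐᵒᵖ)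

lemma Bimod.finite_base [Module.Finite O A] [Module.Finite O B] (X : Bimod O A B)
    [Module.Finite (A ⊗[O] Bᵐᵒᵖ) X] : Module.Finite O X :=
  have : Module.Finite O Bᵐᵒᵖ := Module.Finite.equiv (MulOpposite.opLinearEquiv O)
  Module.Finite.trans (A ⊗[O] Bᵐᵒᵖ) X

lemma tensorObj_finite [Module.Finite O A] [Module.Finite O B] [Module.Finite O C]
    (X : Bimod O A B) (Y : Bimod O B C)
    (hX : Module.Finite (A ⊗[O] Bᵐᵒᵖ) X) (hY : Module.Finite (B ⊗[O] Cᵐᵒᵖ) Y) :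
    Module.Finite (A ⊗[O] Cᵐᵒᵖ) (tensorObj X Y) := by
  have := X.finite_base
  have := Y.finite_base
  have : Module.Finite O (PreTensor X Y) := inferInstanceAs (Module.Finite O (X ⊗[O] Y))
  have : IsScalarTower O (A ⊗[O] Cᵐᵒᵖ) (PreTensor X Y) := IsScalarTower.of_algebraMap_smul
    (R := O) (A := A ⊗[O] Cᵐᵒᵖ) (M := PreTensor X Y) (fun r t => by
      change PreTensor.action X Y (algebraMap O (A ⊗[O] Cᵐᵒᵖ) r) t = r • t
      rw [AlgHom.commutes]
      rfl)
  have : Module.Finite (A ⊗[O] Cᵐᵒᵖ) (PreTensor X Y) :=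
    Module.Finite.of_restrictScalars_finite O _ _
  exact inferInstanceAs (Module.Finite (A ⊗[O] Cᵐᵒᵖ) (PreTensor X Y ⧸ PreTensor.relations X Y))

lemma dualObj_finite [IsNoetherianRing O] [Module.Finite O A] [Module.Finite O B]
    (X : Bimod O A B) (hX : Module.Finite (A ⊗[O] Bᵐᵒᵖ) X) :
    Module.Finite (B ⊗[O] Aᵐᵒᵖ) (dualObj X) := by
  have := X.finite_base
  let _ : Module O (DualSpace X) := inferInstanceAs (Module O (X →ₗ[O] O))
  have : Module.Finite O (DualSpace X) := by
    obtain ⟨n, f, hf⟩ := Module.Finite.exists_fin' O X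
    have : Module.Finite O ((Fin n → O) →ₗ[O] O) := inferInstance
    exact Module.Finite.of_injective (N := (Fin n → O) →ₗ[O] O) (LinearMap.lcomp O O f)
      (fun φ ψ h => (LinearMap.cancel_right hf).1 h)
  have : IsScalarTower O (B ⊗[O] Aᵐᵒᵖ) (DualSpace X) := IsScalarTower.of_algebraMap_smul
    (R := O) (A := B ⊗[O] Aᵐᵒᵖ) (M := DualSpace X) (fun r t => by
      change DualSpace.action X (algebraMap O (B ⊗[O] Aᵐᵒᵖ) r) t = r • t
      rw [AlgHom.commutes]
      rfl)
  exact (Module.Finite.of_restrictScalars_finite O (B ⊗[O] Aᵐᵒᵖ) (DualSpace X) :)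

/-- The product `R(A, B) × R(B, C) → R(A, C)` with `[X] · [Y] = [X ⊗_B Y]`. -/
def BimodK0.mul [Module.Finite O A] [Module.Finite O B] [Module.Finite O C] :
    BimodK0 O A B →+ BimodK0 O B C →+ BimodK0 O A C :=
  SplitK0.lift
    (fun X => SplitK0.lift
      (fun Y => SplitK0.cls ⟨tensorObj X.1 Y.1, tensorObj_finite X.1 Y.1 X.2 Y.2⟩)
      (fun S h₁ h₂ h₃ s => SplitK0.cls_split (S.map ((tensorFunctor O A B C).obj X.1))
        (tensorObj_finite X.1 S.X₁ X.2 h₁) (tensorObj_finite X.1 S.X₂ X.2 h₂)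
        (tensorObj_finite X.1 S.X₃ X.2 h₃) (s.map _)))
    (fun S h₁ h₂ h₃ s => SplitK0.hom_ext (fun Y => by
      simp only [AddMonoidHom.add_apply]
      exact SplitK0.cls_split (S.map ((tensorFunctor O A B C).flip.obj Y.1))
        (tensorObj_finite S.X₁ Y.1 h₁ Y.2) (tensorObj_finite S.X₂ Y.1 h₂ Y.2)
        (tensorObj_finite S.X₃ Y.1 h₃ Y.2) (s.map _)))

/-- The homomorphism `R(A, B) → R(B, A)` with `[X]^∨ = [X^∨]`. -/
def BimodK0.dual [IsNoetherianRing O] [Module.Finite O A] [Module.Finite O B] :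
    BimodK0 O A B →+ BimodK0 O B A :=
  SplitK0.lift
    (fun X => SplitK0.cls ⟨dualObj X.1, dualObj_finite X.1 X.2⟩)
    (fun S h₁ h₂ h₃ s => (SplitK0.cls_split (S.op.map (dualFunctor O A B))
        (dualObj_finite S.X₃ h₃) (dualObj_finite S.X₂ h₂)
        (dualObj_finite S.X₁ h₁) (s.op.map _)).trans (add_comm _ _))

lemma Bimod.IsBiprojective.finite {X : Bimod O A B} (hX : X.IsBiprojective) :
    Module.Finite (A ⊗[O] Bᵐᵒᵖ) X := by
  obtain ⟨s, hs⟩ := hX.left_finite.fg_top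
  refine ⟨⟨s, eq_top_iff.2 fun x _ => ?_⟩⟩
  have hx : x ∈ Submodule.span A (s : Set X.leftModule) := by rw [hs]; trivial
  induction hx using Submodule.span_induction with
  | mem x h => exact Submodule.subset_span h
  | zero => exact Submodule.zero_mem _
  | add x y _ _ hx hy => exact Submodule.add_mem _ (hx trivial) (hy trivial)
  | smul a x _ hx =>
    exact Submodule.smul_mem _ ((Algebra.TensorProduct.includeLeft : A →ₐ[O] A ⊗[O] Bᵐᵒᵖ) a)
      (hx trivial)

/-- The element `[X]` of `R(A, B)`, for a bimodule that is finitely generated projective on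
either side. -/
def Bimod.IsBiprojective.cls {X : Bimod O A B} (hX : X.IsBiprojective) : BimodK0 O A B :=
  SplitK0.cls ⟨X, hX.finite⟩

variable (O A B) in
/-- The subgroup `P(A, B)` of `R(A, B)` generated by the `[X]`, where `X` is a bimodule that is
finitely generated projective as a left module and as a right module. -/
def projK0 : AddSubgroup (BimodK0 O A B) :=
  AddSubgroup.closure {x | ∃ (X : Bimod O A B) (hX : X.IsBiprojective), x = hX.cls}

lemma Bimod.regular_finite : Module.Finite (A ⊗[O] Aᵐᵒᵖ) (Bimod.regular O A) := by
  let f : (A ⊗[O] Aᵐᵒᵖ) →ₗ[A ⊗[O] Aᵐᵒᵖ] Bimod.regular O A :=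
    LinearMap.toSpanSingleton _ _ (show A from 1)
  refine Module.Finite.of_surjective f (fun x => ⟨(show A from x) ⊗ₜ[O] (1 : Aᵐᵒᵖ), ?_⟩)
  change (show A from x) • (1 : Aᵐᵒᵖ) • (1 : A) = x
  rw [one_smul, smul_eq_mul, mul_one]

variable (O A) in
/-- The element `[A]` of `R(A, A)`. -/
def regularCls : BimodK0 O A A := SplitK0.cls ⟨Bimod.regular O A, Bimod.regular_finite⟩

/-- `M ∈ P(A, B)` and `N ∈ P(B, A)` induce a virtual Morita equivalence between `A` and `B`:
`M · N = [A]` in `R(A, A)` and `N · M = [B]` in `R(B, B)`. -/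
structure IsVirtualMorita [Module.Finite O A] [Module.Finite O B]
    (M : BimodK0 O A B) (N : BimodK0 O B A) : Prop where
  left_mem : M ∈ projK0 O A B
  right_mem : N ∈ projK0 O B A
  mul_eq : BimodK0.mul M N = regularCls O A
  mul_eq' : BimodK0.mul N M = regularCls O B

end Grothendieck

/-! ### Representations: relative projectivity, vertices, sources, `p`-permutation modules -/

section Representations

variable {O Γ : Type u} [CommRing O] [Group Γ]

/-- The `OΓ`-module `U` is relatively `P`-projective: it is isomorphic to a direct summand of
`Ind_P^Γ(V)` for some `OP`-module `V`. -/
def IsRelProjective (P : Subgroup Γ) (U : Rep.{u} O Γ) : Prop :=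
  ∃ V : Rep.{u} O P, Nonempty (Retract U (Rep.ind P.subtype V))

/-- The subgroup `P` is a vertex of `U`: it is minimal among the `p`-subgroups for which `U` is
relatively projective. -/
structure IsVertex (p : ℕ) (P : Subgroup Γ) (U : Rep.{u} O Γ) : Prop where
  isPGroup : IsPGroup p P
  relProjective : IsRelProjective P U
  minimal : ∀ Q : Subgroup Γ, Q ≤ P → IsRelProjective Q U → Q = P

/-- `U` is an indecomposable finitely generated `OΓ`-module with trivial source: for some vertex
`P` of `U`, it is isomorphic to a direct summand of `Ind_P^Γ(O)`. -/
structure HasTrivialSource (p : ℕ) (U : Rep.{u} O Γ) : Prop where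
  finite : Module.Finite O U
  indecomposable : Indecomposable U
  source : ∃ P : Subgroup Γ, IsVertex p P U ∧
    Nonempty (Retract U (Rep.ind P.subtype (Rep.trivial O P O)))

/-- `U` is a `p`-permutation module: a finitely generated `OΓ`-module which has, for every
`p`-subgroup `P` of `Γ`, a `P`-stable `O`-basis. -/
structure IsPPermutation (p : ℕ) (U : Rep.{u} O Γ) : Prop where
  finite : Module.Finite O U
  exists_basis : ∀ P : Subgroup Γ, IsPGroup p P →
    ∃ (ι : Type u) (β : Module.Basis ι O U), ∀ g ∈ P, ∀ i, ∃ j, U.ρ g (β i) = β j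

variable (Γ) in
/-- Extension of scalars `O' ⊗_O -` for representations. -/
def baseChange (O O' : Type u) [CommRing O] [CommRing O'] [Algebra O O'] :
    Rep.{u} O Γ ⥤ Rep.{u} O' Γ where
  obj V := Rep.of (X := O' ⊗[O] V)
    { toFun := fun g => LinearMap.baseChange O' (V.ρ g)
      map_one' := by rw [map_one]; exact LinearMap.baseChange_id
      map_mul' := fun g h => by rw [map_mul]; exact LinearMap.baseChange_comp _ _ }
  map {V W} f := Rep.ofHom
    { toLinearMap := LinearMap.baseChange O' f.hom.toLinearMap
      isIntertwining' := fun g => by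
        change LinearMap.baseChange O' f.hom.toLinearMap ∘ₗ LinearMap.baseChange O' (V.ρ g) =
          LinearMap.baseChange O' (W.ρ g) ∘ₗ LinearMap.baseChange O' f.hom.toLinearMap
        rw [← LinearMap.baseChange_comp, ← LinearMap.baseChange_comp, f.hom.isIntertwining' g] }
  map_id V := by
    refine Rep.hom_ext (Representation.IntertwiningMap.ext ?_)
    ext x
    rfl
  map_comp f g := by
    refine Rep.hom_ext (Representation.IntertwiningMap.ext ?_)
    ext x
    rfl

instance (O O' : Type u) [CommRing O] [CommRing O'] [Algebra O O'] :
    (baseChange Γ O O').Additive where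
  map_add {V W f g} := by
    refine Rep.hom_ext (Representation.IntertwiningMap.ext ?_)
    exact LinearMap.baseChange_add f.hom.toLinearMap g.hom.toLinearMap

end Representations

/-! ### Bimodules over block algebras -/

section BlockBimodules

variable {O G H : Type u} [CommRing O] [Group G] [Group H]
variable {b : MonoidAlgebra O G} {c : MonoidAlgebra O H}

/-- The monoid homomorphism `G × H → OGb ⊗_O (OHc)ᵒᵖ`, `(g, h) ↦ g b ⊗ h⁻¹ c`. -/
def groupHom (hb : IsBlock b) (hc : IsBlock c) : G × H →* hb.Alg ⊗[O] (hc.Alg)ᵐᵒᵖ where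
  toFun x := hb.ofGroup x.1 ⊗ₜ[O] MulOpposite.op (hc.ofGroup x.2⁻¹)
  map_one' := by simp [Algebra.TensorProduct.one_def]
  map_mul' x y := by simp

/-- An `(OGb, OHc)`-bimodule `M`, regarded as an `O(G × H)`-module through
`(g, h) m = g m h⁻¹`. -/
def toRep (hb : IsBlock b) (hc : IsBlock c) : Bimod O hb.Alg hc.Alg ⥤ Rep.{u} O (G × H) where
  obj M := Rep.of (X := M)
    ((M.act : hb.Alg ⊗[O] (hc.Alg)ᵐᵒᵖ →* Module.End O M).comp (groupHom hb hc))
  map {M N} f := Rep.ofHom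
    { toLinearMap := Bimod.linear f
      isIntertwining' := fun g => LinearMap.ext fun x => f.hom.map_smul (groupHom hb hc g) x }
  map_id M := rfl
  map_comp f g := rfl

instance (hb : IsBlock b) (hc : IsBlock c) : (toRep hb hc).Additive where
  map_add := rfl

/-- A splendid Rickard complex: a Rickard complex whose terms are `p`-permutation bimodules. -/
structure IsSplendid (p : ℕ) (hb : IsBlock b) (hc : IsBlock c)
    (X : CochainComplex (Bimod O hb.Alg hc.Alg) ℤ) : Prop where
  rickard : IsRickard X
  pPermutation : ∀ i, IsPPermutation p ((toRep hb hc).obj (X.X i))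

/-- `M` and its dual induce a `p`-permutation equivalence between `OGb` and `OHc`: they induce a
virtual Morita equivalence, and `M = [M₀] - [M₁]` for `p`-permutation bimodules `M₀`, `M₁` that
are finitely generated projective as left and as right modules. -/
structure IsPPermutationEquivalence (p : ℕ) [IsNoetherianRing O] [Finite G] [Finite H]
    (hb : IsBlock b) (hc : IsBlock c) (M : BimodK0 O hb.Alg hc.Alg) : Prop where
  virtualMorita : IsVirtualMorita M (BimodK0.dual M)
  pPermutation : ∃ (M₀ M₁ : Bimod O hb.Alg hc.Alg) (h₀ : M₀.IsBiprojective)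
    (h₁ : M₁.IsBiprojective), IsPPermutation p ((toRep hb hc).obj M₀) ∧
    IsPPermutation p ((toRep hb hc).obj M₁) ∧ M = h₀.cls - h₁.cls

end BlockBimodules

/-! ### Extensions of coefficient rings -/

section Extension

variable {O O' G H : Type u} [CommRing O] [CommRing O'] [Algebra O O'] [Group G] [Group H]

/-- The `(O'Gb', O'Hc')`-bimodule `M'` is isomorphic to a direct summand of `O' ⊗_O M`. Both are
`(O'G, O'H)`-bimodules, that is, `O'(G × H)`-modules. -/
def IsSummandOfExtension {b : MonoidAlgebra O G} {c : MonoidAlgebra O H}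
    {b' : MonoidAlgebra O' G} {c' : MonoidAlgebra O' H}
    (hb : IsBlock b) (hc : IsBlock c) (hb' : IsBlock b') (hc' : IsBlock c')
    (M' : Bimod O' hb'.Alg hc'.Alg) (M : Bimod O hb.Alg hc.Alg) : Prop :=
  Nonempty (Retract ((toRep hb' hc').obj M')
    ((baseChange (G × H) O O').obj ((toRep hb hc).obj M)))

/-- The complex `X'` of `(O'Gb', O'Hc')`-bimodules is isomorphic to a direct summand of
`O' ⊗_O X`, as a complex of `(O'G, O'H)`-bimodules. -/
def IsSummandOfExtensionComplex {b : MonoidAlgebra O G} {c : MonoidAlgebra O H}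
    {b' : MonoidAlgebra O' G} {c' : MonoidAlgebra O' H}
    (hb : IsBlock b) (hc : IsBlock c) (hb' : IsBlock b') (hc' : IsBlock c')
    (X' : CochainComplex (Bimod O' hb'.Alg hc'.Alg) ℤ)
    (X : CochainComplex (Bimod O hb.Alg hc.Alg) ℤ) : Prop :=
  Nonempty (Retract
    (((toRep hb' hc').mapHomologicalComplex (ComplexShape.up ℤ)).obj X')
    (((toRep hb hc ⋙ baseChange (G × H) O O').mapHomologicalComplex (ComplexShape.up ℤ)).obj X))

/-- For `a ∈ O'G`, the subfield `k[a]` of the residue field `k'` of `O'` generated by the residue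
field `k` of `O` and the images in `k'` of the coefficients of `a`. -/
def coefficientField (O : Type u) {O' G : Type u} [CommRing O] [IsLocalRing O] [CommRing O']
    [IsLocalRing O'] [Algebra O O'] [IsLocalHom (algebraMap O O')] (a : MonoidAlgebra O' G) :
    IntermediateField (IsLocalRing.ResidueField O) (IsLocalRing.ResidueField O') :=
  IntermediateField.adjoin (IsLocalRing.ResidueField O)
    (Set.range fun g => IsLocalRing.residue O' (a.coeff g))

end Extension

end BlockDescent

end

noncomputable section

namespace BlockDescent

/-! ### Finite algebras over complete local rings -/

section Complete

/-! The point is that `OGb` and `O'Gb'` are the same ring. As both rings are unramified, the maximal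
ideal of `O` generates that of `O'`, so `O'` is finite and free over `O`, and the extension `k'/k`
of finite fields is Galois. Since `k' = k[b']`, a nontrivial Galois automorphism moves the image of
`b'` in `k'G` to a different block, hence to one orthogonal to it. The sum of all the conjugates is
a central idempotent of `kG` lying under the reduction of `b`, which is primitive because central
idempotents lift; so the two are equal. It follows that `x ↦ x b'` is an isomorphism from the
reduction of `OGb` to that of `O'Gb'`, and Nakayama's lemma makes `OGb → O'Gb'` bijective
(`blockHom_bijective`). The same holds for `c` and `c'`.

The required objects over `O` are therefore the given ones over `O'`, with coefficients restricted
along these isomorphisms (`resBimod`). It remains to compare the constructions.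

Tensor products: balancing over `B'` already forces balancing over `O'`, because `O'` acts through
`B'`; so `X ⊗_B Y` and `X ⊗_{B'} Y` agree (`resTensorHom_bijective`). Duals: there is a linear form
`τ` on `O'` for which `(x, y) ↦ τ (x y)` is a perfect pairing over `O`
(`exists_bijective_mul_form`), and composition with `τ` identifies `Hom_{O'}(X, O')` with `Hom_O(X,
O)` (`resDualHom_bijective`). Both identifications are natural, so they pass to complexes and to
Grothendieck groups; this gives the Morita, Rickard and virtual Morita statements.

Summands: a separability idempotent `∑ xᵢ ⊗ yᵢ` of `O'` over `O` splits the multiplication map `O'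
⊗_O X → X`, naturally in `X`.

Sources: an `O`-basis of `O'` times a `P`-stable basis is a `P`-stable basis, so `p`-permutation
modules restrict to such modules. Every endomorphism of the restricted bimodule commutes with the
left action of `OGb`, hence with `O'`, so indecomposability survives. Averaging with the
separability idempotent shows that restriction creates no smaller vertex. Finally `O'` is a direct
sum of copies of `O` as a trivial module, and locality of the endomorphism ring singles out one of
them (`RepRestriction.hasTrivialSource`). -/

theorem isAdicComplete_of_finite {O M : Type u} [CommRing O] [IsNoetherianRing O] (I : Ideal O)
    [IsAdicComplete I O] [AddCommGroup M] [Module O M] [Module.Finite O M] :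
    IsAdicComplete I M := by
  rw [← AdicCompletion.of_bijective_iff]
  have h := AdicCompletion.ofTensorProduct_bijective_of_finite_of_isNoetherian I M
  have h1 : Function.Bijective (AdicCompletion.of I O) :=
    AdicCompletion.of_bijective_iff.2 inferInstance
  let e : O ≃ₗ[O] AdicCompletion I O := LinearEquiv.ofBijective _ h1
  let f : M ≃ₗ[O] AdicCompletion I O ⊗[O] M :=
    (TensorProduct.lid O M).symm ≪≫ₗ LinearEquiv.rTensor M e
  have : (AdicCompletion.of I M : M → _) = AdicCompletion.ofTensorProduct I M ∘ f := by
    funext m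
    simp only [Function.comp_apply]
    change _ = AdicCompletion.ofTensorProduct I M (LinearMap.rTensor M (e : O →ₗ[O] _) (1 ⊗ₜ[O] m))
    rw [LinearMap.rTensor_tmul, AdicCompletion.ofTensorProduct_tmul]
    change _ = (AdicCompletion.of I O 1) • _
    have : AdicCompletion.of I O 1 = 1 := rfl
    rw [this, one_smul]
  rw [this]
  exact h.comp f.bijective

/-- Hensel's lemma for `X ^ 2 - X`: modulo `J` the derivative `2a - 1` squares to `1`, so it is a
unit. -/
theorem exists_isIdempotentElem_sub_mem {R : Type*} [CommRing R] (J : Ideal R) [IsAdicComplete J R]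
    (a : R) (ha : a * a - a ∈ J) : ∃ e : R, IsIdempotentElem e ∧ e - a ∈ J := by
  open Polynomial in
  have h : ((X ^ 2 - X : R[X])).Monic := by
    have : (X ^ 2 - X : R[X]) = X ^ 2 + (- X) := sub_eq_add_neg _ _
    rw [this]
    refine monic_X_pow_add ?_
    rw [degree_neg]
    exact degree_X_le.trans_lt (by norm_num)
  obtain ⟨e, he, hea⟩ := HenselianRing.is_henselian (I := J) _ h a
    (by simpa [pow_two] using ha) (by
      have h0 : (Ideal.Quotient.mk J a) * (Ideal.Quotient.mk J a) = Ideal.Quotient.mk J a := by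
        rw [← map_mul, ← sub_eq_zero, ← map_sub]
        exact Ideal.Quotient.eq_zero_iff_mem.2 ha
      refine IsUnit.of_mul_eq_one (2 * Ideal.Quotient.mk J a - 1) ?_
      rw [derivative_sub]
      simp only [derivative_X_pow, derivative_X, eval_sub, eval_mul, eval_one,
        map_sub, map_one, Polynomial.eval_natCast, Polynomial.eval_pow, Polynomial.eval_X,
        map_mul, map_natCast, map_pow]
      norm_num
      linear_combination 4 * h0)
  refine ⟨e, ?_, hea⟩
  have : e ^ 2 - e = 0 := by simpa using he
  rw [IsIdempotentElem, ← pow_two]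
  exact sub_eq_zero.1 this

theorem isIdempotentElem_pow_of_finite {R : Type*} [Monoid R] [Finite R] (x : R) :
    ∃ n, 0 < n ∧ IsIdempotentElem (x ^ n) := by
  obtain ⟨i, j, hij, h⟩ : ∃ i j, i < j ∧ x ^ i = x ^ j := by
    obtain ⟨i, j, hne, h⟩ := Finite.exists_ne_map_eq_of_infinite fun n : ℕ => x ^ n
    rcases lt_or_gt_of_ne hne with h' | h'
    · exact ⟨i, j, h', h⟩
    · exact ⟨j, i, h', h.symm⟩
  obtain ⟨d, rfl⟩ := Nat.exists_eq_add_of_lt hij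
  have h1 : ∀ n, i ≤ n → ∀ k, x ^ (n + k * (d + 1)) = x ^ n := by
    intro n hn k
    induction k with
    | zero => simp
    | succ k ih =>
      obtain ⟨m, rfl⟩ := Nat.exists_eq_add_of_le hn
      rw [← ih, show i + m + (k + 1) * (d + 1) = (i + d + 1) + (m + k * (d + 1)) by ring, pow_add,
        ← h, ← pow_add]
      congr 1
      ring
  -- From the exponent `i` on, powers have period `d + 1`. The chosen exponent is at least `i` and a
  -- multiple of the period, so doubling it changes nothing.
  refine ⟨(i + 1) * (d + 1), by positivity, ?_⟩
  rw [IsIdempotentElem, ← pow_add]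
  exact h1 _ (by nlinarith) _

/-- A finite quotient of a finite module over a local ring with finite residue field. -/
theorem finite_quotient_of_smul_le {O M : Type*} [CommRing O] [IsLocalRing O]
    [Finite (IsLocalRing.ResidueField O)] [AddCommGroup M] [Module O M] [Module.Finite O M]
    (N : Submodule O M) (hN : IsLocalRing.maximalIdeal O • (⊤ : Submodule O M) ≤ N) :
    Finite (M ⧸ N) := by
  obtain ⟨n, f, hf⟩ := Module.Finite.exists_fin' O M
  refine Finite.of_surjective (α := Fin n → IsLocalRing.ResidueField O)
    (fun v => N.mkQ (f fun i => Function.surjInv IsLocalRing.residue_surjective (v i)))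
    fun y => ?_
  obtain ⟨m, rfl⟩ := N.mkQ_surjective y
  obtain ⟨w, rfl⟩ := hf m
  refine ⟨fun i => IsLocalRing.residue O (w i), ?_⟩
  dsimp only
  rw [← sub_eq_zero, ← map_sub, ← map_sub, Submodule.mkQ_apply, Submodule.Quotient.mk_eq_zero]
  refine hN ?_
  rw [LinearMap.pi_apply_eq_sum_univ f]
  refine Submodule.sum_mem _ fun i _ => Submodule.smul_mem_smul ?_ trivial
  rw [← IsLocalRing.residue_eq_zero_iff, Pi.sub_apply, map_sub, sub_eq_zero]
  exact Function.surjInv_eq IsLocalRing.residue_surjective _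

/-- An algebra without nontrivial idempotents is local. Inside the commutative complete ring `O[x]`,
some power of `x` is idempotent modulo the maximal ideal of `O`, because that quotient is finite;
its lift is `0` or `1`. In the first case `1 - x ^ n`, and with it its divisor `1 - x`, is a unit;
in the second `x ^ n` is. -/
theorem isUnit_or_isUnit_one_sub {O E : Type u} [CommRing O] [IsNoetherianRing O] [IsLocalRing O]
    [IsAdicComplete (IsLocalRing.maximalIdeal O) O] [Finite (IsLocalRing.ResidueField O)]
    [Ring E] [Algebra O E] [Module.Finite O E]
    (hE : ∀ e : E, IsIdempotentElem e → e = 0 ∨ e = 1) (x : E) : IsUnit x ∨ IsUnit (1 - x) := by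
  let R := Algebra.adjoin O {x}
  have : IsMulCommutative R := Algebra.isMulCommutative_adjoin O (by rintro _ rfl _ rfl; rfl)
  have : Module.Finite O R := Module.Finite.of_injective R.val.toLinearMap Subtype.val_injective
  let J : Ideal R := (IsLocalRing.maximalIdeal O).map (algebraMap O R)
  have : IsAdicComplete J R := by
    rw [IsAdicComplete.map_algebraMap_iff]
    exact isAdicComplete_of_finite _
  have hfin : Finite (R ⧸ J) :=
    finite_quotient_of_smul_le (J.restrictScalars O) (by rw [Ideal.smul_top_eq_map])
  let y : R := ⟨x, Algebra.self_mem_adjoin_singleton O x⟩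
  obtain ⟨n, hn, h⟩ := isIdempotentElem_pow_of_finite (Ideal.Quotient.mk J y)
  obtain ⟨e, he, hey⟩ := exists_isIdempotentElem_sub_mem J (y ^ n) (by
    rw [← Ideal.Quotient.eq_zero_iff_mem, map_sub, map_mul, map_pow, sub_eq_zero]
    exact h)
  have hJ : J ≤ Ideal.jacobson ⊥ := IsAdicComplete.le_jacobson_bot J
  have hu : ∀ z ∈ J, IsUnit (1 - z) := fun z hz => by
    have := Ideal.mem_jacobson_bot.1 (hJ hz) (-1)
    rwa [mul_neg_one, neg_add_eq_sub] at this
  have key : IsUnit y ∨ IsUnit (1 - y) := by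
    have h1 : e = 0 ∨ e = 1 := by
      rcases hE e.1 (congrArg Subtype.val he) with h | h
      · exact Or.inl (Subtype.ext h)
      · exact Or.inr (Subtype.ext h)
    rcases h1 with rfl | rfl
    · right
      rw [zero_sub, Ideal.neg_mem_iff] at hey
      exact isUnit_of_dvd_unit (one_sub_dvd_one_sub_pow y n) (hu _ hey)
    · left
      have := hu _ hey
      rw [sub_sub_cancel] at this
      exact (isUnit_pow_iff hn.ne').1 this
  rcases key with h | h
  · exact Or.inl (h.map R.val)
  · right
    have := h.map R.val
    rwa [map_sub, map_one] at this

end Complete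

/-! ### Unramified extensions of complete discrete valuation rings -/

section Unramified

open IsLocalRing

variable {O O' : Type u} [CommRing O] [IsLocalRing O] [CommRing O'] [IsLocalRing O'] [Algebra O O']


/-- Lifts of all elements of the finite residue field span `O'` modulo the maximal ideal of `O`.
Successive approximation makes them span `O'`: finite free modules over `O` are complete, and `O'`
is separated. -/
theorem finite_of_map_maximalIdeal [IsNoetherianRing O] [IsAdicComplete (maximalIdeal O) O]
    [IsNoetherianRing O']
    [Finite (ResidueField O')] (h : (maximalIdeal O).map (algebraMap O O') = maximalIdeal O') :
    Module.Finite O O' := by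
  have : Fintype (ResidueField O') := Fintype.ofFinite _
  have hh : IsHausdorff (maximalIdeal O) O' := by
    rw [← IsHausdorff.map_algebraMap_iff (S := O'), h]
    exact IsHausdorff.of_le_jacobson _ _ (IsLocalRing.maximalIdeal_le_jacobson _)
  have := isAdicComplete_of_finite (M := ResidueField O' → O) (maximalIdeal O)
  let f : (ResidueField O' → O) →ₗ[O] O' :=
    Fintype.linearCombination O fun x => Function.surjInv residue_surjective x
  refine Module.Finite.of_surjective f
    (surjective_of_mkQ_comp_surjective (I := maximalIdeal O) fun y => ?_)
  classical
  obtain ⟨y, rfl⟩ := Submodule.mkQ_surjective _ y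
  refine ⟨Pi.single (residue O' y) 1, ?_⟩
  rw [LinearMap.comp_apply, ← sub_eq_zero, ← map_sub, Submodule.mkQ_apply,
    Submodule.Quotient.mk_eq_zero, Ideal.smul_top_eq_map, h, Submodule.restrictScalars_mem,
    ← residue_eq_zero_iff, map_sub, sub_eq_zero]
  simp only [f, Fintype.linearCombination_apply_single, one_smul]
  exact Function.surjInv_eq residue_surjective _

/-- Any coordinate of an `O`-basis serves as `τ`. Transported through the isomorphism of `O'` with
its dual, `x ↦ τ (x * ·)` becomes an endomorphism `S` of `O'`. Its reduction is injective on the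
finite residue field, hence surjective, and Nakayama's lemma makes `S` surjective, hence bijective.
-/
theorem exists_bijective_mul_form [Module.Finite O O'] [Module.Free O O']
    [Finite (ResidueField O')] (h : (maximalIdeal O).map (algebraMap O O') = maximalIdeal O') :
    ∃ τ : O' →ₗ[O] O, Function.Bijective fun x : O' => τ ∘ₗ LinearMap.mulLeft O x := by
  classical
  let β := Module.Free.chooseBasis O O'
  obtain ⟨i⟩ : Nonempty (Module.Free.ChooseBasisIndex O O') := β.index_nonempty
  let τ := β.coord i
  refine ⟨τ, ?_⟩
  let T : O' →ₗ[O] (O' →ₗ[O] O) := (LinearMap.mul O O').compr₂ τ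
  let ι : O' ≃ₗ[O] (O' →ₗ[O] O) := β.toDualEquiv
  let S : O' →ₗ[O] O' := ι.symm.toLinearMap ∘ₗ T
  have hm : ∀ x : O', x ∈ (maximalIdeal O • (⊤ : Submodule O O')) ↔ x ∈ maximalIdeal O' := by
    intro x
    rw [Ideal.smul_top_eq_map, h, Submodule.restrictScalars_mem]
  have hι : ∀ (x y : O'), x ∈ maximalIdeal O' → ι x y ∈ maximalIdeal O := by
    intro x y hx
    rw [← hm] at hx
    have := Submodule.smul_mono le_rfl (le_top : Submodule.map
      ((LinearMap.applyₗ y) ∘ₗ ι.toLinearMap) ⊤ ≤ ⊤) (by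
        rw [← Submodule.map_smul'']; exact Submodule.mem_map_of_mem hx)
    rw [smul_eq_mul, Ideal.mul_top] at this
    exact this
  -- If `x` were a unit, the form `τ (x * ·)` would take the value `τ (β i) = 1` at `x⁻¹ * β i`,
  -- although all its values lie in the maximal ideal.
  have hS : ∀ x, S x ∈ maximalIdeal O' → x ∈ maximalIdeal O' := by
    intro x hx
    by_contra hu
    obtain ⟨u, rfl⟩ := of_not_not hu
    have h1 := hι _ (↑u⁻¹ * β i) hx
    simp [S, T, τ] at h1
  have hS' : ∀ x, x ∈ maximalIdeal O' → S x ∈ maximalIdeal O' := by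
    intro x hx
    rw [← hm] at hx ⊢
    exact Submodule.smul_mono le_rfl (le_top : Submodule.map S ⊤ ≤ ⊤) (by
      rw [← Submodule.map_smul'']; exact Submodule.mem_map_of_mem hx)
  have hsurj : Function.Surjective S := by
    let S' : ResidueField O' →+ ResidueField O' :=
      QuotientAddGroup.map (maximalIdeal O').toAddSubgroup (maximalIdeal O').toAddSubgroup
        S.toAddMonoidHom hS'
    have hS'r : ∀ x, S' (residue O' x) = residue O' (S x) := fun x => rfl
    have hinj : Function.Injective S' := by
      rw [injective_iff_map_eq_zero]
      intro x hx
      obtain ⟨x, rfl⟩ := residue_surjective x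
      rw [hS'r, residue_eq_zero_iff] at hx
      exact (residue_eq_zero_iff _).2 (hS x hx)
    have hsur := Finite.surjective_of_injective hinj
    rw [← LinearMap.range_eq_top, ← top_le_iff]
    refine Submodule.le_of_le_smul_of_le_jacobson_bot (I := maximalIdeal O)
      Module.Finite.fg_top (IsLocalRing.maximalIdeal_le_jacobson _) fun y _ => ?_
    obtain ⟨x, hx⟩ := hsur (residue O' y)
    obtain ⟨x, rfl⟩ := residue_surjective x
    rw [hS'r, ← sub_eq_zero, ← map_sub, residue_eq_zero_iff, ← hm] at hx
    rw [Submodule.mem_sup]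
    exact ⟨S x, ⟨x, rfl⟩, y - S x, by rw [← neg_sub]; exact Submodule.neg_mem _ hx, by simp⟩
  have hbij : Function.Bijective S :=
    ⟨OrzechProperty.injective_of_surjective_endomorphism S hsurj, hsurj⟩
  have : (fun x : O' => τ ∘ₗ LinearMap.mulLeft O x) = ι ∘ S := by
    funext x
    simp only [S, Function.comp_apply, LinearMap.comp_apply, LinearEquiv.coe_coe,
      LinearEquiv.apply_symm_apply]
    rfl
  rw [this]
  exact ι.bijective.comp hbij

end Unramified

/-! ### Blocks and coefficient extensions -/

section GroupAlgebra

open MonoidAlgebra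

variable {R S G : Type*} [CommRing R] [CommRing S] [Group G]

theorem mem_center_iff_coeff (x : MonoidAlgebra R G) :
    x ∈ Subring.center (MonoidAlgebra R G) ↔ ∀ g h, x.coeff (g * h * g⁻¹) = x.coeff h := by
  rw [Subring.mem_center_iff]
  constructor
  · intro hx g h
    have := congrArg (fun y => MonoidAlgebra.coeff y (g * h)) (hx (single g 1))
    simp only [coeff_single_mul_apply, coeff_mul_single_apply] at this
    simpa using this.symm
  · intro hx y
    induction y using MonoidAlgebra.induction_linear with
    | zero => simp
    | add y z hy hz => rw [add_mul, mul_add, hy, hz]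
    | single g r =>
      ext h
      simp only [coeff_single_mul_apply, coeff_mul_single_apply]
      rw [mul_comm, ← hx g (g⁻¹ * h)]
      simp

theorem mapRingHom_mem_center (f : R →+* S) {x : MonoidAlgebra R G}
    (hx : x ∈ Subring.center (MonoidAlgebra R G)) :
    mapRingHom G f x ∈ Subring.center (MonoidAlgebra S G) := by
  rw [mem_center_iff_coeff] at hx ⊢
  intro g h
  rw [coeff_mapRingHom, coeff_mapRingHom, hx]

theorem mapRingHom_injective {f : R →+* S} (hf : Function.Injective f) :
    Function.Injective (mapRingHom G f) := by
  intro x y h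
  ext g
  have := congrArg (fun z => MonoidAlgebra.coeff z g) h
  simp only [coeff_mapRingHom] at this
  exact hf this

theorem mapRingHom_surjective {f : R →+* S} (hf : Function.Surjective f) :
    Function.Surjective (mapRingHom G f) := by
  intro x
  induction x using MonoidAlgebra.induction_linear with
  | zero => exact ⟨0, map_zero _⟩
  | add y z hy hz =>
    obtain ⟨y, rfl⟩ := hy
    obtain ⟨z, rfl⟩ := hz
    exact ⟨y + z, map_add _ _ _⟩
  | single g r =>
    obtain ⟨r, rfl⟩ := hf r
    exact ⟨single g r, mapRingHom_single _ _ _⟩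

/-- The center consists of the elements whose coefficients are constant on conjugacy classes;
lifting coefficients through one fixed section preserves this. -/
theorem exists_mem_center_mapRingHom_eq [Finite G] {f : R →+* S} (hf : Function.Surjective f)
    {x : MonoidAlgebra S G} (hx : x ∈ Subring.center (MonoidAlgebra S G)) :
    ∃ y ∈ Subring.center (MonoidAlgebra R G), mapRingHom G f y = x := by
  refine ⟨ofCoeff (Finsupp.equivFunOnFinite.symm fun g => Function.surjInv hf (x.coeff g)), ?_, ?_⟩
  · rw [mem_center_iff_coeff] at hx ⊢
    intro g h
    change Function.surjInv hf (x.coeff (g * h * g⁻¹)) = Function.surjInv hf (x.coeff h)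
    rw [hx]
  · ext g
    rw [coeff_mapRingHom]
    exact Function.surjInv_eq hf _

theorem IsBlock.commute {R : Type*} [Ring R] {b : R} (hb : IsBlock b) (x : R) : x * b = b * x :=
  Subring.mem_center_iff.1 hb.central x

/-- Primitivity of either block identifies it with the nonzero central idempotent `b * c`. -/
theorem IsBlock.eq_of_mul_ne_zero {R : Type*} [Ring R] {b c : R} (hb : IsBlock b) (hc : IsBlock c)
    (h : b * c ≠ 0) : b = c := by
  have hcen := mul_mem hb.central hc.central
  have hid : IsIdempotentElem (b * c) := by
    rw [IsIdempotentElem, mul_assoc, ← mul_assoc c, hb.commute c, mul_assoc, hc.idem.eq,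
      ← mul_assoc, hb.idem.eq]
  have h1 := (hb.primitive _ hcen hid (by rw [mul_assoc, hb.commute c, ← mul_assoc, hb.idem.eq])).resolve_left h
  have h2 := (hc.primitive _ hcen hid (by rw [mul_assoc, hc.idem.eq])).resolve_left h
  exact h1.symm.trans h2

theorem IsBlock.map_ringEquiv {R S : Type*} [Ring R] [Ring S] (e : R ≃+* S) {b : R}
    (hb : IsBlock b) : IsBlock (e b) where
  central := Subring.mem_center_iff.2 fun x => by
    obtain ⟨x, rfl⟩ := e.surjective x
    rw [← map_mul, ← map_mul, hb.commute]
  idem := by rw [IsIdempotentElem, ← map_mul, hb.idem.eq]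
  ne_zero := by simpa using hb.ne_zero
  primitive f hf hf' h := by
    obtain ⟨f, rfl⟩ := e.surjective f
    have := hb.primitive f (Subring.mem_center_iff.2 fun x => e.injective (by
      rw [map_mul, map_mul]; exact Subring.mem_center_iff.1 hf _))
      (e.injective (by rw [map_mul]; exact hf')) (e.injective (by rw [map_mul]; exact h))
    simpa using this

theorem IsBlock.mul_eq_of_ne_zero {f : R →+* S} {b : MonoidAlgebra R G} {b' : MonoidAlgebra S G}
    (hb : IsBlock b) (hb' : IsBlock b') (h : mapRingHom G f b * b' ≠ 0) :
    mapRingHom G f b * b' = b' := by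
  have hc := mapRingHom_mem_center f hb.central
  refine (hb'.primitive _ (mul_mem hc hb'.central) ?_ ?_).resolve_left h
  · rw [IsIdempotentElem, mul_assoc, ← mul_assoc b', Subring.mem_center_iff.1 hc b', mul_assoc,
      hb'.idem.eq, ← mul_assoc, ← map_mul, hb.idem.eq]
  · rw [mul_assoc, hb'.idem.eq]

end GroupAlgebra

/-! ### Reduction of blocks modulo the maximal ideal -/

section Reduction

open MonoidAlgebra IsLocalRing

variable {O G : Type u} [CommRing O] [IsDomain O] [IsDiscreteValuationRing O] [Group G]

theorem mapRingHom_residue_eq_zero_iff {ϖ : O} (hϖ : maximalIdeal O = Ideal.span {ϖ})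
    (x : MonoidAlgebra O G) :
    mapRingHom G (residue O) x = 0 ↔ ∃ y, x = ϖ • y := by
  classical
  constructor
  · intro h
    have h1 : ∀ g, ∃ r, x.coeff g = ϖ * r := fun g => by
      have := congrArg (fun z => MonoidAlgebra.coeff z g) h
      simp only [coeff_mapRingHom, coeff_zero, Finsupp.coe_zero, Pi.zero_apply,
        residue_eq_zero_iff] at this
      rw [hϖ, Ideal.mem_span_singleton] at this
      exact this
    choose r hr using h1
    refine ⟨ofCoeff (Finsupp.onFinset x.coeff.support (fun g => if x.coeff g = 0 then 0 else r g)
      (by intro g hg; simp only [ne_eq, ite_eq_left_iff, not_forall] at hg; simpa using hg.1)), ?_⟩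
    ext g
    simp only [coeff_smul, Finsupp.smul_apply, Finsupp.onFinset_apply, smul_eq_mul]
    split_ifs with h0
    · rw [h0, mul_zero]
    · exact hr g
  · rintro ⟨y, rfl⟩
    ext g
    rw [coeff_mapRingHom, coeff_smul_apply, smul_eq_mul, map_mul, (residue_eq_zero_iff ϖ).2, zero_mul]
    · rfl
    · rw [hϖ]; exact Ideal.mem_span_singleton_self ϖ

variable [IsAdicComplete (maximalIdeal O) O]

/-- The kernel of reduction on the center of `OG` is generated by the uniformizer, and the center is
complete for it. So reduction kills no nonzero central idempotent, and central idempotents of `kG`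
lift; a proper decomposition of the reduced block would lift to one of `b`. -/
theorem IsBlock.residue [Finite G] {b : MonoidAlgebra O G} (hb : IsBlock b) :
    IsBlock (mapRingHom G (residue O) b) := by
  obtain ⟨ϖ, hϖ⟩ := (IsPrincipalIdealRing.principal (maximalIdeal O)).principal
  have hϖ0 : ϖ ≠ 0 := by
    rintro rfl
    exact IsDiscreteValuationRing.not_a_field O (by rw [hϖ]; simp)
  let Z := Subalgebra.center O (MonoidAlgebra O G)
  have : Module.Finite O Z := Module.Finite.of_injective Z.val.toLinearMap Subtype.val_injective
  let J : Ideal Z := (maximalIdeal O).map (algebraMap O Z)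
  have hadic : IsAdicComplete J Z := by
    rw [IsAdicComplete.map_algebraMap_iff]
    exact isAdicComplete_of_finite _
  have hJ : ∀ z : Z, mapRingHom G (IsLocalRing.residue O) z.1 = 0 → z ∈ J := by
    rintro ⟨z, hz⟩ h
    obtain ⟨y, rfl⟩ := (mapRingHom_residue_eq_zero_iff hϖ z).1 h
    -- `OG` is torsion-free over `O`, so centrality of `ϖ • y` gives that of `y`.
    have hy : y ∈ Z := by
      refine Subalgebra.mem_center_iff.2 fun x => ?_
      have := Subalgebra.mem_center_iff.1 hz x
      rw [mul_smul_comm, smul_mul_assoc] at this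
      ext g
      have h' := congrArg (fun z => MonoidAlgebra.coeff z g) this
      simp only [coeff_smul_apply, smul_eq_mul] at h'
      exact mul_left_cancel₀ hϖ0 h'
    have : (⟨ϖ • y, hz⟩ : Z) = algebraMap O Z ϖ * ⟨y, hy⟩ := by
      refine Subtype.ext ?_
      change ϖ • y = algebraMap O (MonoidAlgebra O G) ϖ * y
      rw [Algebra.smul_def]
    rw [this]
    exact Ideal.mul_mem_right _ _ (Ideal.mem_map_of_mem _ (by
      rw [hϖ]; exact Ideal.mem_span_singleton_self ϖ))
  have hJ' : ∀ z ∈ J, mapRingHom G (IsLocalRing.residue O) z.1 = 0 := by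
    intro z hz
    have : J ≤ RingHom.ker ((mapRingHom G (IsLocalRing.residue O)).comp (Z.val : Z →+* _)) := by
      rw [Ideal.map_le_iff_le_comap]
      intro r hr
      rw [Ideal.mem_comap, RingHom.mem_ker]
      refine (mapRingHom_residue_eq_zero_iff hϖ _).2 ?_
      rw [hϖ] at hr
      obtain ⟨s, rfl⟩ := Ideal.mem_span_singleton.1 hr
      exact ⟨algebraMap O _ s, by rw [map_mul]; exact (Algebra.smul_def _ _).symm⟩
    exact this hz
  have mem_Z : ∀ {x}, x ∈ Subring.center (MonoidAlgebra O G) → x ∈ Z := fun h =>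
    Subalgebra.mem_center_iff.2 (Subring.mem_center_iff.1 h)
  refine ⟨mapRingHom_mem_center _ hb.central, ?_, fun h0 => hb.ne_zero ?_, fun e he he' heb => ?_⟩
  · rw [IsIdempotentElem, ← map_mul, hb.idem.eq]
  · have := hJ ⟨b, mem_Z hb.central⟩ h0
    have := Ideal.mem_jacobson_bot.1 (@IsAdicComplete.le_jacobson_bot Z _ J hadic _ this) (-1)
    have h1 : b * (1 - b) = 0 := by rw [mul_sub, mul_one, hb.idem.eq, sub_self]
    have hu : IsUnit (1 - b) := by
      have := this.map Z.val
      simpa [neg_add_eq_sub] using this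
    exact (hu.mul_left_eq_zero).1 h1
  · obtain ⟨a, ha, rfl⟩ := exists_mem_center_mapRingHom_eq residue_surjective he
    obtain ⟨f, hf, hfa⟩ := @exists_isIdempotentElem_sub_mem Z _ J hadic (⟨a, mem_Z ha⟩ : Z) (hJ _ (by
      change mapRingHom G _ (a * a - a) = 0
      rw [map_sub, map_mul, he'.eq, sub_self]))
    have hfa' := hJ' _ hfa
    replace hfa' : mapRingHom G (IsLocalRing.residue O) f.1 =
        mapRingHom G (IsLocalRing.residue O) a := by
      rw [← sub_eq_zero, ← map_sub]; exact hfa'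
    rw [← hfa'] at heb ⊢
    have hf2 : f.1 * f.1 = f.1 := congrArg Subtype.val hf
    have hfc : f.1 ∈ Subring.center (MonoidAlgebra O G) :=
      Subring.mem_center_iff.2 (Subalgebra.mem_center_iff.1 f.2)
    -- The lift `f` need not lie under `b`, but `f * b` does, and it has the same reduction.
    rcases hb.primitive (f.1 * b) (mul_mem hfc hb.central) (by
      rw [IsIdempotentElem, mul_assoc, ← mul_assoc b, ← hb.commute, mul_assoc f.1 b b, hb.idem.eq,
        ← mul_assoc, hf2]) (by rw [mul_assoc, hb.idem.eq]) with h | h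
    · left; rw [← heb, ← map_mul, h, map_zero]
    · right; rw [← heb, ← map_mul, h]

end Reduction

/-! ### Galois conjugates of a block over the residue field -/

section Galois

open MonoidAlgebra

variable {k k' G : Type*} [Field k] [Field k'] [Algebra k k'] [Group G]

/-- A conjugate of a block is a block, so it is either orthogonal to `b'` or equal to it. In the
second case `σ` fixes the coefficients of `b'`, which generate `k'`, and is trivial. -/
theorem mapRingHom_galois_mul_eq_zero {b' : MonoidAlgebra k' G} (hb' : IsBlock b')
    (h : IntermediateField.adjoin k (Set.range b'.coeff) = ⊤) (σ : k' ≃ₐ[k] k') (hσ : σ ≠ 1) :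
    mapRingHom G (σ : k' →+* k') b' * b' = 0 := by
  by_contra h0
  have hbl : IsBlock (mapRingHom G (σ : k' →+* k') b') := by
    let e : MonoidAlgebra k' G ≃+* MonoidAlgebra k' G :=
      RingEquiv.ofRingHom (mapRingHom G (σ : k' →+* k')) (mapRingHom G (σ.symm : k' →+* k'))
        (by rw [← mapRingHom_comp]; convert mapRingHom_id; ext; simp)
        (by rw [← mapRingHom_comp]; convert mapRingHom_id; ext; simp)
    exact hb'.map_ringEquiv e
  have heq := hbl.eq_of_mul_ne_zero hb' h0
  refine hσ ?_
  have : IntermediateField.adjoin k (Set.range b'.coeff) ≤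
      IntermediateField.fixedField (Subgroup.zpowers σ) := by
    rw [IntermediateField.adjoin_le_iff]
    rintro _ ⟨g, rfl⟩
    have h1 : σ (b'.coeff g) = b'.coeff g := by
      have := congrArg (fun z => MonoidAlgebra.coeff z g) heq
      simp only [coeff_mapRingHom] at this
      exact this
    rintro ⟨τ, hτ⟩
    have : σ ∈ MulAction.stabilizer (k' ≃ₐ[k] k') (b'.coeff g) := h1
    exact (Subgroup.zpowers_le.2 this) hτ
  rw [h] at this
  ext x
  exact this (IntermediateField.mem_top (x := x)) ⟨σ, Subgroup.mem_zpowers σ⟩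

variable [FiniteDimensional k k']

/-- Multiplication by `b'` annihilates every conjugate except the one for `σ = 1`. This recovers an
element of `k'G b'` from its trace, which has coefficients in `k`. -/
theorem sum_mapRingHom_mul {b' : MonoidAlgebra k' G} (hb' : IsBlock b')
    (h : IntermediateField.adjoin k (Set.range b'.coeff) = ⊤) (y : MonoidAlgebra k' G) :
    (∑ σ : k' ≃ₐ[k] k', mapRingHom G (σ : k' →+* k') (y * b')) * b' = y * b' := by
  classical
  rw [Finset.sum_mul, Finset.sum_eq_single 1]
  · have : ((1 : k' ≃ₐ[k] k') : k' →+* k') = RingHom.id k' := rfl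
    rw [this, mapRingHom_id, RingHom.id_apply, mul_assoc, hb'.idem.eq]
  · intro σ _ hσ
    rw [map_mul, mul_assoc, mapRingHom_galois_mul_eq_zero hb' h σ hσ, mul_zero]
  · simp

variable [IsGalois k k'] [Finite G]

theorem exists_mapRingHom_eq_sum (y : MonoidAlgebra k' G) :
    ∃ x : MonoidAlgebra k G, mapRingHom G (algebraMap k k') x =
      ∑ σ : k' ≃ₐ[k] k', mapRingHom G (σ : k' →+* k') y := by
  refine ⟨ofCoeff (Finsupp.equivFunOnFinite.symm fun g => Algebra.trace k k' (y.coeff g)), ?_⟩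
  ext g
  rw [coeff_mapRingHom, coeff_sum, Finsupp.finsetSum_apply]
  simp only [coeff_mapRingHom]
  exact trace_eq_sum_automorphisms (y.coeff g)

theorem exists_mapRingHom_mul_eq {b' : MonoidAlgebra k' G} (hb' : IsBlock b')
    (h : IntermediateField.adjoin k (Set.range b'.coeff) = ⊤) (y : MonoidAlgebra k' G) :
    ∃ x : MonoidAlgebra k G, mapRingHom G (algebraMap k k') x * b' = y * b' := by
  obtain ⟨x, hx⟩ := exists_mapRingHom_eq_sum (k := k) (y * b')
  exact ⟨x, by rw [hx, sum_mapRingHom_mul hb' h]⟩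

/-- The trace `f` of `b'` is a nonzero central idempotent of `kG` under `b`, so it is `b`. Hence the
image of `x b` is the sum of the conjugates of `x b' = 0`. -/
theorem mul_eq_zero_of_mapRingHom_mul_eq_zero {b : MonoidAlgebra k G} {b' : MonoidAlgebra k' G}
    (hb : IsBlock b) (hb' : IsBlock b')
    (h : IntermediateField.adjoin k (Set.range b'.coeff) = ⊤)
    (hbb' : mapRingHom G (algebraMap k k') b * b' = b') (x : MonoidAlgebra k G)
    (hx : mapRingHom G (algebraMap k k') x * b' = 0) : x * b = 0 := by
  classical
  have hσj : ∀ (σ : k' ≃ₐ[k] k') (x : MonoidAlgebra k G), mapRingHom G (σ : k' →+* k')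
      (mapRingHom G (algebraMap k k') x) = mapRingHom G (algebraMap k k') x := fun σ x => by
    ext g
    simp
  have hj := mapRingHom_injective (G := G) (algebraMap k k').injective
  obtain ⟨f, hf⟩ := exists_mapRingHom_eq_sum (k := k) b'
  have hfb' : mapRingHom G (algebraMap k k') f * b' = b' := by
    have := sum_mapRingHom_mul hb' h 1
    rwa [one_mul, ← hf] at this
  have hff : f * f = f := hj (by
    rw [map_mul]
    nth_rw 2 [hf]
    rw [Finset.mul_sum, hf]
    refine Finset.sum_congr rfl fun σ _ => ?_
    rw [← hf, ← hσj σ f, ← map_mul, hfb'])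
  have hfc : f ∈ Subring.center (MonoidAlgebra k G) := by
    rw [Subring.mem_center_iff]
    intro x
    apply hj
    rw [map_mul, map_mul]
    refine Subring.mem_center_iff.1 ?_ _
    rw [hf]
    exact sum_mem fun σ _ => mapRingHom_mem_center _ hb'.central
  have hfb : f * b = f := hj (by
    rw [map_mul, Subring.mem_center_iff.1 (mapRingHom_mem_center _ hb.central), hf, Finset.mul_sum]
    refine Finset.sum_congr rfl fun σ _ => ?_
    rw [← hσj σ b, ← map_mul, hbb'])
  have hf0 : f ≠ 0 := by
    rintro rfl
    rw [map_zero, zero_mul] at hfb'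
    exact hb'.ne_zero hfb'.symm
  -- From here on `b` is replaced by the trace `f`.
  rw [← (hb.primitive f hfc hff hfb).resolve_left hf0]
  apply hj
  rw [map_zero, map_mul, hf, Finset.mul_sum]
  refine Finset.sum_eq_zero fun σ _ => ?_
  rw [← hσj σ x, ← map_mul, hx, map_zero]

end Galois

/-! ### The isomorphism between the block algebras -/

section BlockIso

open MonoidAlgebra IsLocalRing

variable {O O' G : Type u} [CommRing O] [CommRing O'] [Algebra O O'] [Group G] {b : MonoidAlgebra O G} {b' : MonoidAlgebra O' G}

/-- The ring homomorphism `x ↦ x b'` from `OGb` to `O'Gb'`, for blocks with `b b' ≠ 0`. -/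
def blockHom (hb : IsBlock b) (hb' : IsBlock b')
    (h : mapRingHom G (algebraMap O O') b * b' ≠ 0) : hb.Alg →+* hb'.Alg where
  toFun x := hb'.proj (mapRingHom G (algebraMap O O') x.1)
  map_one' := Subtype.ext (by
    change b' * (mapRingHom G (algebraMap O O') b) * b' = b'
    rw [mul_assoc, hb.mul_eq_of_ne_zero hb' h, hb'.idem.eq])
  map_zero' := Subtype.ext (by
    change b' * (mapRingHom G (algebraMap O O') 0) * b' = 0
    rw [map_zero, mul_zero, zero_mul])
  map_mul' x y := by
    rw [← map_mul, ← map_mul]; rfl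
  map_add' x y := Subtype.ext (by
    change b' * (mapRingHom G (algebraMap O O') (x.1 + y.1)) * b' =
      b' * (mapRingHom G (algebraMap O O') x.1) * b' +
        b' * (mapRingHom G (algebraMap O O') y.1) * b'
    rw [map_add, mul_add, add_mul])

theorem blockHom_val (hb : IsBlock b) (hb' : IsBlock b')
    (h : mapRingHom G (algebraMap O O') b * b' ≠ 0) (x : hb.Alg) :
    (blockHom hb hb' h x).1 = mapRingHom G (algebraMap O O') x.1 * b' := by
  change b' * (mapRingHom G (algebraMap O O') x.1) * b' = _
  rw [← hb'.commute, mul_assoc, hb'.idem.eq]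

theorem IsBlock.proj_val {R : Type u} [Ring R] {b : R} (hb : IsBlock b) (x : R) :
    (hb.proj x).1 = x * b := by
  change b * x * b = _
  rw [← hb.commute, mul_assoc, hb.idem.eq]

theorem IsBlock.val_mul {R : Type u} [Ring R] {b : R} (hb : IsBlock b) (x : hb.Alg) :
    x.1 * b = x.1 := by
  obtain ⟨y, hy⟩ := x.2
  rw [← hy]
  change b * y * b * b = _
  rw [mul_assoc, hb.idem.eq]

theorem blockHom_proj (hb : IsBlock b) (hb' : IsBlock b')
    (h : mapRingHom G (algebraMap O O') b * b' ≠ 0) (x : MonoidAlgebra O G) :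
    blockHom hb hb' h (hb.proj x) = hb'.proj (mapRingHom G (algebraMap O O') x) :=
  Subtype.ext (by
    rw [blockHom_val, IsBlock.proj_val, IsBlock.proj_val, map_mul, mul_assoc,
      hb.mul_eq_of_ne_zero hb' h])

theorem blockHom_ofGroup (hb : IsBlock b) (hb' : IsBlock b')
    (h : mapRingHom G (algebraMap O O') b * b' ≠ 0) (g : G) :
    blockHom hb hb' h (hb.ofGroup g) = hb'.ofGroup g := by
  change blockHom hb hb' h (hb.proj (MonoidAlgebra.single g 1)) = _
  rw [blockHom_proj, mapRingHom_single, map_one]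
  rfl

theorem blockHom_algebraMap (hb : IsBlock b) (hb' : IsBlock b')
    (h : mapRingHom G (algebraMap O O') b * b' ≠ 0) (r : O) :
    blockHom hb hb' h (algebraMap O hb.Alg r) = algebraMap O' hb'.Alg (algebraMap O O' r) :=
  Subtype.ext (by
    rw [blockHom_val]
    change mapRingHom G (algebraMap O O') (r • b) * b' = algebraMap O O' r • b'
    nth_rw 2 [← hb.mul_eq_of_ne_zero hb' h]
    rw [← smul_mul_assoc]
    congr 1
    ext g
    simp [Algebra.smul_def])

/-- Over the residue fields bijectivity comes from `mul_eq_zero_of_mapRingHom_mul_eq_zero` and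
`exists_mapRingHom_mul_eq`. It is lifted by applying Nakayama's lemma over `O` to the kernel and to
the image. -/
theorem blockHom_bijective [IsDomain O] [IsDiscreteValuationRing O]
    [IsAdicComplete (maximalIdeal O) O] [IsDomain O'] [IsDiscreteValuationRing O']
    [IsAdicComplete (maximalIdeal O') O'] [IsLocalHom (algebraMap O O')] [Finite G]
    [Finite (ResidueField O)] [Finite (ResidueField O')]
    (hm : (maximalIdeal O).map (algebraMap O O') = maximalIdeal O')
    (hinj : Function.Injective (algebraMap O O'))
    (hb : IsBlock b) (hb' : IsBlock b')
    (h : mapRingHom G (algebraMap O O') b * b' ≠ 0) (hk : coefficientField O b' = ⊤) :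
    Function.Bijective (blockHom hb hb' h) := by
  have : Module.Finite O O' := finite_of_map_maximalIdeal hm
  have : FiniteDimensional (ResidueField O) (ResidueField O') := inferInstance
  obtain ⟨ϖ, hϖ⟩ := (IsPrincipalIdealRing.principal (maximalIdeal O)).principal
  have hϖ0 : ϖ ≠ 0 := by
    rintro rfl
    exact IsDiscreteValuationRing.not_a_field O (by rw [hϖ]; simp)
  have hϖ' : maximalIdeal O' = Ideal.span {algebraMap O O' ϖ} := by
    rw [← hm, hϖ, Ideal.submodule_span_eq, Ideal.map_span, Set.image_singleton]
  set j := mapRingHom G (algebraMap O O') with hj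
  set j₀ := mapRingHom G (algebraMap (ResidueField O) (ResidueField O')) with hj₀
  set ρ := mapRingHom G (residue O) with hρ
  set ρ' := mapRingHom G (residue O') with hρ'
  have hcomm : ∀ x, ρ' (j x) = j₀ (ρ x) := fun x => by
    ext g
    simp only [hj, hj₀, hρ, hρ', coeff_mapRingHom]
    rfl
  have hres := hb.residue
  have hres' := hb'.residue
  have hk' : IntermediateField.adjoin (ResidueField O) (Set.range (ρ' b').coeff) = ⊤ := by
    rw [← hk]
    unfold coefficientField
    congr 2
  have hbb' : j b * b' = b' := hb.mul_eq_of_ne_zero hb' h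
  have hbb₀ : j₀ (ρ b) * ρ' b' = ρ' b' := by rw [← hcomm, ← map_mul, hbb']
  let F : hb.Alg →ₗ[O] MonoidAlgebra O' G :=
    { toFun := fun x => j x.1 * b'
      map_add' := fun x y => by
        change j (x.1 + y.1) * b' = _
        rw [map_add, add_mul]
      map_smul' := fun r x => by
        change j (r • x.1) * b' = r • (j x.1 * b')
        rw [← smul_mul_assoc]
        congr 1
        ext g
        simp [hj, Algebra.smul_def] }
  constructor
  · rw [injective_iff_map_eq_zero]
    intro x hx
    have hker : LinearMap.ker F = ⊥ := by
      rw [← le_bot_iff]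
      -- An element of the kernel reduces to zero, so it is `ϖ` times an element of the block
      -- algebra. As `O'G` has no `ϖ`-torsion, that element lies in the kernel too: the kernel is
      -- `ϖ` times itself.
      refine Submodule.le_of_le_smul_of_le_jacobson_bot (I := maximalIdeal O)
        (IsNoetherian.noetherian _) (IsLocalRing.maximalIdeal_le_jacobson _) fun x hx => ?_
      rw [bot_sup_eq]
      replace hx : j x.1 * b' = 0 := hx
      have h1 := mul_eq_zero_of_mapRingHom_mul_eq_zero hres hres' hk' hbb₀ (ρ x.1) (by
        rw [← hj₀, ← hcomm, ← map_mul, hx, map_zero])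
      rw [← hρ, ← map_mul, hb.val_mul] at h1
      obtain ⟨y, hy⟩ := (mapRingHom_residue_eq_zero_iff hϖ _).1 h1
      have hxy : x = ϖ • hb.proj y := Subtype.ext (by
        change _ = ϖ • (hb.proj y).1
        rw [IsBlock.proj_val, ← smul_mul_assoc, ← hy, hb.val_mul])
      rw [hxy]
      refine Submodule.smul_mem_smul (by rw [hϖ]; exact Ideal.mem_span_singleton_self ϖ) ?_
      rw [LinearMap.mem_ker]
      have h2 : ϖ • F (hb.proj y) = 0 := by
        rw [← map_smul, ← hxy]
        exact hx
      ext g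
      have h3 := congrArg (fun z => MonoidAlgebra.coeff z g) h2
      simp only [coeff_smul_apply, coeff_zero, Finsupp.coe_zero, Pi.zero_apply] at h3
      rw [Algebra.smul_def, mul_eq_zero, map_eq_zero_iff _ hinj] at h3
      exact h3.resolve_left hϖ0
    refine (LinearMap.ker_eq_bot'.1 hker) x ?_
    have := congrArg Subtype.val hx
    rwa [blockHom_val] at this
  · intro y
    let N : Submodule O (MonoidAlgebra O' G) :=
      LinearMap.range ((LinearMap.mulRight O' b').restrictScalars O)
    have : Module.Finite O (MonoidAlgebra O' G) := Module.Finite.trans O' _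
    -- Modulo `ϖ`, an element of `O'G b'` agrees with the image of some `x` in `OGb`; the error is
    -- `ϖ` times an element of `O'G b'`.
    have hN : N ≤ LinearMap.range F := by
      refine Submodule.le_of_le_smul_of_le_jacobson_bot (I := maximalIdeal O)
        (IsNoetherian.noetherian _) (IsLocalRing.maximalIdeal_le_jacobson _) ?_
      rintro _ ⟨y, rfl⟩
      obtain ⟨x, hx⟩ := exists_mapRingHom_mul_eq hres' hk' (ρ' y)
      obtain ⟨x, rfl⟩ := mapRingHom_surjective residue_surjective x
      rw [← hj₀, ← hρ, ← hcomm, ← map_mul, ← hρ', ← map_mul, eq_comm, ← sub_eq_zero, ← map_sub,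
        ← sub_mul] at hx
      obtain ⟨z, hz⟩ := (mapRingHom_residue_eq_zero_iff hϖ' _).1 hx
      refine Submodule.mem_sup.2 ⟨F (hb.proj x), ⟨_, rfl⟩, ϖ • (z * b'),
        Submodule.smul_mem_smul (by rw [hϖ]; exact Ideal.mem_span_singleton_self ϖ) ⟨z, rfl⟩, ?_⟩
      have h1 : F (hb.proj x) = j x * b' := by
        change j (hb.proj x).1 * b' = _
        rw [IsBlock.proj_val, map_mul, mul_assoc, hbb']
      have h2 : ϖ • (z * b') = (algebraMap O O' ϖ • z) * b' := by
        rw [smul_mul_assoc, algebraMap_smul]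
      rw [h1, h2, ← hz, mul_assoc, hb'.idem.eq, sub_mul, add_sub_cancel]
      rfl
    obtain ⟨x, hx⟩ := hN ⟨y.1, rfl⟩
    refine ⟨x, Subtype.ext ?_⟩
    rw [blockHom_val]
    exact hx.trans (hb'.val_mul y)

end BlockIso

/-! ### Restriction of coefficients for bimodules -/

section CoeffHom

/-- A ring homomorphism from an `O`-algebra to an `O'`-algebra that is compatible with the
structural homomorphism `O → O'`. -/
structure CoeffHom (O O' A A' : Type u) [CommRing O] [CommRing O'] [Algebra O O'] [Ring A]
    [Algebra O A] [Ring A'] [Algebra O' A'] extends A →+* A' where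
  map_algebraMap : ∀ r, toRingHom (algebraMap O A r) = algebraMap O' A' (algebraMap O O' r)

variable {O O' : Type u} [CommRing O] [CommRing O'] [Algebra O O']
variable {A A' B B' C C' : Type u} [Ring A] [Algebra O A] [Ring A'] [Algebra O' A']
  [Ring B] [Algebra O B] [Ring B'] [Algebra O' B'] [Ring C] [Algebra O C] [Ring C'] [Algebra O' C']

/-- The ring homomorphism `A ⊗_O Bᵒᵖ → A' ⊗_{O'} B'ᵒᵖ` induced by `A → A'` and `B → B'`. -/
def CoeffHom.tensor (f : CoeffHom O O' A A') (g : CoeffHom O O' B B') :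
    A ⊗[O] Bᵐᵒᵖ →+* A' ⊗[O'] B'ᵐᵒᵖ :=
  letI : Algebra O (A' ⊗[O'] B'ᵐᵒᵖ) := Algebra.compHom _ (algebraMap O O')
  (Algebra.TensorProduct.lift
    (⟨(Algebra.TensorProduct.includeLeft : A' →ₐ[O'] A' ⊗[O'] B'ᵐᵒᵖ).toRingHom.comp f.toRingHom,
      fun r => by
        change (Algebra.TensorProduct.includeLeft : A' →ₐ[O'] A' ⊗[O'] B'ᵐᵒᵖ)
          (f.toRingHom (algebraMap O A r)) = _
        rw [f.map_algebraMap, AlgHom.commutes]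
        rfl⟩ : A →ₐ[O] A' ⊗[O'] B'ᵐᵒᵖ)
    (⟨(Algebra.TensorProduct.includeRight : B'ᵐᵒᵖ →ₐ[O'] A' ⊗[O'] B'ᵐᵒᵖ).toRingHom.comp
        g.toRingHom.op,
      fun r => by
        change (Algebra.TensorProduct.includeRight : B'ᵐᵒᵖ →ₐ[O'] A' ⊗[O'] B'ᵐᵒᵖ)
          (MulOpposite.op (g.toRingHom (algebraMap O B r))) = _
        rw [g.map_algebraMap]
        exact AlgHom.commutes
          (Algebra.TensorProduct.includeRight : B'ᵐᵒᵖ →ₐ[O'] A' ⊗[O'] B'ᵐᵒᵖ) (algebraMap O O' r)⟩ :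
        Bᵐᵒᵖ →ₐ[O] A' ⊗[O'] B'ᵐᵒᵖ)
    (fun a b => by
      change (f.toRingHom a ⊗ₜ[O'] (1 : B'ᵐᵒᵖ)) * ((1 : A') ⊗ₜ[O'] g.toRingHom.op b) =
        ((1 : A') ⊗ₜ[O'] g.toRingHom.op b) * (f.toRingHom a ⊗ₜ[O'] (1 : B'ᵐᵒᵖ))
      simp)).toRingHom

lemma CoeffHom.tensor_tmul (f : CoeffHom O O' A A') (g : CoeffHom O O' B B') (a : A)
    (b : Bᵐᵒᵖ) : f.tensor g (a ⊗ₜ[O] b) =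
      f.toRingHom a ⊗ₜ[O'] MulOpposite.op (g.toRingHom b.unop) := by
  change (f.toRingHom a ⊗ₜ[O'] (1 : B'ᵐᵒᵖ)) * ((1 : A') ⊗ₜ[O'] g.toRingHom.op b) = _
  simp

lemma CoeffHom.tensor_algebraMap (f : CoeffHom O O' A A') (g : CoeffHom O O' B B') (r : O) :
    f.tensor g (algebraMap O _ r) = algebraMap O' _ (algebraMap O O' r) := by
  rw [Algebra.TensorProduct.algebraMap_apply, CoeffHom.tensor_tmul, f.map_algebraMap,
    Algebra.TensorProduct.algebraMap_apply]
  simp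

lemma CoeffHom.tensor_surjective (f : CoeffHom O O' A A') (g : CoeffHom O O' B B')
    (hf : Function.Surjective f.toRingHom) (hg : Function.Surjective g.toRingHom) :
    Function.Surjective (f.tensor g) := by
  intro t
  induction t with
  | zero => exact ⟨0, map_zero _⟩
  | add s t hs ht =>
    obtain ⟨s, rfl⟩ := hs
    obtain ⟨t, rfl⟩ := ht
    exact ⟨s + t, map_add _ _ _⟩
  | tmul a b =>
    obtain ⟨a, rfl⟩ := hf a
    obtain ⟨b', hb⟩ := hg b.unop
    exact ⟨a ⊗ₜ[O] MulOpposite.op b', by rw [CoeffHom.tensor_tmul, MulOpposite.unop_op, hb,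
      MulOpposite.op_unop]⟩

/-- Restriction of coefficients for bimodules. -/
def resBimod (f : CoeffHom O O' A A') (g : CoeffHom O O' B B') :
    Bimod O' A' B' ⥤ Bimod O A B :=
  ModuleCat.restrictScalars (f.tensor g)

instance (f : CoeffHom O O' A A') (g : CoeffHom O O' B B') : (resBimod f g).Additive :=
  inferInstanceAs (ModuleCat.restrictScalars (f.tensor g)).Additive

variable (f : CoeffHom O O' A A') (g : CoeffHom O O' B B') (h : CoeffHom O O' C C')

/-- The identity map from a bimodule to its restriction. -/
def toRes (X : Bimod O' A' B') : X ≃+ (resBimod f g).obj X := AddEquiv.refl X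

lemma smul_toRes (X : Bimod O' A' B') (r : A ⊗[O] Bᵐᵒᵖ) (x : X) :
    r • toRes f g X x = toRes f g X (f.tensor g r • x) := rfl

lemma left_toRes (X : Bimod O' A' B') (a : A) (x : X) :
    ((resBimod f g).obj X).left a (toRes f g X x) =
      toRes f g X (X.left (f.toRingHom a) x) := by
  change f.tensor g (a ⊗ₜ[O] (1 : Bᵐᵒᵖ)) • x = (f.toRingHom a ⊗ₜ[O'] (1 : B'ᵐᵒᵖ)) • x
  rw [CoeffHom.tensor_tmul, MulOpposite.unop_one, map_one, MulOpposite.op_one]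

lemma right_toRes (X : Bimod O' A' B') (b : Bᵐᵒᵖ) (x : X) :
    ((resBimod f g).obj X).right b (toRes f g X x) =
      toRes f g X (X.right (MulOpposite.op (g.toRingHom b.unop)) x) := by
  change f.tensor g ((1 : A) ⊗ₜ[O] b) • x =
    ((1 : A') ⊗ₜ[O'] MulOpposite.op (g.toRingHom b.unop)) • x
  rw [CoeffHom.tensor_tmul, map_one]

lemma base_smul_toRes (X : Bimod O' A' B') (r : O) (x : X) :
    r • toRes f g X x = toRes f g X (algebraMap O O' r • x) := by
  change f.tensor g (algebraMap O _ r) • x = _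
  rw [CoeffHom.tensor_algebraMap]
  rfl

lemma Bimod.base_smul_right (X : Bimod O A B) (r : O) (x : X) :
    X.right (MulOpposite.op (algebraMap O B r)) x = r • x := by
  have : X.right (algebraMap O Bᵐᵒᵖ r) = algebraMap O _ r := X.right.commutes r
  exact LinearMap.congr_fun this x

lemma Bimod.base_smul_left (X : Bimod O A B) (r : O) (x : X) :
    X.left (algebraMap O A r) x = r • x :=
  LinearMap.congr_fun (X.left.commutes r) x

end CoeffHom

/-! ### Restriction of coefficients and tensor products -/

section Tensor

variable {O O' : Type u} [CommRing O] [CommRing O'] [Algebra O O']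
variable {A A' B B' C C' : Type u} [Ring A] [Algebra O A] [Ring A'] [Algebra O' A']
  [Ring B] [Algebra O B] [Ring B'] [Algebra O' B'] [Ring C] [Algebra O C] [Ring C'] [Algebra O' C']
variable (f : CoeffHom O O' A A') (g : CoeffHom O O' B B') (h : CoeffHom O O' C C')

lemma PreTensor.induction {X : Bimod O A B} {Y : Bimod O B C} {P : PreTensor X Y → Prop}
    (t : PreTensor X Y) (zero : P 0) (tmul : ∀ x y, P (PreTensor.tmul X Y x y))
    (add : ∀ s t, P s → P t → P (s + t)) : P t :=
  TensorProduct.induction_on t zero tmul add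

lemma PreTensor.tmul_smul_tmul (X : Bimod O A B) (Y : Bimod O B C) (a : A) (c : Cᵐᵒᵖ) (x : X)
    (y : Y) : (a ⊗ₜ[O] c) • PreTensor.tmul X Y x y =
      PreTensor.tmul X Y (X.left a x) (Y.right c y) :=
  PreTensor.action_tmul X Y a c x y

lemma tensorMk_balanced (X : Bimod O A B) (Y : Bimod O B C) (x : X) (b : B) (y : Y) :
    tensorMk X Y (X.right (MulOpposite.op b) x) y = tensorMk X Y x (Y.left b y) := by
  rw [← sub_eq_zero]
  exact (Submodule.Quotient.mk_eq_zero _).2 (Submodule.subset_span ⟨x, b, y, rfl⟩)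

lemma smul_tensorMk (X : Bimod O A B) (Y : Bimod O B C) (a : A) (c : Cᵐᵒᵖ) (x : X) (y : Y) :
    (a ⊗ₜ[O] c) • tensorMk X Y x y = tensorMk X Y (X.left a x) (Y.right c y) := by
  unfold tensorMk
  rw [← PreTensor.tmul_smul_tmul, map_smul]
  rfl

/-- The canonical map `X ⊗_O Y → X ⊗_{O'} Y`. -/
def resPreTensor (X : Bimod O' A' B') (Y : Bimod O' B' C') :
    PreTensor ((resBimod f g).obj X) ((resBimod g h).obj Y) →+ PreTensor X Y :=
  TensorProduct.liftAddHom
    (M := (resBimod f g).obj X) (N := (resBimod g h).obj Y) (R := O)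
    (AddMonoidHom.mk' (fun x => AddMonoidHom.mk'
        (fun y => PreTensor.tmul X Y ((toRes f g X).symm x) ((toRes g h Y).symm y))
        (fun y y' => TensorProduct.tmul_add _ _ _))
      (fun x x' => AddMonoidHom.ext fun y => TensorProduct.add_tmul _ _ _))
    (fun r x y => by
      obtain ⟨x, rfl⟩ := (toRes f g X).surjective x
      obtain ⟨y, rfl⟩ := (toRes g h Y).surjective y
      rw [base_smul_toRes, base_smul_toRes]
      exact TensorProduct.smul_tmul (R := O') (R' := O') (M := X) (N := Y) _ _ _)

lemma resPreTensor_tmul (X : Bimod O' A' B') (Y : Bimod O' B' C') (x : X) (y : Y) :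
    resPreTensor f g h X Y (PreTensor.tmul _ _ (toRes f g X x) (toRes g h Y y)) =
      PreTensor.tmul X Y x y :=
  rfl

lemma resPreTensor_smul (X : Bimod O' A' B') (Y : Bimod O' B' C') (r : A ⊗[O] Cᵐᵒᵖ)
    (t : PreTensor ((resBimod f g).obj X) ((resBimod g h).obj Y)) :
    resPreTensor f g h X Y (r • t) = f.tensor h r • resPreTensor f g h X Y t := by
  induction r with
  | zero =>
    rw [map_zero, zero_smul (A ⊗[O] Cᵐᵒᵖ) t, zero_smul (A' ⊗[O'] C'ᵐᵒᵖ) (_ : PreTensor X Y),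
      map_zero]
  | add r s hr hs => rw [map_add, add_smul, add_smul, map_add, hr, hs]
  | tmul a c =>
    induction t using PreTensor.induction with
    | zero => rw [smul_zero, map_zero, smul_zero]
    | add s t hs ht => rw [smul_add, map_add, map_add, smul_add, hs, ht]
    | tmul x y =>
      obtain ⟨x, rfl⟩ := (toRes f g X).surjective x
      obtain ⟨y, rfl⟩ := (toRes g h Y).surjective y
      rw [PreTensor.tmul_smul_tmul, left_toRes, right_toRes, resPreTensor_tmul,
        resPreTensor_tmul, CoeffHom.tensor_tmul, PreTensor.tmul_smul_tmul]

/-- The canonical homomorphism `X ⊗_B Y → X ⊗_{B'} Y`. -/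
def resTensorHom (X : Bimod O' A' B') (Y : Bimod O' B' C') :
    tensorObj ((resBimod f g).obj X) ((resBimod g h).obj Y) ⟶
      (resBimod f h).obj (tensorObj X Y) :=
  ModuleCat.ofHom (Y := (resBimod f h).obj (tensorObj X Y)) (Submodule.liftQ _
    ({ toFun := fun t => toRes f h _ ((PreTensor.relations X Y).mkQ (resPreTensor f g h X Y t))
       map_add' := fun s t => by rw [map_add, map_add, ← map_add]; rfl
       map_smul' := fun r t => by rw [resPreTensor_smul, map_smul]; rfl } :
      PreTensor ((resBimod f g).obj X) ((resBimod g h).obj Y) →ₗ[A ⊗[O] Cᵐᵒᵖ]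
        (resBimod f h).obj (tensorObj X Y)) (by
    rw [PreTensor.relations, Submodule.span_le]
    rintro _ ⟨x, b, y, rfl⟩
    obtain ⟨x, rfl⟩ := (toRes f g X).surjective x
    obtain ⟨y, rfl⟩ := (toRes g h Y).surjective y
    refine (Submodule.Quotient.mk_eq_zero _).2 (Submodule.subset_span ⟨x, g.toRingHom b, y, ?_⟩)
    rw [right_toRes, left_toRes]
    exact map_sub (resPreTensor f g h X Y) _ _))

lemma resTensorHom_naturality {X X' : Bimod O' A' B'} {Y Y' : Bimod O' B' C'} (φ : X ⟶ X')
    (ψ : Y ⟶ Y') : tensorMap ((resBimod f g).map φ) ((resBimod g h).map ψ) ≫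
      resTensorHom f g h X' Y' = resTensorHom f g h X Y ≫ (resBimod f h).map (tensorMap φ ψ) :=
  tensor_hom_ext fun _ _ => rfl

/-- The inverse of the canonical homomorphism `X ⊗_B Y → X ⊗_{B'} Y`, before passing to the
quotient. -/
def resPreTensorInv (hg : Function.Surjective g.toRingHom) (X : Bimod O' A' B')
    (Y : Bimod O' B' C') :
    PreTensor X Y →+ tensorObj ((resBimod f g).obj X) ((resBimod g h).obj Y) :=
  TensorProduct.liftAddHom (M := X) (N := Y) (R := O')
    (AddMonoidHom.mk' (fun x => AddMonoidHom.mk'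
        (fun y => tensorMk _ _ (toRes f g X x) (toRes g h Y y))
        (fun y y' => tensorMk_add_right _ _ _ _ _))
      (fun x x' => AddMonoidHom.ext fun y => tensorMk_add_left _ _ _ _ _))
    (fun r x y => by
      change tensorMk _ _ (toRes f g X (r • x)) (toRes g h Y y) =
        tensorMk _ _ (toRes f g X x) (toRes g h Y (r • y))
      -- The scalar `r` acts on `X` and on `Y` through its image in `B'`, which comes from some `b`
      -- in `B`; balancing over `B` moves it across.
      obtain ⟨b, hb⟩ := hg (algebraMap O' B' r)
      rw [← Bimod.base_smul_right, ← Bimod.base_smul_left, ← hb, ← left_toRes,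
        ← tensorMk_balanced, right_toRes, MulOpposite.unop_op])

lemma resPreTensorInv_tmul (hg : Function.Surjective g.toRingHom) (X : Bimod O' A' B')
    (Y : Bimod O' B' C') (x : X) (y : Y) : resPreTensorInv f g h hg X Y (PreTensor.tmul X Y x y) =
      tensorMk _ _ (toRes f g X x) (toRes g h Y y) := rfl

lemma resPreTensorInv_smul (hg : Function.Surjective g.toRingHom) (X : Bimod O' A' B')
    (Y : Bimod O' B' C') (r : A ⊗[O] Cᵐᵒᵖ) (t : PreTensor X Y) :
    resPreTensorInv f g h hg X Y (f.tensor h r • t) = r • resPreTensorInv f g h hg X Y t := by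
  induction r with
  | zero =>
    rw [map_zero, zero_smul (A' ⊗[O'] C'ᵐᵒᵖ) t, map_zero]
    exact (zero_smul (A ⊗[O] Cᵐᵒᵖ) (resPreTensorInv f g h hg X Y t)).symm
  | add r s hr hs => rw [map_add, add_smul, add_smul, map_add, hr, hs]
  | tmul a c =>
    induction t using PreTensor.induction with
    | zero => rw [smul_zero, map_zero, smul_zero]
    | add s t hs ht => rw [smul_add, map_add, map_add, smul_add, hs, ht]
    | tmul x y =>
      rw [resPreTensorInv_tmul, smul_tensorMk, left_toRes, right_toRes,
        CoeffHom.tensor_tmul, PreTensor.tmul_smul_tmul, resPreTensorInv_tmul]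

/-- The relations are a span over `A' ⊗ C'ᵐᵒᵖ`, while the target only has an action of `A ⊗ Cᵐᵒᵖ`;
surjectivity of `f.tensor h` bridges the two. -/
lemma resPreTensorInv_relations (hg : Function.Surjective g.toRingHom)
    (hfh : Function.Surjective (f.tensor h)) (X : Bimod O' A' B') (Y : Bimod O' B' C')
    (t : PreTensor X Y) (ht : t ∈ PreTensor.relations X Y) :
    resPreTensorInv f g h hg X Y t = 0 := by
  induction ht using Submodule.span_induction with
  | zero => exact map_zero _
  | add s t _ _ hs ht => rw [map_add, hs, ht, add_zero]
  | smul r t _ ht =>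
    obtain ⟨r, rfl⟩ := hfh r
    rw [resPreTensorInv_smul, ht, smul_zero]
  | mem t ht =>
    obtain ⟨x, b, y, rfl⟩ := ht
    obtain ⟨b, rfl⟩ := hg b
    refine (map_sub (resPreTensorInv f g h hg X Y) (PreTensor.tmul X Y _ _)
      (PreTensor.tmul X Y _ _)).trans (sub_eq_zero.2 ?_)
    rw [resPreTensorInv_tmul, resPreTensorInv_tmul, ← left_toRes, ← tensorMk_balanced, right_toRes,
      MulOpposite.unop_op]

lemma resPreTensorInv_resPreTensor (hg : Function.Surjective g.toRingHom) (X : Bimod O' A' B')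
    (Y : Bimod O' B' C') (t : PreTensor ((resBimod f g).obj X) ((resBimod g h).obj Y)) :
    resPreTensorInv f g h hg X Y (resPreTensor f g h X Y t) = (PreTensor.relations _ _).mkQ t := by
  induction t using PreTensor.induction with
  | zero => rw [map_zero, map_zero, map_zero]; rfl
  | add s t hs ht => rw [map_add, map_add, map_add, hs, ht]; rfl
  | tmul x y => rfl

lemma resTensorHom_bijective (hg : Function.Surjective g.toRingHom)
    (hfh : Function.Surjective (f.tensor h)) (X : Bimod O' A' B') (Y : Bimod O' B' C') :
    Function.Bijective (resTensorHom f g h X Y).hom := by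
  constructor
  · rw [injective_iff_map_eq_zero]
    intro z hz
    obtain ⟨t, rfl⟩ := Submodule.mkQ_surjective _ z
    have h1 : resPreTensor f g h X Y t ∈ PreTensor.relations X Y :=
      (Submodule.Quotient.mk_eq_zero _).1 hz
    rw [← resPreTensorInv_resPreTensor f g h hg X Y, resPreTensorInv_relations f g h hg hfh X Y _ h1]
  · intro z
    obtain ⟨t, rfl⟩ := (PreTensor.relations X Y).mkQ_surjective z
    induction t using PreTensor.induction with
    | zero => exact ⟨0, (map_zero _).trans (map_zero _).symm⟩
    | add s t hs ht =>
      obtain ⟨s', hs⟩ := hs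
      obtain ⟨t', ht⟩ := ht
      exact ⟨s' + t', by rw [map_add, hs, ht, map_add]; rfl⟩
    | tmul x y => exact ⟨tensorMk _ _ (toRes f g X x) (toRes g h Y y), rfl⟩

/-- Restriction of coefficients commutes with tensor products. -/
def resTensorIso (hg : Function.Surjective g.toRingHom)
    (hfh : Function.Surjective (f.tensor h)) (X : Bimod O' A' B') (Y : Bimod O' B' C') :
    tensorObj ((resBimod f g).obj X) ((resBimod g h).obj Y) ≅
      (resBimod f h).obj (tensorObj X Y) :=
  haveI : IsIso (resTensorHom f g h X Y) :=
    (ConcreteCategory.isIso_iff_bijective _).2 (resTensorHom_bijective f g h hg hfh X Y)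
  asIso (resTensorHom f g h X Y)

end Tensor

/-! ### Restriction of coefficients, duals and regular bimodules -/

section Dual

variable {O O' : Type u} [CommRing O] [CommRing O'] [Algebra O O']
variable {A A' B B' C C' : Type u} [Ring A] [Algebra O A] [Ring A'] [Algebra O' A']
  [Ring B] [Algebra O B] [Ring B'] [Algebra O' B'] [Ring C] [Algebra O C] [Ring C'] [Algebra O' C']
variable (f : CoeffHom O O' A A') (g : CoeffHom O O' B B') (h : CoeffHom O O' C C')
variable (τ : O' →ₗ[O] O)

/-- A linear form on a bimodule. -/
def DualSpace.toLinear {X : Bimod O A B} (φ : dualObj X) : X →ₗ[O] O := φ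

lemma DualSpace.toLinear_smul {X : Bimod O A B} (a : A) (b : B) (φ : dualObj X) (x : X) :
    DualSpace.toLinear ((b ⊗ₜ[O] MulOpposite.op a : B ⊗[O] Aᵐᵒᵖ) • φ) x =
      DualSpace.toLinear φ (X.left a (X.right (MulOpposite.op b) x)) := by
  change DualSpace.action X (b ⊗ₜ[O] MulOpposite.op a) φ x = _
  rw [DualSpace.action, Algebra.TensorProduct.lift_tmul]
  rfl

lemma DualSpace.ext_toLinear {X : Bimod O A B} {φ ψ : dualObj X}
    (h : ∀ x, DualSpace.toLinear φ x = DualSpace.toLinear ψ x) : φ = ψ :=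
  LinearMap.ext h

/-- The map `Hom_{O'}(X, O') → Hom_O(X, O)` given by composition with a linear form on `O'`. -/
def resDualAddHom (X : Bimod O' A' B') : dualObj X →+ dualObj ((resBimod f g).obj X) where
  toFun := fun φ =>
    ({ toFun := fun x => τ (DualSpace.toLinear φ ((toRes f g X).symm x))
       map_add' := fun x y => by rw [map_add, map_add, map_add]
       map_smul' := fun r x => by
        obtain ⟨x, rfl⟩ := (toRes f g X).surjective x
        rw [base_smul_toRes, AddEquiv.symm_apply_apply, AddEquiv.symm_apply_apply, map_smul,
          algebraMap_smul, map_smul, RingHom.id_apply] } : (resBimod f g).obj X →ₗ[O] O)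
  map_zero' := LinearMap.ext fun _ => map_zero τ
  map_add' := fun _ _ => LinearMap.ext fun _ => map_add τ _ _

lemma resDualAddHom_apply (X : Bimod O' A' B') (φ : dualObj X) (x : X) :
    DualSpace.toLinear (resDualAddHom f g τ X φ) (toRes f g X x) =
      τ (DualSpace.toLinear φ x) := rfl

lemma resDualAddHom_smul (X : Bimod O' A' B') (r : B ⊗[O] Aᵐᵒᵖ) (φ : dualObj X) :
    resDualAddHom f g τ X (g.tensor f r • φ) = r • resDualAddHom f g τ X φ := by
  induction r with
  | zero =>
    rw [map_zero, zero_smul (B' ⊗[O'] A'ᵐᵒᵖ) φ, map_zero]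
    exact (zero_smul (B ⊗[O] Aᵐᵒᵖ) (resDualAddHom f g τ X φ)).symm
  | add r s hr hs => rw [map_add, add_smul, add_smul, map_add, hr, hs]
  | tmul b a =>
    obtain ⟨a, rfl⟩ := MulOpposite.op_surjective a
    refine DualSpace.ext_toLinear fun x => ?_
    obtain ⟨x, rfl⟩ := (toRes f g X).surjective x
    rw [DualSpace.toLinear_smul, right_toRes, left_toRes, resDualAddHom_apply,
      resDualAddHom_apply, CoeffHom.tensor_tmul, MulOpposite.unop_op, MulOpposite.unop_op,
      DualSpace.toLinear_smul]

/-- The bimodule homomorphism `Hom_{O'}(X, O') → Hom_O(X, O)` given by composition with a linear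
form on `O'`. -/
def resDualHom (X : Bimod O' A' B') :
    (resBimod g f).obj (dualObj X) ⟶ dualObj ((resBimod f g).obj X) :=
  ModuleCat.ofHom (X := (resBimod g f).obj (dualObj X)) (Y := DualSpace ((resBimod f g).obj X))
    { toFun := fun φ => resDualAddHom f g τ X ((toRes g f _).symm φ)
      map_add' := fun _ _ => map_add (resDualAddHom f g τ X) _ _
      map_smul' := fun r _ => resDualAddHom_smul f g τ X r _ }

lemma resDualHom_apply (X : Bimod O' A' B') (φ : dualObj X) (x : X) :
    DualSpace.toLinear ((resDualHom f g τ X).hom (toRes g f _ φ)) (toRes f g X x) =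
      τ (DualSpace.toLinear φ x) := rfl

lemma resDualHom_naturality {X Y : Bimod O' A' B'} (φ : X ⟶ Y) :
    (resBimod g f).map (dualMap φ) ≫ resDualHom f g τ X =
      resDualHom f g τ Y ≫ dualMap ((resBimod f g).map φ) := rfl

/-- For `ψ` on the restricted bimodule and `x` in `X`, the form `r ↦ ψ (r x)` on `O'` is `τ (l x *
·)` for exactly one `l x`. Uniqueness makes `l` linear over `O'`, and `r = 1` gives `τ ∘ l = ψ`. -/
lemma resDualHom_bijective
    (hτ : Function.Bijective fun x : O' => τ ∘ₗ LinearMap.mulLeft O x) (X : Bimod O' A' B') :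
    Function.Bijective (resDualHom f g τ X).hom := by
  constructor
  · rw [injective_iff_map_eq_zero]
    intro φ hφ
    obtain ⟨φ, rfl⟩ := (toRes g f _).surjective φ
    suffices φ = 0 by rw [this, map_zero]
    refine DualSpace.ext_toLinear fun x => ?_
    apply hτ.1
    ext r
    change τ (DualSpace.toLinear φ x * r) = τ (0 * r)
    rw [zero_mul, map_zero, mul_comm, ← smul_eq_mul, ← map_smul, ← resDualHom_apply f g, hφ]
    rfl
  · intro ψ
    let m : X → O' →ₗ[O] O := fun x =>
      { toFun := fun r => DualSpace.toLinear ψ (toRes f g X (r • x))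
        map_add' := fun r s => by rw [add_smul, map_add, map_add]
        map_smul' := fun r s => by
          rw [Algebra.smul_def, mul_smul, ← base_smul_toRes, map_smul, RingHom.id_apply] }
    choose l hl using fun x => hτ.2 (m x)
    have hl' : ∀ x r, τ (l x * r) = DualSpace.toLinear ψ (toRes f g X (r • x)) := fun x r =>
      LinearMap.congr_fun (hl x) r
    let φ : X →ₗ[O'] O' :=
      { toFun := l
        map_add' := fun x y => hτ.1 (by
          ext r
          change τ (l (x + y) * r) = τ ((l x + l y) * r)
          rw [add_mul, map_add, hl', hl', hl', smul_add, map_add, map_add])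
        map_smul' := fun s x => hτ.1 (by
          ext r
          change τ (l (s • x) * r) = τ (s * l x * r)
          rw [mul_comm s, mul_assoc, hl', hl', smul_smul, mul_comm s]) }
    refine ⟨toRes g f (dualObj X) φ, DualSpace.ext_toLinear fun x => ?_⟩
    obtain ⟨x, rfl⟩ := (toRes f g X).surjective x
    change τ (l x) = _
    rw [← mul_one (l x), hl', one_smul]

variable {τ} in
/-- Restriction of coefficients commutes with duals. -/
def resDualIso (hτ : Function.Bijective fun x : O' => τ ∘ₗ LinearMap.mulLeft O x)
    (X : Bimod O' A' B') :
    (resBimod g f).obj (dualObj X) ≅ dualObj ((resBimod f g).obj X) :=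
  haveI : IsIso (resDualHom f g τ X) :=
    (ConcreteCategory.isIso_iff_bijective _).2 (resDualHom_bijective f g τ hτ X)
  asIso (resDualHom f g τ X)

lemma resRegular_smul (r : A ⊗[O] Aᵐᵒᵖ) (x : Bimod.regular O A) :
    f.toRingHom (show A from r • x) = f.tensor f r • (show Bimod.regular O' A' from f.toRingHom x) := by
  induction r with
  | zero =>
    rw [map_zero, zero_smul (A ⊗[O] Aᵐᵒᵖ) x]
    exact (map_zero f.toRingHom).trans (zero_smul (A' ⊗[O'] A'ᵐᵒᵖ) (_ : Bimod.regular O' A')).symm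
  | add r s hr hs =>
    rw [map_add, add_smul, add_smul, ← hr, ← hs]
    exact map_add f.toRingHom _ _
  | tmul a b =>
    rw [CoeffHom.tensor_tmul]
    change f.toRingHom (a * ((show A from x) * b.unop)) =
      f.toRingHom a * (f.toRingHom x * f.toRingHom b.unop)
    rw [map_mul, map_mul]

/-- Restriction of coefficients of the regular bimodule. -/
def resRegularHom : Bimod.regular O A ⟶ (resBimod f f).obj (Bimod.regular O' A') :=
  ModuleCat.ofHom (X := Bimod.regular O A) (Y := (resBimod f f).obj (Bimod.regular O' A'))
    { toFun := fun a => toRes f f (Bimod.regular O' A') (f.toRingHom a)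
      map_add' := fun a b => map_add f.toRingHom a b
      map_smul' := fun r x => by
        refine Eq.trans ?_ (congrArg (toRes f f _) (resRegular_smul f r x))
        rfl }

/-- Restriction of coefficients of the regular bimodule, for an isomorphism `A ≅ A'`. -/
def resRegularIso (hf : Function.Bijective f.toRingHom) :
    Bimod.regular O A ≅ (resBimod f f).obj (Bimod.regular O' A') :=
  haveI : IsIso (resRegularHom f) := (ConcreteCategory.isIso_iff_bijective _).2 hf
  asIso (resRegularHom f)

lemma resBimod_finite (hf : Function.Surjective f.toRingHom) (hg : Function.Surjective g.toRingHom)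
    (X : Bimod O' A' B') (hX : Module.Finite (A' ⊗[O'] B'ᵐᵒᵖ) X) :
    Module.Finite (A ⊗[O] Bᵐᵒᵖ) ((resBimod f g).obj X) := by
  obtain ⟨s, hs⟩ := hX.fg_top
  refine ⟨⟨s, eq_top_iff.2 fun x _ => ?_⟩⟩
  have hx : x ∈ Submodule.span (A' ⊗[O'] B'ᵐᵒᵖ) (s : Set X) := by rw [hs]; trivial
  induction hx using Submodule.span_induction with
  | mem x h => exact Submodule.subset_span h
  | zero => exact Submodule.zero_mem _
  | add x y _ _ hx hy => exact Submodule.add_mem _ (hx trivial) (hy trivial)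
  | smul a x _ hx =>
    obtain ⟨a, rfl⟩ := CoeffHom.tensor_surjective f g hf hg a
    exact Submodule.smul_mem _ a (hx trivial)

/-- The map `e` is a semilinear equivalence along the ring isomorphism `σ`, and both properties are
invariant under such equivalences. -/
theorem finite_projective_of_bijective {R S M N : Type u} [Ring R] [Ring S] [AddCommGroup M]
    [AddCommGroup N] [Module R M] [Module S N] (σ : R →+* S) (hσ : Function.Bijective σ)
    (e : M ≃+ N) (he : ∀ r m, e (r • m) = σ r • e m) (h1 : Module.Finite S N)
    (h2 : Module.Projective S N) : Module.Finite R M ∧ Module.Projective R M := by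
  let σ' : R ≃+* S := RingEquiv.ofBijective σ hσ
  have : RingHomInvPair (σ' : R →+* S) (σ'.symm : S →+* R) := RingHomInvPair.of_ringEquiv σ'
  have : RingHomInvPair (σ'.symm : S →+* R) (σ' : R →+* S) := RingHomInvPair.of_ringEquiv σ'.symm
  let e' : M ≃ₛₗ[(σ' : R →+* S)] N := { e with map_smul' := he }
  exact ⟨Module.Finite.of_surjective (σ := (σ'.symm : S →+* R)) e'.symm.toLinearMap e'.symm.surjective,
    Module.Projective.of_equiv (R := S) (S := R) e'.symm⟩

lemma resBimod_isBiprojective (hf : Function.Bijective f.toRingHom)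
    (hg : Function.Bijective g.toRingHom) {X : Bimod O' A' B'} (hX : X.IsBiprojective) :
    ((resBimod f g).obj X).IsBiprojective := by
  have hl := finite_projective_of_bijective (M := ((resBimod f g).obj X).leftModule) f.toRingHom hf
    (show ((resBimod f g).obj X).leftModule ≃+ X.leftModule from (toRes f g X).symm)
    (left_toRes f g X) hX.left_finite hX.left_projective
  have hr := finite_projective_of_bijective (M := ((resBimod f g).obj X).rightModule)
    g.toRingHom.op ⟨fun x y h => MulOpposite.unop_injective (hg.1 (MulOpposite.op_injective h)),
      fun x => by
        obtain ⟨y, hy⟩ := hg.2 x.unop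
        exact ⟨MulOpposite.op y, MulOpposite.unop_injective hy⟩⟩
    (show ((resBimod f g).obj X).rightModule ≃+ X.rightModule from (toRes f g X).symm)
    (right_toRes f g X) hX.right_finite hX.right_projective
  exact ⟨hl.1, hl.2, hr.1, hr.2⟩

end Dual

/-! ### Morita equivalences -/

section Morita

variable {O O' : Type u} [CommRing O] [CommRing O'] [Algebra O O']
variable {A A' B B' : Type u} [Ring A] [Algebra O A] [Ring A'] [Algebra O' A']
  [Ring B] [Algebra O B] [Ring B'] [Algebra O' B']
variable (f : CoeffHom O O' A A') (g : CoeffHom O O' B B')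

variable (O O') in
/-- The structural homomorphism `O → O'`, as a homomorphism of coefficient rings. -/
def CoeffHom.base : CoeffHom O O' O O' := ⟨algebraMap O O', fun _ => rfl⟩

/-- An `(A, O)`-bimodule is just an `A`-module, so the map becomes `f` after contracting the factors
`Oᵐᵒᵖ` and `O'ᵐᵒᵖ`. This holds although `O → O'` itself need not be surjective. -/
lemma CoeffHom.tensor_base_bijective (hf : Function.Bijective f.toRingHom) :
    Function.Bijective (f.tensor (CoeffHom.base O O')) := by
  let e : A ⊗[O] Oᵐᵒᵖ ≃ₗ[O] A :=
    LinearEquiv.lTensor A (MulOpposite.opLinearEquiv O).symm ≪≫ₗ TensorProduct.rid O A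
  let e' : A' ⊗[O'] O'ᵐᵒᵖ ≃ₗ[O'] A' :=
    LinearEquiv.lTensor A' (MulOpposite.opLinearEquiv O').symm ≪≫ₗ TensorProduct.rid O' A'
  have key : (e' ∘ f.tensor (CoeffHom.base O O') : A ⊗[O] Oᵐᵒᵖ → A') = f.toRingHom ∘ e := by
    funext t
    simp only [Function.comp_apply]
    induction t with
    | zero => rw [map_zero, map_zero, map_zero, map_zero]
    | add s t hs ht => rw [map_add, map_add, map_add, map_add, hs, ht]
    | tmul a b =>
      rw [CoeffHom.tensor_tmul]
      change algebraMap O O' b.unop • f.toRingHom a = f.toRingHom (b.unop • a)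
      rw [Algebra.smul_def, Algebra.smul_def, map_mul, f.map_algebraMap]
  have : Function.Bijective (e' ∘ f.tensor (CoeffHom.base O O')) := by
    rw [key]; exact hf.comp e.bijective
  exact (Function.Bijective.of_comp_iff' e'.bijective _).1 this

lemma resBimod_base_isEquivalence (hf : Function.Bijective f.toRingHom) :
    (resBimod f (CoeffHom.base O O')).IsEquivalence :=
  ModuleCat.restrictScalars_isEquivalence_of_ringEquiv
    (RingEquiv.ofBijective _ (f.tensor_base_bijective hf))

/-- Restriction is an equivalence on left modules over either algebra and intertwines the two tensor
functors, so one functor is an equivalence when the other is. -/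
theorem resBimod_isMorita (hf : Function.Bijective f.toRingHom)
    (hg : Function.Bijective g.toRingHom) {M : Bimod O' A' B'} (hM : IsMorita M) :
    IsMorita ((resBimod f g).obj M) where
  biprojective := resBimod_isBiprojective f g hf hg hM.biprojective
  equivalence := by
    have := hM.equivalence
    have := resBimod_base_isEquivalence f hf
    have := resBimod_base_isEquivalence g hg
    let F := resBimod g (CoeffHom.base O O')
    let e : F ⋙ (tensorFunctor O A B O).obj ((resBimod f g).obj M) ≅
        (tensorFunctor O' A' B' O').obj M ⋙ resBimod f (CoeffHom.base O O') :=
      NatIso.ofComponents (fun Y => resTensorIso f g (CoeffHom.base O O') hg.2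
        (f.tensor_base_bijective hf).2 M Y) (fun φ => by
          refine Eq.trans ?_ (resTensorHom_naturality f g (CoeffHom.base O O') (𝟙 M) φ)
          exact tensor_hom_ext fun _ _ => rfl)
    have := Functor.isEquivalence_of_iso e.symm
    exact Functor.isEquivalence_of_comp_left F _

end Morita

/-! ### Total complexes and functors preserving coproducts -/

section MapBifunctor

open HomologicalComplex

variable {C₁ C₂ D C₁' C₂' D' : Type*} [Category* C₁] [Category* C₂] [Category* D]
  [Category* C₁'] [Category* C₂'] [Category* D']
  [Preadditive C₁] [Preadditive C₂] [Preadditive D]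
  [Preadditive C₁'] [Preadditive C₂'] [Preadditive D']
  {F : C₁ ⥤ C₂ ⥤ D} {F' : C₁' ⥤ C₂' ⥤ D'} [F.Additive] [∀ X, (F.obj X).Additive]
  [F'.Additive] [∀ X, (F'.obj X).Additive]
  {R₁ : C₁ ⥤ C₁'} {R₂ : C₂ ⥤ C₂'} {R : D ⥤ D'} [R₁.Additive] [R₂.Additive]
  (α : ∀ X Y, (F'.obj (R₁.obj X)).obj (R₂.obj Y) ≅ R.obj ((F.obj X).obj Y))
  (K₁ : CochainComplex C₁ ℤ) (K₂ : CochainComplex C₂ ℤ)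
  [HasMapBifunctor K₁ K₂ F (ComplexShape.up ℤ)]
  [HasMapBifunctor ((R₁.mapHomologicalComplex (ComplexShape.up ℤ)).obj K₁)
    ((R₂.mapHomologicalComplex (ComplexShape.up ℤ)).obj K₂) F' (ComplexShape.up ℤ)]

/-- The canonical map from the total complex of `F'(R₁ K₁, R₂ K₂)` to `R` of the total complex of
`F(K₁, K₂)`, in degree `n`. -/
def mapBifunctorComparison (n : ℤ) :
    (mapBifunctor ((R₁.mapHomologicalComplex (ComplexShape.up ℤ)).obj K₁)
      ((R₂.mapHomologicalComplex (ComplexShape.up ℤ)).obj K₂) F' (ComplexShape.up ℤ)).X n ⟶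
    R.obj ((mapBifunctor K₁ K₂ F (ComplexShape.up ℤ)).X n) :=
  mapBifunctorDesc (fun i j h => (α (K₁.X i) (K₂.X j)).hom ≫
    R.map (ιMapBifunctor K₁ K₂ F (ComplexShape.up ℤ) i j n h))

lemma ι_mapBifunctorComparison (n i j : ℤ) (h) :
    ιMapBifunctor ((R₁.mapHomologicalComplex (ComplexShape.up ℤ)).obj K₁)
      ((R₂.mapHomologicalComplex (ComplexShape.up ℤ)).obj K₂) F' (ComplexShape.up ℤ) i j n h ≫
      mapBifunctorComparison α K₁ K₂ n = (α (K₁.X i) (K₂.X j)).hom ≫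
        R.map (ιMapBifunctor K₁ K₂ F (ComplexShape.up ℤ) i j n h) :=
  ι_mapBifunctorDesc _ _ _ _

/-- Degree `n` of a total complex is a coproduct over the pairs `(i, j)` lying over `n`. Its image
under `R` is still a coproduct, and the inverse is assembled there from the inverses of the `α`. -/
theorem isIso_mapBifunctorComparison [∀ J : Type, PreservesColimitsOfShape (Discrete J) R] (n : ℤ) :
    IsIso (mapBifunctorComparison α K₁ K₂ n) := by
  let G := (((F.mapBifunctorHomologicalComplex (ComplexShape.up ℤ)
    (ComplexShape.up ℤ)).obj K₁).obj K₂).toGradedObject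
  let π := ComplexShape.π (ComplexShape.up ℤ) (ComplexShape.up ℤ) (ComplexShape.up ℤ)
  have hc := isColimitOfHasCoproductOfPreservesColimit R (G.mapObjFun π n)
  let s : ∀ x : π ⁻¹' {n}, R.obj (G.mapObjFun π n x) ⟶
      (mapBifunctor ((R₁.mapHomologicalComplex (ComplexShape.up ℤ)).obj K₁)
      ((R₂.mapHomologicalComplex (ComplexShape.up ℤ)).obj K₂) F' (ComplexShape.up ℤ)).X n :=
    fun x => (α (K₁.X x.1.1) (K₂.X x.1.2)).inv ≫
      ιMapBifunctor ((R₁.mapHomologicalComplex (ComplexShape.up ℤ)).obj K₁)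
      ((R₂.mapHomologicalComplex (ComplexShape.up ℤ)).obj K₂) F' (ComplexShape.up ℤ)
        x.1.1 x.1.2 n x.2
  have hs : ∀ (i j : ℤ) (h : π (i, j) = n),
      R.map (ιMapBifunctor K₁ K₂ F (ComplexShape.up ℤ) i j n h) ≫
        Cofan.IsColimit.desc hc s = s ⟨(i, j), h⟩ := fun i j h =>
    Cofan.IsColimit.fac hc s ⟨(i, j), h⟩
  refine ⟨Cofan.IsColimit.desc hc s, ?_, ?_⟩
  · refine mapBifunctor.hom_ext fun i j h => ?_
    refine (Category.assoc _ _ _).symm.trans ?_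
    rw [ι_mapBifunctorComparison]
    refine (Category.assoc _ _ _).trans ?_
    rw [hs]
    exact (Iso.hom_inv_id_assoc _ _).trans (Category.comp_id _).symm
  · refine Cofan.IsColimit.hom_ext hc _ _ fun x => ?_
    obtain ⟨⟨i, j⟩, h⟩ := x
    replace h : π (i, j) = n := h
    change R.map (ιMapBifunctor K₁ K₂ F (ComplexShape.up ℤ) i j n h) ≫ _ =
      R.map (ιMapBifunctor K₁ K₂ F (ComplexShape.up ℤ) i j n h) ≫ 𝟙 _
    refine (Category.assoc _ _ _).symm.trans ((congrArg (· ≫ _) (hs i j h)).trans ?_)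
    exact (Category.assoc _ _ _).trans (((congrArg (_ ≫ ·)
      (ι_mapBifunctorComparison α K₁ K₂ n i j h)).trans (Iso.inv_hom_id_assoc _ _)).trans
        (Category.comp_id _).symm)

lemma d₁_mapBifunctorComparison [R.Additive]
    (hα : ∀ {X X' : C₁} (φ : X ⟶ X') (Y : C₂), (F'.map (R₁.map φ)).app (R₂.obj Y) ≫
      (α X' Y).hom = (α X Y).hom ≫ R.map ((F.map φ).app Y)) (i j n : ℤ) :
    mapBifunctor.d₁ ((R₁.mapHomologicalComplex (ComplexShape.up ℤ)).obj K₁)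
      ((R₂.mapHomologicalComplex (ComplexShape.up ℤ)).obj K₂) F' (ComplexShape.up ℤ) i j n ≫
      mapBifunctorComparison α K₁ K₂ n = (α (K₁.X i) (K₂.X j)).hom ≫
        R.map (mapBifunctor.d₁ K₁ K₂ F (ComplexShape.up ℤ) i j n) := by
  by_cases h : ComplexShape.π (ComplexShape.up ℤ) (ComplexShape.up ℤ) (ComplexShape.up ℤ)
    (i + 1, j) = n
  · rw [mapBifunctor.d₁_eq _ _ _ _ (show (ComplexShape.up ℤ).Rel i (i + 1) from rfl) j n h,
      mapBifunctor.d₁_eq _ _ _ _ (show (ComplexShape.up ℤ).Rel i (i + 1) from rfl) j n h,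
      R.map_units_smul, Linear.units_smul_comp, Linear.comp_units_smul, Category.assoc,
      ι_mapBifunctorComparison, R.map_comp]
    exact congrArg _ (((Category.assoc _ _ _).symm.trans
      (congrArg (· ≫ _) (hα (K₁.d i (i + 1)) (K₂.X j)))).trans (Category.assoc _ _ _))
  · rw [mapBifunctor.d₁_eq_zero' _ _ _ _ (show (ComplexShape.up ℤ).Rel i (i + 1) from rfl) j n h,
      mapBifunctor.d₁_eq_zero' _ _ _ _ (show (ComplexShape.up ℤ).Rel i (i + 1) from rfl) j n h,
      zero_comp, R.map_zero, comp_zero]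
    rfl

lemma d₂_mapBifunctorComparison [R.Additive]
    (hα : ∀ (X : C₁) {Y Y' : C₂} (ψ : Y ⟶ Y'), (F'.obj (R₁.obj X)).map (R₂.map ψ) ≫
      (α X Y').hom = (α X Y).hom ≫ R.map ((F.obj X).map ψ)) (i j n : ℤ) :
    mapBifunctor.d₂ ((R₁.mapHomologicalComplex (ComplexShape.up ℤ)).obj K₁)
      ((R₂.mapHomologicalComplex (ComplexShape.up ℤ)).obj K₂) F' (ComplexShape.up ℤ) i j n ≫
      mapBifunctorComparison α K₁ K₂ n = (α (K₁.X i) (K₂.X j)).hom ≫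
        R.map (mapBifunctor.d₂ K₁ K₂ F (ComplexShape.up ℤ) i j n) := by
  by_cases h : ComplexShape.π (ComplexShape.up ℤ) (ComplexShape.up ℤ) (ComplexShape.up ℤ)
    (i, j + 1) = n
  · rw [mapBifunctor.d₂_eq _ _ _ _ i (show (ComplexShape.up ℤ).Rel j (j + 1) from rfl) n h,
      mapBifunctor.d₂_eq _ _ _ _ i (show (ComplexShape.up ℤ).Rel j (j + 1) from rfl) n h,
      R.map_units_smul, Linear.units_smul_comp, Linear.comp_units_smul, Category.assoc,
      ι_mapBifunctorComparison, R.map_comp]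
    exact congrArg _ (((Category.assoc _ _ _).symm.trans
      (congrArg (· ≫ _) (hα (K₁.X i) (K₂.d j (j + 1))))).trans (Category.assoc _ _ _))
  · rw [mapBifunctor.d₂_eq_zero' _ _ _ _ i (show (ComplexShape.up ℤ).Rel j (j + 1) from rfl) n h,
      mapBifunctor.d₂_eq_zero' _ _ _ _ i (show (ComplexShape.up ℤ).Rel j (j + 1) from rfl) n h,
      zero_comp, R.map_zero, comp_zero]
    rfl

/-- If `F'(R₁ X, R₂ Y) ≅ R F(X, Y)` naturally, and `R` preserves coproducts, then the total complex
of `F'(R₁ K₁, R₂ K₂)` is isomorphic to `R` of the total complex of `F(K₁, K₂)`. -/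
def mapBifunctorComparisonIso [R.Additive] [∀ J : Type, PreservesColimitsOfShape (Discrete J) R]
    (hα₁ : ∀ {X X' : C₁} (φ : X ⟶ X') (Y : C₂), (F'.map (R₁.map φ)).app (R₂.obj Y) ≫
      (α X' Y).hom = (α X Y).hom ≫ R.map ((F.map φ).app Y))
    (hα₂ : ∀ (X : C₁) {Y Y' : C₂} (ψ : Y ⟶ Y'), (F'.obj (R₁.obj X)).map (R₂.map ψ) ≫
      (α X Y').hom = (α X Y).hom ≫ R.map ((F.obj X).map ψ)) :
    mapBifunctor ((R₁.mapHomologicalComplex (ComplexShape.up ℤ)).obj K₁)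
      ((R₂.mapHomologicalComplex (ComplexShape.up ℤ)).obj K₂) F' (ComplexShape.up ℤ) ≅
    (R.mapHomologicalComplex (ComplexShape.up ℤ)).obj
      (mapBifunctor K₁ K₂ F (ComplexShape.up ℤ)) :=
  Hom.isoOfComponents (fun n =>
      @asIso _ _ _ _ (mapBifunctorComparison α K₁ K₂ n) (isIso_mapBifunctorComparison α K₁ K₂ n)) (fun m n _ => by
    refine mapBifunctor.hom_ext fun i j h => ?_
    rw [mapBifunctor.d_eq]
    change _ ≫ mapBifunctorComparison α K₁ K₂ m ≫ R.map _ =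
      _ ≫ _ ≫ mapBifunctorComparison α K₁ K₂ n
    rw [← Category.assoc, ι_mapBifunctorComparison, Preadditive.add_comp, Preadditive.comp_add,
      ← Category.assoc, ← Category.assoc, mapBifunctor.ι_D₁, mapBifunctor.ι_D₂,
      d₁_mapBifunctorComparison α K₁ K₂ hα₁, d₂_mapBifunctorComparison α K₁ K₂ hα₂,
      mapBifunctor.d_eq]
    have key : R.map (ιMapBifunctor K₁ K₂ F (ComplexShape.up ℤ) i j m h) ≫
        R.map (mapBifunctor.D₁ K₁ K₂ F (ComplexShape.up ℤ) m n +
          mapBifunctor.D₂ K₁ K₂ F (ComplexShape.up ℤ) m n) =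
        R.map (mapBifunctor.d₁ K₁ K₂ F (ComplexShape.up ℤ) i j n) +
          R.map (mapBifunctor.d₂ K₁ K₂ F (ComplexShape.up ℤ) i j n) := by
      rw [← R.map_comp, Preadditive.comp_add, mapBifunctor.ι_D₁, mapBifunctor.ι_D₂, R.map_add]
    exact (Category.assoc _ _ _).trans ((congrArg (_ ≫ ·) key).trans
      (Preadditive.comp_add _ _ _ _ _ _)))

end MapBifunctor

/-! ### Rickard complexes -/

section Complexes

variable {O O' : Type u} [CommRing O] [CommRing O'] [Algebra O O']
variable {A A' B B' C C' : Type u} [Ring A] [Algebra O A] [Ring A'] [Algebra O' A']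
  [Ring B] [Algebra O B] [Ring B'] [Algebra O' B'] [Ring C] [Algebra O C] [Ring C'] [Algebra O' C']
variable (f : CoeffHom O O' A A') (g : CoeffHom O O' B B') (h : CoeffHom O O' C C')

/-- Restriction of coefficients for complexes of bimodules. -/
abbrev resComplex : CochainComplex (Bimod O' A' B') ℤ ⥤ CochainComplex (Bimod O A B) ℤ :=
  (resBimod f g).mapHomologicalComplex (ComplexShape.up ℤ)

/-- Restriction of scalars has a right adjoint, namely coextension, so it preserves coproducts. -/
instance (J : Type) : PreservesColimitsOfShape (Discrete J) (resBimod f g) :=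
  (ModuleCat.restrictCoextendScalarsAdj.{u} (f.tensor g)).leftAdjoint_preservesColimits.1

instance (X Y : CochainComplex (Bimod O' A' B') ℤ) :
    PreservesBinaryBiproduct X Y (resComplex f g) :=
  preservesBinaryBiproduct_of_preservesBiproduct _ _ _

/-- Restriction of coefficients commutes with tensor products of complexes. -/
def resTensorComplexIso (hg : Function.Surjective g.toRingHom)
    (hfh : Function.Surjective (f.tensor h)) (X : CochainComplex (Bimod O' A' B') ℤ)
    (Y : CochainComplex (Bimod O' B' C') ℤ) :
    tensorComplex ((resComplex f g).obj X) ((resComplex g h).obj Y) ≅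
      (resComplex f h).obj (tensorComplex X Y) :=
  mapBifunctorComparisonIso (F := tensorFunctor O' A' B' C') (F' := tensorFunctor O A B C)
    (fun X Y => resTensorIso f g h hg hfh X Y) X Y
    (fun φ Y => resTensorHom_naturality f g h φ (𝟙 Y))
    (fun X _ _ ψ => resTensorHom_naturality f g h (𝟙 X) ψ)

variable {τ : O' →ₗ[O] O}

/-- Restriction of coefficients commutes with duals of complexes. -/
def resDualComplexIso (hτ : Function.Bijective fun x : O' => τ ∘ₗ LinearMap.mulLeft O x)
    (X : CochainComplex (Bimod O' A' B') ℤ) :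
    dualComplex ((resComplex f g).obj X) ≅ (resComplex g f).obj (dualComplex X) :=
  HomologicalComplex.Hom.isoOfComponents (fun n => (resDualIso f g hτ (X.X (-n))).symm)
    (fun m n _ => (Iso.inv_comp_eq (resDualIso f g hτ (X.X (-m)))).2
      (((Iso.eq_comp_inv (resDualIso f g hτ (X.X (-n)))).2
        (resDualHom_naturality f g τ (X.d (-n) (-m)))).trans (Category.assoc _ _ _)))

/-- Restriction of coefficients of the regular bimodule, as a complex. -/
def resRegularComplexIso (hf : Function.Bijective f.toRingHom) :
    (resComplex f f).obj (regularComplex O' A') ≅ regularComplex O A :=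
  (HomologicalComplex.singleMapHomologicalComplex (resBimod f f) (ComplexShape.up ℤ) 0).app
    (Bimod.regular O' A') ≪≫
    (HomologicalComplex.single (Bimod O A A) (ComplexShape.up ℤ) 0).mapIso
      (resRegularIso f hf).symm

lemma IsContractible.res {X : CochainComplex (Bimod O' A' B') ℤ} (hX : IsContractible X) :
    IsContractible ((resComplex f g).obj X) := by
  obtain ⟨s⟩ := hX
  exact ⟨(Homotopy.ofEq ((resComplex f g).map_id X).symm).trans
    (((resBimod f g).mapHomotopy s).trans (Homotopy.ofEq ((resComplex f g).map_zero X X)))⟩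

/-- Isomorphisms of complexes induce isomorphisms of tensor products. -/
def tensorComplexIso {X X' : CochainComplex (Bimod O A B) ℤ} {Y Y' : CochainComplex (Bimod O B C) ℤ}
    (e : X ≅ X') (e' : Y ≅ Y') : tensorComplex X Y ≅ tensorComplex X' Y' :=
  ((tensorFunctor O A B C).map₂CochainComplex.mapIso e).app Y ≪≫
    ((tensorFunctor O A B C).map₂CochainComplex.obj X').mapIso e'

/-- Restriction is additive and commutes with tensor products, duals and the regular bimodule, and
it preserves contractibility. Hence it carries the two decompositions over. -/
theorem IsRickard.res (hf : Function.Bijective f.toRingHom) (hg : Function.Bijective g.toRingHom)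
    (hτ : Function.Bijective fun x : O' => τ ∘ₗ LinearMap.mulLeft O x)
    {X : CochainComplex (Bimod O' A' B') ℤ} (hX : IsRickard X) :
    IsRickard ((resComplex f g).obj X) where
  bounded := by
    obtain ⟨m, n, h⟩ := hX.bounded
    exact ⟨m, n, fun i hi => (resBimod f g).map_isZero (h i hi)⟩
  biprojective i := resBimod_isBiprojective f g hf hg (hX.biprojective i)
  left := by
    obtain ⟨Y, hY, ⟨e⟩⟩ := hX.left
    refine ⟨(resComplex f f).obj Y, hY.res f f, ⟨?_⟩⟩
    exact tensorComplexIso (Iso.refl _) (resDualComplexIso f g hτ X) ≪≫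
      resTensorComplexIso f g f hg.2 (f.tensor_surjective f hf.2 hf.2) X (dualComplex X) ≪≫
      (resComplex f f).mapIso e ≪≫ (resComplex f f).mapBiprod _ _ ≪≫
      biprod.mapIso (resRegularComplexIso f hf) (Iso.refl _)
  right := by
    obtain ⟨Y, hY, ⟨e⟩⟩ := hX.right
    refine ⟨(resComplex g g).obj Y, hY.res g g, ⟨?_⟩⟩
    exact tensorComplexIso (resDualComplexIso f g hτ X) (Iso.refl _) ≪≫
      resTensorComplexIso g f g hf.2 (g.tensor_surjective g hg.2 hg.2) (dualComplex X) X ≪≫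
      (resComplex g g).mapIso e ≪≫ (resComplex g g).mapBiprod _ _ ≪≫
      biprod.mapIso (resRegularComplexIso g hg) (Iso.refl _)

end Complexes

/-! ### Grothendieck groups and virtual Morita equivalences -/

section K0

/-- An isomorphism is a split exact sequence with third term zero, and `[0] = [0] + [0]` forces `[0]
= 0`. -/
lemma SplitK0.cls_congr {R : Type u} [Ring R] {M N : FGMod R} (e : M.1 ≅ N.1) :
    SplitK0.cls M = SplitK0.cls N := by
  have h0 : Module.Finite R (ModuleCat.of R PUnit.{u + 1}) :=
    inferInstanceAs (Module.Finite R PUnit.{u + 1})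
  have hz : IsZero (ModuleCat.of R PUnit.{u + 1}) := ModuleCat.isZero_of_subsingleton _
  have h1 := SplitK0.cls_split (ShortComplex.mk e.hom (0 : N.1 ⟶ ModuleCat.of R PUnit.{u + 1})
    comp_zero) M.2 N.2 h0 (ShortComplex.Splitting.ofIsIsoOfIsZero _ e.isIso_hom hz)
  have h2 := SplitK0.cls_split (ShortComplex.mk (𝟙 (ModuleCat.of R PUnit.{u + 1}))
    (0 : _ ⟶ ModuleCat.of R PUnit.{u + 1}) comp_zero) h0 h0 h0
    (ShortComplex.Splitting.ofIsIsoOfIsZero _ (inferInstanceAs (IsIso (𝟙 _))) hz)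
  have h3 := left_eq_add.1 h2
  rw [h3, add_zero] at h1
  exact h1.symm

variable {O O' : Type u} [CommRing O] [CommRing O'] [Algebra O O']
variable {A A' B B' C C' : Type u} [Ring A] [Algebra O A] [Ring A'] [Algebra O' A']
  [Ring B] [Algebra O B] [Ring B'] [Algebra O' B'] [Ring C] [Algebra O C] [Ring C'] [Algebra O' C']
variable (f : CoeffHom O O' A A') (g : CoeffHom O O' B B') (h : CoeffHom O O' C C')

/-- Restriction of coefficients on Grothendieck groups. -/
def resK0 (hf : Function.Surjective f.toRingHom) (hg : Function.Surjective g.toRingHom) :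
    BimodK0 O' A' B' →+ BimodK0 O A B :=
  SplitK0.lift (fun X => SplitK0.cls ⟨(resBimod f g).obj X.1, resBimod_finite f g hf hg X.1 X.2⟩)
    (fun S h₁ h₂ h₃ s => SplitK0.cls_split (S.map (resBimod f g))
      (resBimod_finite f g hf hg S.X₁ h₁) (resBimod_finite f g hf hg S.X₂ h₂)
      (resBimod_finite f g hf hg S.X₃ h₃) (s.map _))

lemma resK0_cls (hf : Function.Surjective f.toRingHom) (hg : Function.Surjective g.toRingHom)
    (X : FGMod (A' ⊗[O'] B'ᵐᵒᵖ)) : resK0 f g hf hg (SplitK0.cls X) =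
      SplitK0.cls ⟨(resBimod f g).obj X.1, resBimod_finite f g hf hg X.1 X.2⟩ :=
  SplitK0.lift_cls _ _ _

lemma resK0_mul [Module.Finite O A] [Module.Finite O B] [Module.Finite O C]
    [Module.Finite O' A'] [Module.Finite O' B'] [Module.Finite O' C']
    (hf : Function.Surjective f.toRingHom) (hg : Function.Surjective g.toRingHom)
    (hh : Function.Surjective h.toRingHom) (x : BimodK0 O' A' B') (y : BimodK0 O' B' C') :
    resK0 f h hf hh (BimodK0.mul x y) =
      BimodK0.mul (resK0 f g hf hg x) (resK0 g h hg hh y) := by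
  suffices ((resK0 f h hf hh).compHom.comp BimodK0.mul : BimodK0 O' A' B' →+ _) =
      (BimodK0.mul.compl₂ (resK0 g h hg hh)).comp (resK0 f g hf hg) from
    DFunLike.congr_fun (DFunLike.congr_fun this x) y
  refine SplitK0.hom_ext fun X => SplitK0.hom_ext fun Y => ?_
  refine SplitK0.cls_congr ?_
  exact (resTensorIso f g h hg (f.tensor_surjective h hf hh) X.1 Y.1).symm

lemma resK0_dual [IsNoetherianRing O] [IsNoetherianRing O'] [Module.Finite O A] [Module.Finite O B]
    [Module.Finite O' A'] [Module.Finite O' B'] {τ : O' →ₗ[O] O}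
    (hf : Function.Surjective f.toRingHom) (hg : Function.Surjective g.toRingHom)
    (hτ : Function.Bijective fun x : O' => τ ∘ₗ LinearMap.mulLeft O x) (x : BimodK0 O' A' B') :
    resK0 g f hg hf (BimodK0.dual x) = BimodK0.dual (resK0 f g hf hg x) := by
  suffices ((resK0 g f hg hf).comp BimodK0.dual : BimodK0 O' A' B' →+ _) =
      BimodK0.dual.comp (resK0 f g hf hg) from DFunLike.congr_fun this x
  refine SplitK0.hom_ext fun X => ?_
  refine SplitK0.cls_congr ?_
  exact resDualIso f g hτ X.1

lemma resK0_regularCls (hf : Function.Bijective f.toRingHom) :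
    resK0 f f hf.2 hf.2 (regularCls O' A') = regularCls O A :=
  (resK0_cls f f hf.2 hf.2 _).trans (SplitK0.cls_congr (resRegularIso f hf).symm)

lemma resK0_isBiprojective_cls (hf : Function.Bijective f.toRingHom)
    (hg : Function.Bijective g.toRingHom) {X : Bimod O' A' B'} (hX : X.IsBiprojective) :
    resK0 f g hf.2 hg.2 hX.cls = (resBimod_isBiprojective f g hf hg hX).cls :=
  resK0_cls f g hf.2 hg.2 _

lemma resK0_mem_projK0 (hf : Function.Bijective f.toRingHom) (hg : Function.Bijective g.toRingHom)
    {x : BimodK0 O' A' B'} (hx : x ∈ projK0 O' A' B') :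
    resK0 f g hf.2 hg.2 x ∈ projK0 O A B := by
  refine (AddSubgroup.closure_le (K := (projK0 O A B).comap (resK0 f g hf.2 hg.2))).2 ?_ hx
  rintro _ ⟨X, hX, rfl⟩
  exact AddSubgroup.subset_closure
    ⟨_, resBimod_isBiprojective f g hf hg hX, resK0_isBiprojective_cls f g hf hg hX⟩

theorem IsVirtualMorita.res [Module.Finite O A] [Module.Finite O B] [Module.Finite O' A']
    [Module.Finite O' B'] (hf : Function.Bijective f.toRingHom)
    (hg : Function.Bijective g.toRingHom) {M : BimodK0 O' A' B'} {N : BimodK0 O' B' A'}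
    (hMN : IsVirtualMorita M N) :
    IsVirtualMorita (resK0 f g hf.2 hg.2 M) (resK0 g f hg.2 hf.2 N) where
  left_mem := resK0_mem_projK0 f g hf hg hMN.left_mem
  right_mem := resK0_mem_projK0 g f hg hf hMN.right_mem
  mul_eq := by rw [← resK0_mul f g f, hMN.mul_eq, resK0_regularCls f hf]
  mul_eq' := by rw [← resK0_mul g f g, hMN.mul_eq', resK0_regularCls g hg]

end K0

/-! ### Separability of the coefficient extension -/

section Separability

/-- A separability idempotent `∑ xᵢ ⊗ yᵢ` of an `O`-algebra `O'`. -/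
structure SeparabilityIdempotent (O O' : Type u) [CommRing O] [CommRing O'] [Algebra O O'] where
  n : ℕ
  x : Fin n → O'
  y : Fin n → O'
  sum_mul : ∑ i, x i * y i = 1
  balanced : ∀ {P : Type u} [AddCommGroup P] (B : O' →+ O' →+ P),
    (∀ (r : O) (a b : O'), B (r • a) b = B a (r • b)) → ∀ r : O',
      ∑ i, B (x i) (y i * r) = ∑ i, B (r * x i) (y i)

/-- Since the maximal ideal of `O` generates that of `O'` and the residue extension is separable,
`O'` is unramified over `O`. The canonical element `e` of `O' ⊗ O'` satisfies `(1 ⊗ r) e = (r ⊗ 1)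
e`; pairing this with a balanced biadditive map gives the field `balanced`. -/
theorem exists_separabilityIdempotent {O O' : Type u} [CommRing O] [IsLocalRing O] [CommRing O']
    [IsLocalRing O'] [Algebra O O'] [IsLocalHom (algebraMap O O')] [Module.Finite O O']
    [Finite (IsLocalRing.ResidueField O)]
    (hm : (IsLocalRing.maximalIdeal O).map (algebraMap O O') = IsLocalRing.maximalIdeal O') :
    Nonempty (SeparabilityIdempotent O O') := by
  have : Algebra.FormallyUnramified O O' := Algebra.FormallyUnramified.of_map_maximalIdeal hm
  obtain ⟨n, x, y, h⟩ : ∃ (n : ℕ) (x y : Fin n → O'),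
      Algebra.FormallyUnramified.elem O O' = ∑ i, x i ⊗ₜ y i := by
    obtain ⟨s, hs⟩ := TensorProduct.exists_finset (Algebra.FormallyUnramified.elem O O')
    refine ⟨s.card, fun i => (s.equivFin.symm i).1.1, fun i => (s.equivFin.symm i).1.2, ?_⟩
    rw [hs, ← Finset.sum_coe_sort, ← s.equivFin.symm.sum_comp]
  refine ⟨⟨n, x, y, ?_, fun B hB r => ?_⟩⟩
  · have := Algebra.FormallyUnramified.lmul_elem (R := O) (S := O')
    rw [h, map_sum] at this
    simpa using this
  · have := congrArg (TensorProduct.liftAddHom B hB)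
      (Algebra.FormallyUnramified.one_tmul_mul_elem (R := O) r)
    rw [h, Finset.mul_sum, Finset.mul_sum, map_sum, map_sum] at this
    simpa [mul_comm] using this

end Separability

/-! ### Indecomposable objects and local endomorphism rings -/

section Indecomposable

variable {C : Type*} [Category* C] [Preadditive C] [HasBinaryBiproducts C]

/-- Splitting both `p` and `1 - p` writes `X` as a biproduct, one of whose terms must vanish. -/
theorem Indecomposable.eq_zero_or_eq_id [IsIdempotentComplete C] {X : C} (hX : Indecomposable X)
    (p : X ⟶ X) (hp : p ≫ p = p) : p = 0 ∨ p = 𝟙 X := by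
  obtain ⟨Y, i, e, hie, hei⟩ := IsIdempotentComplete.idempotents_split X p hp
  have hq : (𝟙 X - p) ≫ (𝟙 X - p) = 𝟙 X - p := by
    simp [Preadditive.sub_comp, Preadditive.comp_sub, hp]
  obtain ⟨Z, j, f, hjf, hfj⟩ := IsIdempotentComplete.idempotents_split X _ hq
  have hi : i ≫ p = i := by rw [← hei, reassoc_of% hie]
  have he : p ≫ e = e := by rw [← hei, Category.assoc, hie, Category.comp_id]
  have hj : j ≫ (𝟙 X - p) = j := by rw [← hfj, reassoc_of% hjf]
  have hf : (𝟙 X - p) ≫ f = f := by rw [← hfj, Category.assoc, hjf, Category.comp_id]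
  have hif : i ≫ f = 0 := by
    rw [← hi, ← hf, Category.assoc, Preadditive.sub_comp, Preadditive.comp_sub, Category.id_comp,
      reassoc_of% hp, sub_self, comp_zero]
  have hje : j ≫ e = 0 := by
    rw [← hj, ← he, Category.assoc, Preadditive.sub_comp, Category.id_comp, reassoc_of% hp,
      sub_self, comp_zero]
  let iso : X ≅ Y ⊞ Z :=
    { hom := biprod.lift e f
      inv := biprod.desc i j
      hom_inv_id := by simp [hei, hfj]
      inv_hom_id := by
        ext <;> simp [hie, hif, hje, hjf] }
  rcases hX.2 Y Z iso with h | h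
  · left
    rw [← hei, h.eq_of_tgt e 0, zero_comp]
  · right
    rw [← sub_eq_zero.1 (hfj.symm.trans (by rw [h.eq_of_tgt f 0, zero_comp]))]

theorem indecomposable_of_idempotents {X : C} (h0 : ¬ IsZero X)
    (h : ∀ p : X ⟶ X, p ≫ p = p → p = 0 ∨ p = 𝟙 X) : Indecomposable X := by
  refine ⟨h0, fun Y Z e => ?_⟩
  rcases h (e.hom ≫ biprod.fst ≫ biprod.inl ≫ e.inv) (by simp) with h | h
  · left
    rw [IsZero.iff_id_eq_zero]
    have := congrArg (fun p => biprod.inl ≫ e.inv ≫ p ≫ e.hom ≫ biprod.fst) h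
    simpa using this
  · right
    rw [IsZero.iff_id_eq_zero]
    have := congrArg (fun p => biprod.inr ≫ e.inv ≫ p ≫ e.hom ≫ biprod.snd) h
    simpa using this.symm

/-- In a ring in which `x` or `1 - x` is a unit for every `x`, a sum that is a unit has a summand
that is a unit. -/
theorem exists_isUnit_of_isUnit_sum {R ι : Type*} [Ring R] [Nontrivial R]
    (hR : ∀ x : R, IsUnit x ∨ IsUnit (1 - x)) (s : Finset ι) (f : ι → R)
    (h : IsUnit (∑ i ∈ s, f i)) : ∃ i ∈ s, IsUnit (f i) := by
  classical
  induction s using Finset.induction_on with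
  | empty => simp at h
  | insert a s ha ih =>
    rw [Finset.sum_insert ha] at h
    obtain ⟨v, hv⟩ := h
    -- Dividing by the total sum `v` reduces to the case of sum `1`, where the first term or the sum
    -- of the others is a unit.
    have h1 : 1 - v⁻¹.1 * f a = v⁻¹.1 * ∑ i ∈ s, f i := by
      rw [sub_eq_iff_eq_add, ← mul_add, add_comm, ← hv, Units.inv_mul]
    rcases hR (v⁻¹.1 * f a) with h | h
    · exact ⟨a, Finset.mem_insert_self a s, (Units.isUnit_units_mul _ _).1 h⟩
    · rw [h1, Units.isUnit_units_mul] at h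
      obtain ⟨i, hi, h⟩ := ih h
      exact ⟨i, Finset.mem_insert_of_mem hi, h⟩

end Indecomposable

/-! ### Relative projectivity -/

section RelProjective

variable {O Γ : Type u} [CommRing O] [Group Γ]

/-- The unit `U → Coind_Q Res_Q U`. -/
def coindUnit (Q : Subgroup Γ) (U : Rep.{u} O Γ) :
    U ⟶ Rep.coind Q.subtype (Rep.res Q.subtype U) :=
  Rep.resCoindHomEquiv.{u} Q.subtype U (Rep.res Q.subtype U) (𝟙 _)

/-- For a finite group induction and coinduction agree. A map from `U` to a coinduced module factors
through the unit by adjunction, so if `U` is a summand of some induced module then the unit itself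
splits. -/
theorem isRelProjective_iff [Finite Γ] (Q : Subgroup Γ) (U : Rep.{u} O Γ) : IsRelProjective Q U ↔
    ∃ s : Rep.coind Q.subtype (Rep.res Q.subtype U) ⟶ U, coindUnit Q U ≫ s = 𝟙 U := by
  classical
  constructor
  · rintro ⟨V, ⟨r⟩⟩
    let e := Rep.indCoindIso.{u} V
    refine ⟨(Rep.coindFunctor.{u} O Q.subtype).map
      ((Rep.resCoindHomEquiv.{u} Q.subtype U V).symm (r.i ≫ e.hom)) ≫ e.inv ≫ r.r, ?_⟩
    have : coindUnit Q U ≫ (Rep.coindFunctor.{u} O Q.subtype).map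
        ((Rep.resCoindHomEquiv.{u} Q.subtype U V).symm (r.i ≫ e.hom)) = r.i ≫ e.hom :=
      (Rep.resCoindHomEquiv.{u} Q.subtype U V).apply_symm_apply _
    rw [← Category.assoc, this]
    simp
  · rintro ⟨s, hs⟩
    exact ⟨Rep.res Q.subtype U, ⟨(⟨coindUnit Q U, s, hs⟩ : Retract _ _).trans
      (Retract.ofIso (Rep.indCoindIso.{u} _).symm)⟩⟩

end RelProjective

/-! ### Restriction of coefficients for representations: vertices and sources -/

section RepRestriction

variable {O O' Γ : Type u} [CommRing O] [CommRing O'] [Group Γ]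

/-- A homomorphism of representations, from an additive map. -/
def repHom {V W : Rep.{u} O Γ} (f : V →+ W) (h : ∀ (r : O) (x : V), f (r • x) = r • f x)
    (hf : ∀ (g : Γ) (x : V), f (V.ρ g x) = W.ρ g (f x)) : V ⟶ W :=
  Rep.ofHom (ρ := V.ρ) (σ := W.ρ) ⟨{ f with map_smul' := h }, fun g => LinearMap.ext (hf g)⟩

lemma repHom_ext {V W : Rep.{u} O Γ} {f g : V ⟶ W} (h : ∀ x, f.hom x = g.hom x) : f = g :=
  Rep.hom_ext (Representation.IntertwiningMap.ext (LinearMap.ext h))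

/-- The map between coinduced modules induced by an equivariant additive map, between modules that
may have different rings of coefficients. -/
def coindChange (Q : Subgroup Γ) {V' : Rep.{u} O' Q} {V : Rep.{u} O Q} (θ : V' →+ V)
    (hθ : ∀ (g : Q) (x : V'), θ (V'.ρ g x) = V.ρ g (θ x)) :
    Rep.coind Q.subtype V' →+ Rep.coind Q.subtype V where
  toFun F := ⟨fun h => θ (F.1 h), fun g h => (congrArg θ (F.2 g h)).trans (hθ _ _)⟩
  map_zero' := Subtype.ext (funext fun _ => map_zero θ)
  map_add' _ _ := Subtype.ext (funext fun _ => map_add θ _ _)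

lemma coindChange_rho (Q : Subgroup Γ) {V' : Rep.{u} O' Q} {V : Rep.{u} O Q} (θ : V' →+ V)
    (hθ : ∀ (g : Q) (x : V'), θ (V'.ρ g x) = V.ρ g (θ x)) (g : Γ)
    (F : Rep.coind Q.subtype V') : coindChange Q θ hθ ((Rep.coind Q.subtype V').ρ g F) =
      (Rep.coind Q.subtype V).ρ g (coindChange Q θ hθ F) := rfl

variable [Algebra O O']

/-- An identification of the representation `U` over `O` with the restriction of coefficients of
the representation `U'` over `O'`. -/
structure RepRestriction (U' : Rep.{u} O' Γ) (U : Rep.{u} O Γ) where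
  equiv : U' ≃+ U
  equiv_smul : ∀ (r : O) (x : U'), equiv (algebraMap O O' r • x) = r • equiv x
  equiv_rho : ∀ (g : Γ) (x : U'), equiv (U'.ρ g x) = U.ρ g (equiv x)

variable {U' : Rep.{u} O' Γ} {U : Rep.{u} O Γ}

/-- An `O`-linear retraction `s` of the coinduction unit is made `O'`-linear by averaging: `F ↦ ∑ xᵢ
s (yᵢ F)`. It remains a retraction because `∑ xᵢ yᵢ = 1`, and it remains equivariant because scalars
commute with the group. -/
theorem IsRelProjective.of_restriction [Finite Γ] (σ : SeparabilityIdempotent O O')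
    (e : RepRestriction U' U) (Q : Subgroup Γ) (h : IsRelProjective Q U) :
    IsRelProjective Q U' := by
  rw [isRelProjective_iff] at h ⊢
  obtain ⟨s, hs⟩ := h
  let θ (y : O') : Rep.res Q.subtype U' →+ Rep.res Q.subtype U :=
    e.equiv.toAddMonoidHom.comp (DistribSMul.toAddMonoidHom U' y)
  have hθ (y : O') : ∀ (g : Q) (x : Rep.res Q.subtype U'),
      θ y ((Rep.res Q.subtype U').ρ g x) = (Rep.res Q.subtype U).ρ g (θ y x) := fun g x => by
    change e.equiv (y • U'.ρ g x) = U.ρ g (e.equiv (y • x))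
    rw [← map_smul, e.equiv_rho]
  let B (F : Rep.coind Q.subtype (Rep.res Q.subtype U')) : O' →+ O' →+ U' :=
    AddMonoidHom.mk' (fun x => AddMonoidHom.mk' (fun y =>
        x • e.equiv.symm (s.hom (coindChange Q (θ y) (hθ y) F)))
      (fun y y' => by
        rw [← smul_add, ← map_add, ← map_add]
        congr 3
        exact Subtype.ext (funext fun h => (congrArg e.equiv (add_smul y y' (F.1 h))).trans
          (map_add _ _ _))))
      (fun x x' => AddMonoidHom.ext fun y => add_smul _ _ _)
  have hBd (F) (x y : O') : B F x y =
      x • e.equiv.symm (s.hom (coindChange Q (θ y) (hθ y) F)) := rfl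
  have hB (F) (r : O) (a b : O') : B F (r • a) b = B F a (r • b) := by
    change (r • a) • e.equiv.symm (s.hom (coindChange Q (θ b) (hθ b) F)) =
      a • e.equiv.symm (s.hom (coindChange Q (θ (r • b)) (hθ (r • b)) F))
    have : coindChange Q (θ (r • b)) (hθ (r • b)) F = r • coindChange Q (θ b) (hθ b) F :=
      Subtype.ext (funext fun h => by
        change e.equiv ((r • b) • F.1 h) = r • e.equiv (b • F.1 h)
        rw [← e.equiv_smul, Algebra.smul_def, mul_smul])
    rw [this, map_smul, Algebra.smul_def, mul_comm, mul_smul]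
    congr 1
    rw [AddEquiv.eq_symm_apply, e.equiv_smul, AddEquiv.apply_symm_apply]
  let S : Rep.coind Q.subtype (Rep.res Q.subtype U') →+ U' :=
    AddMonoidHom.mk' (fun F => ∑ i, B F (σ.x i) (σ.y i)) (fun F F' => by
      rw [← Finset.sum_add_distrib]
      refine Finset.sum_congr rfl fun i _ => ?_
      rw [hBd, hBd, hBd, map_add, map_add, map_add, smul_add])
  refine ⟨repHom S (fun r F => ?_) (fun g F => ?_), repHom_ext fun x => ?_⟩
  · change ∑ i, B (r • F) (σ.x i) (σ.y i) = r • ∑ i, B F (σ.x i) (σ.y i)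
    rw [Finset.smul_sum]
    -- Linearity over `O'` is the separability identity: a scalar on the `yᵢ` may be moved to the
    -- `xᵢ`.
    refine Eq.trans ?_ ((σ.balanced (B F) (hB F) r).trans ?_)
    · refine Finset.sum_congr rfl fun i _ => ?_
      rw [hBd, hBd]
      congr 3
      exact Subtype.ext (funext fun h => congrArg e.equiv (mul_smul _ _ (F.1 h)).symm)
    · exact Finset.sum_congr rfl fun i _ => mul_smul _ _ _
  · change ∑ i, B ((Rep.coind Q.subtype (Rep.res Q.subtype U')).ρ g F) (σ.x i) (σ.y i) =
      U'.ρ g (∑ i, B F (σ.x i) (σ.y i))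
    rw [map_sum]
    refine Finset.sum_congr rfl fun i _ => ?_
    rw [hBd, hBd, map_smul]
    congr 1
    rw [AddEquiv.symm_apply_eq, e.equiv_rho, AddEquiv.apply_symm_apply, coindChange_rho]
    exact Rep.hom_comm_apply s g _
  · change ∑ i, B ((coindUnit Q U').hom x) (σ.x i) (σ.y i) = x
    have : ∀ i, B ((coindUnit Q U').hom x) (σ.x i) (σ.y i) = (σ.x i * σ.y i) • x := fun i => by
      change σ.x i • e.equiv.symm (s.hom (coindChange Q _ _ ((coindUnit Q U').hom x))) = _
      have h1 : coindChange Q (θ (σ.y i)) (hθ (σ.y i)) ((coindUnit Q U').hom x) =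
          (coindUnit Q U).hom (e.equiv (σ.y i • x)) := Subtype.ext (funext fun h => by
        change e.equiv (σ.y i • U'.ρ h x) = U.ρ h (e.equiv (σ.y i • x))
        rw [← map_smul, e.equiv_rho])
      have h2 : s.hom ((coindUnit Q U).hom (e.equiv (σ.y i • x))) = e.equiv (σ.y i • x) :=
        congrArg (fun φ : U ⟶ U => φ.hom (e.equiv (σ.y i • x))) hs
      rw [h1, h2, AddEquiv.symm_apply_apply, mul_smul]
    rw [Finset.sum_congr rfl fun i _ => this i, ← Finset.sum_smul, σ.sum_mul, one_smul]

/-- By `he`, endomorphisms of the restriction are linear over `O'`. An idempotent of `U` is then one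
of `U'`, hence trivial. -/
theorem RepRestriction.indecomposable [Finite Γ] (e : RepRestriction U' U)
    (he : ∀ (φ : U ⟶ U) (r : O') (x : U'),
      e.equiv.symm (φ.hom (e.equiv (r • x))) = r • e.equiv.symm (φ.hom (e.equiv x)))
    (h : Indecomposable U') : Indecomposable U := by
  refine indecomposable_of_idempotents (fun h0 => h.1 ?_) (fun p hp => ?_)
  · have h1 : ∀ x : U, x = 0 := fun x =>
      congrArg (fun φ : U ⟶ U => φ.hom x) ((IsZero.iff_id_eq_zero _).1 h0)
    exact (IsZero.iff_id_eq_zero _).2 (repHom_ext fun x => e.equiv.injective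
      ((h1 (e.equiv x)).trans (map_zero e.equiv).symm))
  · have hp' : ∀ x, p.hom (p.hom x) = p.hom x := fun x =>
      congrArg (fun φ : U ⟶ U => φ.hom x) hp
    let q : U' ⟶ U' := repHom
      ((e.equiv.symm.toAddMonoidHom.comp p.hom.toLinearMap.toAddMonoidHom).comp
        e.equiv.toAddMonoidHom) (he p) (fun g x => by
        change e.equiv.symm (p.hom (e.equiv (U'.ρ g x))) =
          U'.ρ g (e.equiv.symm (p.hom (e.equiv x)))
        rw [AddEquiv.symm_apply_eq, e.equiv_rho, e.equiv_rho, AddEquiv.apply_symm_apply]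
        exact Rep.hom_comm_apply p g _)
    have hq : ∀ x, q.hom x = e.equiv.symm (p.hom (e.equiv x)) := fun _ => rfl
    rcases Indecomposable.eq_zero_or_eq_id h q (repHom_ext fun x => by
      change q.hom (q.hom x) = q.hom x
      rw [hq, hq, AddEquiv.apply_symm_apply, hp']) with h1 | h1
    · left
      refine repHom_ext fun x => ?_
      obtain ⟨x, rfl⟩ := e.equiv.surjective x
      have h2 : q.hom x = 0 := by rw [h1]; rfl
      rw [hq, AddEquiv.symm_apply_eq, map_zero] at h2
      exact h2
    · right
      refine repHom_ext fun x => ?_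
      obtain ⟨x, rfl⟩ := e.equiv.surjective x
      have h2 : q.hom x = x := by rw [h1]; rfl
      rw [hq, AddEquiv.symm_apply_eq] at h2
      exact h2

/-- If `End(U)` is local, then `U` is a direct summand of a module through finitely many copies of
which the identity of `U` factors. -/
theorem retract_of_sum_comp_eq_id {C ι : Type*} [Category* C] [Preadditive C] {X Y : C}
    (h0 : ¬ IsZero X) (hX : ∀ f : End X, IsUnit f ∨ IsUnit (1 - f)) (i : ι → (X ⟶ Y))
    (r : ι → (Y ⟶ X)) [Fintype ι] (h : ∑ j, i j ≫ r j = 𝟙 X) : Nonempty (Retract X Y) := by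
  have : Nontrivial (End X) := ⟨⟨0, 1, fun h => h0 ((IsZero.iff_id_eq_zero _).2 h.symm)⟩⟩
  let f : ι → End X := fun j => i j ≫ r j
  have hf : ∑ j, f j = 1 := h
  -- In the local ring `End X` one of the terms summing to the identity is invertible; correcting `r
  -- j` by its inverse gives the retraction.
  obtain ⟨j, -, hj⟩ := exists_isUnit_of_isUnit_sum hX Finset.univ f (by rw [hf]; exact isUnit_one)
  have hj : IsIso (i j ≫ r j) := (isUnit_iff_isIso _).1 hj
  exact ⟨⟨i j, r j ≫ inv (i j ≫ r j), by rw [← Category.assoc, IsIso.hom_inv_id]⟩⟩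

/-- This finiteness is what allows `isUnit_or_isUnit_one_sub` to be applied to the endomorphism
ring. -/
instance [IsNoetherianRing O] [Module.Finite O U] : Module.Finite O (End U) := by
  have : Module.Finite O (U →ₗ[O] U) := by
    obtain ⟨n, f, hf⟩ := Module.Finite.exists_fin' O U
    exact Module.Finite.of_injective (N := (Fin n → O) →ₗ[O] U) (LinearMap.lcomp O U f)
      (fun φ ψ h => (LinearMap.cancel_right hf).1 h)
  exact Module.Finite.of_injective (N := U →ₗ[O] U)
    ({ toFun := fun φ => Rep.Hom.hom φ |>.toLinearMap
       map_add' := fun _ _ => rfl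
       map_smul' := fun _ _ => rfl } : End U →ₗ[O] (U →ₗ[O] U))
    (fun φ ψ h => Rep.hom_ext (Representation.IntertwiningMap.ext h))

/-- Over `O` the module coinduced from `O'` is a finite sum of copies of that coinduced from `O`. So
the identity of `U` is a sum of maps factoring through one copy each, and `End U` is local. -/
theorem RepRestriction.retract_ind_trivial [Finite Γ] [IsNoetherianRing O] [IsLocalRing O]
    [IsAdicComplete (IsLocalRing.maximalIdeal O) O] [Finite (IsLocalRing.ResidueField O)]
    [Module.Finite O O'] [Module.Free O O'] [Module.Finite O U] (e : RepRestriction U' U)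
    (hU : Indecomposable U) (P : Subgroup Γ)
    (h : Nonempty (Retract U' (Rep.ind P.subtype (Rep.trivial O' P O')))) :
    Nonempty (Retract U (Rep.ind P.subtype (Rep.trivial O P O))) := by
  classical
  obtain ⟨t⟩ := h
  let t := t.trans (Retract.ofIso (Rep.indCoindIso.{u} (Rep.trivial O' P O')))
  let β := Module.Free.chooseBasis O O'
  -- The coordinates `γ j` and the inclusions `δ j` of an `O`-basis of `O'`; they satisfy `∑ δ j ∘ γ
  -- j = id`.
  let γ (j) : Rep.trivial O' P O' →+ Rep.trivial O P O := (β.coord j).toAddMonoidHom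
  let δ (j) : Rep.trivial O P O →+ Rep.trivial O' P O' :=
    (LinearMap.toSpanSingleton O O' (β j)).toAddMonoidHom
  have hγ (j) : ∀ (g : P) (x : Rep.trivial O' P O'),
      γ j ((Rep.trivial O' P O').ρ g x) = (Rep.trivial O P O).ρ g (γ j x) := fun _ _ => rfl
  have hδ (j) : ∀ (g : P) (x : Rep.trivial O P O),
      δ j ((Rep.trivial O P O).ρ g x) = (Rep.trivial O' P O').ρ g (δ j x) := fun _ _ => rfl
  let i (j) : U ⟶ Rep.coind P.subtype (Rep.trivial O P O) := repHom
    (((coindChange P (γ j) (hγ j)).comp t.i.hom.toLinearMap.toAddMonoidHom).comp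
      e.equiv.symm.toAddMonoidHom)
    (fun r x => by
      obtain ⟨x, rfl⟩ := e.equiv.surjective x
      change coindChange P (γ j) (hγ j) (t.i.hom (e.equiv.symm (r • e.equiv x))) =
        r • coindChange P (γ j) (hγ j) (t.i.hom (e.equiv.symm (e.equiv x)))
      rw [← e.equiv_smul, AddEquiv.symm_apply_apply, AddEquiv.symm_apply_apply, map_smul]
      refine Subtype.ext (funext fun h => ?_)
      change β.coord j (algebraMap O O' r • ((t.i.hom x).1 h : O')) =
        r • β.coord j ((t.i.hom x).1 h)
      rw [algebraMap_smul, map_smul])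
    (fun g x => by
      obtain ⟨x, rfl⟩ := e.equiv.surjective x
      change coindChange P (γ j) (hγ j) (t.i.hom (e.equiv.symm (U.ρ g (e.equiv x)))) =
        (Rep.coind P.subtype (Rep.trivial O P O)).ρ g
          (coindChange P (γ j) (hγ j) (t.i.hom (e.equiv.symm (e.equiv x))))
      rw [← e.equiv_rho, AddEquiv.symm_apply_apply, AddEquiv.symm_apply_apply, ← coindChange_rho]
      exact congrArg _ (Rep.hom_comm_apply t.i g x))
  let r (j) : Rep.coind P.subtype (Rep.trivial O P O) ⟶ U := repHom
    (e.equiv.toAddMonoidHom.comp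
      (t.r.hom.toLinearMap.toAddMonoidHom.comp (coindChange P (δ j) (hδ j))))
    (fun r F => by
      change e.equiv (t.r.hom (coindChange P (δ j) (hδ j) (r • F))) =
        r • e.equiv (t.r.hom (coindChange P (δ j) (hδ j) F))
      have : coindChange P (δ j) (hδ j) (r • F) =
          algebraMap O O' r • coindChange P (δ j) (hδ j) F := by
        refine Subtype.ext (funext fun h => ?_)
        change (r * (F.1 h : O)) • β j = algebraMap O O' r • (F.1 h : O) • β j
        rw [mul_smul, algebraMap_smul]
      rw [this, map_smul, e.equiv_smul])
    (fun g F => by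
      change e.equiv (t.r.hom (coindChange P (δ j) (hδ j)
          ((Rep.coind P.subtype (Rep.trivial O P O)).ρ g F))) =
        U.ρ g (e.equiv (t.r.hom (coindChange P (δ j) (hδ j) F)))
      rw [coindChange_rho, ← e.equiv_rho]
      exact congrArg e.equiv (Rep.hom_comm_apply t.r g _))
  have hU' : Nonempty (Retract U (Rep.coind P.subtype (Rep.trivial O P O))) := by
    refine retract_of_sum_comp_eq_id hU.1 (isUnit_or_isUnit_one_sub (O := O) fun p hp =>
      Indecomposable.eq_zero_or_eq_id hU p hp) i r (repHom_ext fun x => ?_)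
    obtain ⟨x, rfl⟩ := e.equiv.surjective x
    have hF : ∀ F : Rep.coind P.subtype (Rep.trivial O' P O'),
        ∑ j, coindChange P (δ j) (hδ j) (coindChange P (γ j) (hγ j) F) = F :=
      fun F => by
        refine Subtype.ext (funext fun h => ?_)
        rw [AddSubmonoidClass.coe_finsetSum, Finset.sum_apply]
        exact β.sum_repr (F.1 h)
    have ht : t.r.hom (t.i.hom x) = x := congrArg (fun φ : U' ⟶ U' => φ.hom x) t.retract
    rw [Rep.sum_hom, Representation.IntertwiningMap.sum_apply]
    change ∑ j, e.equiv (t.r.hom (coindChange P (δ j) (hδ j)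
      (coindChange P (γ j) (hγ j) (t.i.hom (e.equiv.symm (e.equiv x)))))) = e.equiv x
    rw [← map_sum, ← map_sum, hF, AddEquiv.symm_apply_apply, ht]
  obtain ⟨t'⟩ := hU'
  exact ⟨t'.trans (Retract.ofIso (Rep.indCoindIso.{u} (Rep.trivial O P O)).symm)⟩

theorem RepRestriction.finite [Module.Finite O O'] (e : RepRestriction U' U)
    (h : Module.Finite O' U') : Module.Finite O U := by
  let _ : Module O U' := Module.compHom U' (algebraMap O O')
  have : IsScalarTower O O' U' := IsScalarTower.of_algebraMap_smul fun _ _ => rfl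
  have := Module.Finite.trans (R := O) O' U'
  let e' : U' ≃ₗ[O] U := { e.equiv with map_smul' := e.equiv_smul }
  exact Module.Finite.equiv e'

theorem RepRestriction.isPPermutation [Module.Finite O O'] [Module.Free O O'] {p : ℕ}
    (e : RepRestriction U' U) (h : IsPPermutation p U') : IsPPermutation p U where
  finite := e.finite h.finite
  exists_basis P hP := by
    obtain ⟨ι, β, hβ⟩ := h.exists_basis P hP
    let _ : Module O U' := Module.compHom U' (algebraMap O O')
    have : IsScalarTower O O' U' := IsScalarTower.of_algebraMap_smul fun _ _ => rfl
    let e' : U' ≃ₗ[O] U := { e.equiv with map_smul' := e.equiv_smul }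
    -- Products of an `O`-basis of `O'` with a `P`-stable `O'`-basis of `U'`; the group permutes the
    -- second factor only.
    refine ⟨_, ((Module.Free.chooseBasis O O').smulTower β).map e', fun g hg i => ?_⟩
    obtain ⟨j, hj⟩ := hβ g hg i.2
    refine ⟨(i.1, j), ?_⟩
    rw [Module.Basis.map_apply, Module.Basis.map_apply, Module.Basis.smulTower_apply,
      Module.Basis.smulTower_apply]
    change U.ρ g (e.equiv _) = e.equiv _
    rw [← e.equiv_rho, map_smul, hj]

/-- A vertex `P` of `U'` is also one of `U`. Being a summand of the module induced from the trivial
`OP`-module gives relative projectivity, and `IsRelProjective.of_restriction` transfers minimality.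
-/
theorem RepRestriction.hasTrivialSource [Finite Γ] [IsNoetherianRing O] [IsLocalRing O]
    [IsAdicComplete (IsLocalRing.maximalIdeal O) O] [Finite (IsLocalRing.ResidueField O)]
    [Module.Finite O O'] [Module.Free O O'] {p : ℕ} (σ : SeparabilityIdempotent O O')
    (e : RepRestriction U' U)
    (he : ∀ (φ : U ⟶ U) (r : O') (x : U'),
      e.equiv.symm (φ.hom (e.equiv (r • x))) = r • e.equiv.symm (φ.hom (e.equiv x)))
    (h : HasTrivialSource p U') : HasTrivialSource p U where
  finite := e.finite h.finite
  indecomposable := e.indecomposable he h.indecomposable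
  source := by
    obtain ⟨P, hP, hs⟩ := h.source
    have := e.finite h.finite
    have hs' := e.retract_ind_trivial (e.indecomposable he h.indecomposable) P hs
    exact ⟨P, ⟨hP.isPGroup, ⟨_, hs'⟩,
      fun Q hQ hU => hP.minimal Q hQ (hU.of_restriction σ e Q)⟩, hs'⟩

end RepRestriction

/-! ### Splitting the multiplication map from the extension of scalars -/

section BaseChange

variable {O O' Γ : Type u} [CommRing O] [CommRing O'] [Algebra O O'] [Group Γ]
variable {U' V' : Rep.{u} O' Γ} {U V : Rep.{u} O Γ}

/-- The homomorphism `U' → O' ⊗_O U`, `u ↦ ∑ xᵢ ⊗ yᵢ u`. -/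
def RepRestriction.toBaseChange (σ : SeparabilityIdempotent O O') (e : RepRestriction U' U) :
    U' ⟶ (baseChange Γ O O').obj U :=
  repHom (W := (baseChange Γ O O').obj U)
    (AddMonoidHom.mk' (fun u => ∑ i, σ.x i ⊗ₜ[O] e.equiv (σ.y i • u)) (fun u v => by
      refine Eq.trans ?_ Finset.sum_add_distrib
      refine Finset.sum_congr rfl fun i _ => ?_
      rw [smul_add, map_add, TensorProduct.tmul_add]
      rfl))
    (fun r u => by
      let B : O' →+ O' →+ O' ⊗[O] U := AddMonoidHom.mk' (fun x => AddMonoidHom.mk'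
          (fun y => x ⊗ₜ[O] e.equiv (y • u))
          (fun y y' => by rw [add_smul, map_add, TensorProduct.tmul_add]))
        (fun x x' => AddMonoidHom.ext fun y => TensorProduct.add_tmul _ _ _)
      have hB : ∀ x y, B x y = x ⊗ₜ[O] e.equiv (y • u) := fun _ _ => rfl
      change ∑ i, σ.x i ⊗ₜ[O] e.equiv (σ.y i • r • u) = r • ∑ i, σ.x i ⊗ₜ[O] e.equiv (σ.y i • u)
      -- Linearity over `O'`: `∑ xᵢ ⊗ yᵢ r u = ∑ r xᵢ ⊗ yᵢ u`.
      have := σ.balanced B (fun s a b => by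
        rw [hB, hB, TensorProduct.smul_tmul, ← e.equiv_smul, Algebra.smul_def, mul_smul]) r
      simp only [hB, mul_smul] at this
      rw [this, Finset.smul_sum]
      rfl)
    (fun g u => by
      change ∑ i, σ.x i ⊗ₜ[O] e.equiv (σ.y i • U'.ρ g u) =
        LinearMap.baseChange O' (U.ρ g) (∑ i, σ.x i ⊗ₜ[O] e.equiv (σ.y i • u))
      rw [map_sum]
      refine Finset.sum_congr rfl fun i _ => ?_
      rw [LinearMap.baseChange_tmul, ← map_smul (U'.ρ g), e.equiv_rho])

/-- The homomorphism `O' ⊗_O U → U'`, `r ⊗ u ↦ r u`. -/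
def RepRestriction.ofBaseChange (e : RepRestriction U' U) : (baseChange Γ O O').obj U ⟶ U' :=
  let F : O' ⊗[O] U →+ U' := TensorProduct.liftAddHom
    (AddMonoidHom.mk' (fun r => AddMonoidHom.mk' (fun u => r • e.equiv.symm u)
        (fun u v => by rw [map_add, smul_add]))
      (fun r s => AddMonoidHom.ext fun u => add_smul _ _ _))
    (fun r a u => by
      obtain ⟨u, rfl⟩ := e.equiv.surjective u
      change (r • a) • e.equiv.symm (e.equiv u) = a • e.equiv.symm (r • e.equiv u)
      rw [← e.equiv_smul, AddEquiv.symm_apply_apply, AddEquiv.symm_apply_apply, Algebra.smul_def,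
        mul_comm, mul_smul])
  have hF : ∀ r u, F (r ⊗ₜ[O] u) = r • e.equiv.symm u := fun _ _ => rfl
  repHom (V := (baseChange Γ O O').obj U) F
    (fun r t => by
      change O' ⊗[O] U at t
      change F (r • t) = r • F t
      induction t with
      | zero => rw [smul_zero, map_zero, smul_zero]
      | add s t hs ht => rw [smul_add, map_add, map_add, smul_add, hs, ht]
      | tmul a u => rw [TensorProduct.smul_tmul', hF, hF, smul_eq_mul, mul_smul])
    (fun g t => by
      change O' ⊗[O] U at t
      change F (LinearMap.baseChange O' (U.ρ g) t) = U'.ρ g (F t)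
      induction t with
      | zero => rw [map_zero, map_zero, map_zero]
      | add s t hs ht => rw [map_add, map_add, map_add, map_add, hs, ht]
      | tmul a u =>
        obtain ⟨u, rfl⟩ := e.equiv.surjective u
        rw [LinearMap.baseChange_tmul, hF, hF, ← e.equiv_rho, AddEquiv.symm_apply_apply,
          AddEquiv.symm_apply_apply, map_smul])

lemma RepRestriction.ofBaseChange_tmul (e : RepRestriction U' U) (r : O') (u : U) :
    e.ofBaseChange.hom (r ⊗ₜ[O] u) = r • e.equiv.symm u := rfl

lemma RepRestriction.toBaseChange_ofBaseChange (σ : SeparabilityIdempotent O O')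
    (e : RepRestriction U' U) : e.toBaseChange σ ≫ e.ofBaseChange = 𝟙 U' :=
  repHom_ext fun u => by
    change e.ofBaseChange.hom (∑ i, σ.x i ⊗ₜ[O] e.equiv (σ.y i • u)) = u
    refine (map_sum e.ofBaseChange.hom _ _).trans ?_
    have : ∀ i, e.ofBaseChange.hom (σ.x i ⊗ₜ[O] e.equiv (σ.y i • u)) = (σ.x i * σ.y i) • u :=
      fun i => by
        rw [e.ofBaseChange_tmul, AddEquiv.symm_apply_apply, mul_smul]
    rw [Finset.sum_congr rfl fun i _ => this i, ← Finset.sum_smul, σ.sum_mul, one_smul]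

lemma RepRestriction.toBaseChange_naturality (σ : SeparabilityIdempotent O O')
    (e : RepRestriction U' U) (e' : RepRestriction V' V) (φ' : U' ⟶ V') (φ : U ⟶ V)
    (h : ∀ u, e'.equiv (φ'.hom u) = φ.hom (e.equiv u)) :
    φ' ≫ e'.toBaseChange σ = e.toBaseChange σ ≫ (baseChange Γ O O').map φ :=
  repHom_ext fun u => by
    change ∑ i, σ.x i ⊗ₜ[O] e'.equiv (σ.y i • φ'.hom u) =
      LinearMap.baseChange O' φ.hom.toLinearMap (∑ i, σ.x i ⊗ₜ[O] e.equiv (σ.y i • u))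
    rw [map_sum]
    refine Finset.sum_congr rfl fun i _ => ?_
    rw [LinearMap.baseChange_tmul, ← map_smul, h]
    rfl

lemma RepRestriction.ofBaseChange_naturality
    (e : RepRestriction U' U) (e' : RepRestriction V' V) (φ' : U' ⟶ V') (φ : U ⟶ V)
    (h : ∀ u, e'.equiv (φ'.hom u) = φ.hom (e.equiv u)) :
    (baseChange Γ O O').map φ ≫ e'.ofBaseChange = e.ofBaseChange ≫ φ' :=
  repHom_ext fun t => by
    change O' ⊗[O] U at t
    change e'.ofBaseChange.hom (LinearMap.baseChange O' φ.hom.toLinearMap t) =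
      φ'.hom (e.ofBaseChange.hom t)
    induction t with
    | zero =>
      rw [map_zero]
      exact (map_zero e'.ofBaseChange.hom).trans
        ((congrArg φ'.hom (map_zero e.ofBaseChange.hom)).trans (map_zero φ'.hom)).symm
    | add s t hs ht =>
      rw [map_add]
      refine (map_add e'.ofBaseChange.hom _ _).trans ((congrArg₂ (· + ·) hs ht).trans ?_)
      exact ((congrArg φ'.hom (map_add e.ofBaseChange.hom s t)).trans (map_add φ'.hom _ _)).symm
    | tmul a u =>
      obtain ⟨u, rfl⟩ := e.equiv.surjective u
      rw [LinearMap.baseChange_tmul, e.ofBaseChange_tmul, e'.ofBaseChange_tmul, map_smul,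
        AddEquiv.symm_apply_apply]
      congr 1
      exact (AddEquiv.symm_apply_eq _).2 (h u).symm

end BaseChange

/-! ### Bimodules over block algebras as representations -/

section Blocks

variable {O O' G H : Type u} [CommRing O] [CommRing O'] [Algebra O O'] [Group G] [Group H]
  {b : MonoidAlgebra O G} {c : MonoidAlgebra O H}
  {b' : MonoidAlgebra O' G} {c' : MonoidAlgebra O' H}
variable (hb : IsBlock b) (hc : IsBlock c) (hb' : IsBlock b') (hc' : IsBlock c')
  (h : MonoidAlgebra.mapRingHom G (algebraMap O O') b * b' ≠ 0)
  (k : MonoidAlgebra.mapRingHom H (algebraMap O O') c * c' ≠ 0)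

/-- The homomorphism `OGb → O'Gb'`, together with its compatibility with `O → O'`. -/
def blockCoeffHom : CoeffHom O O' hb.Alg hb'.Alg :=
  { blockHom hb hb' h with map_algebraMap := blockHom_algebraMap hb hb' h }

lemma tensor_groupHom (x : G × H) :
    (blockCoeffHom hb hb' h).tensor (blockCoeffHom hc hc' k) (groupHom hb hc x) =
      groupHom hb' hc' x := by
  refine (CoeffHom.tensor_tmul _ _ _ _).trans ?_
  exact congrArg₂ (fun (a : hb'.Alg) (d : hc'.Alg) => a ⊗ₜ[O'] MulOpposite.op d)
    (blockHom_ofGroup hb hb' h x.1) (blockHom_ofGroup hc hc' k x.2⁻¹)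

/-- Restriction of coefficients for a bimodule is restriction of coefficients for the
corresponding representation. -/
def bimodRestriction (X : Bimod O' hb'.Alg hc'.Alg) :
    RepRestriction ((toRep hb' hc').obj X)
      ((toRep hb hc).obj ((resBimod (blockCoeffHom hb hb' h) (blockCoeffHom hc hc' k)).obj X)) where
  equiv := toRes (blockCoeffHom hb hb' h) (blockCoeffHom hc hc' k) X
  equiv_smul r x := (base_smul_toRes _ _ X r x).symm
  equiv_rho g x := by
    change X at x
    change toRes (blockCoeffHom hb hb' h) (blockCoeffHom hc hc' k) X (groupHom hb' hc' g • x) =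
      groupHom hb hc g • toRes (blockCoeffHom hb hb' h) (blockCoeffHom hc hc' k) X x
    rw [smul_toRes, tensor_groupHom]

/-- The natural transformation from the `O'(G × H)`-module `X` to `O' ⊗_O X`. -/
def toExtension (σ : SeparabilityIdempotent O O') : toRep hb' hc' ⟶
    resBimod (blockCoeffHom hb hb' h) (blockCoeffHom hc hc' k) ⋙
      toRep hb hc ⋙ baseChange (G × H) O O' where
  app X := (bimodRestriction hb hc hb' hc' h k X).toBaseChange σ
  naturality _ _ _ := RepRestriction.toBaseChange_naturality σ _ _ _ _ fun _ => rfl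

/-- The natural transformation from `O' ⊗_O X` to the `O'(G × H)`-module `X`. -/
def ofExtension : resBimod (blockCoeffHom hb hb' h) (blockCoeffHom hc hc' k) ⋙
      toRep hb hc ⋙ baseChange (G × H) O O' ⟶ toRep hb' hc' where
  app X := (bimodRestriction hb hc hb' hc' h k X).ofBaseChange
  naturality _ _ _ := RepRestriction.ofBaseChange_naturality _ _ _ _ fun _ => rfl

lemma toExtension_ofExtension (σ : SeparabilityIdempotent O O') :
    toExtension hb hc hb' hc' h k σ ≫ ofExtension hb hc hb' hc' h k = 𝟙 _ := by
  ext X : 2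
  exact RepRestriction.toBaseChange_ofBaseChange σ _

theorem isSummandOfExtension_res (σ : SeparabilityIdempotent O O')
    (X : Bimod O' hb'.Alg hc'.Alg) : IsSummandOfExtension hb hc hb' hc' X
      ((resBimod (blockCoeffHom hb hb' h) (blockCoeffHom hc hc' k)).obj X) :=
  ⟨⟨(toExtension hb hc hb' hc' h k σ).app X, (ofExtension hb hc hb' hc' h k).app X,
    NatTrans.congr_app (toExtension_ofExtension hb hc hb' hc' h k σ) X⟩⟩

theorem isSummandOfExtensionComplex_res (σ : SeparabilityIdempotent O O')
    (X : CochainComplex (Bimod O' hb'.Alg hc'.Alg) ℤ) :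
    IsSummandOfExtensionComplex hb hc hb' hc' X
      ((resComplex (blockCoeffHom hb hb' h) (blockCoeffHom hc hc' k)).obj X) :=
  ⟨⟨(NatTrans.mapHomologicalComplex (toExtension hb hc hb' hc' h k σ) (ComplexShape.up ℤ)).app X,
    (NatTrans.mapHomologicalComplex (ofExtension hb hc hb' hc' h k) (ComplexShape.up ℤ)).app X, by
    refine HomologicalComplex.Hom.ext (funext fun i => ?_)
    exact NatTrans.congr_app (toExtension_ofExtension hb hc hb' hc' h k σ) (X.X i)⟩⟩

/-- The elements `g b` span `OGb` over `O`, so commuting with `G` amounts to commuting with the left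
action of the block algebra. -/
lemma toRep_hom_left {X Y : Bimod O hb.Alg hc.Alg} (φ : (toRep hb hc).obj X ⟶ (toRep hb hc).obj Y)
    (a : hb.Alg) (x : X) : φ.hom (X.left a x) = Y.left a (φ.hom x) := by
  have hadd : ∀ y z, hb.proj (y + z) = hb.proj y + hb.proj z := fun y z => Subtype.ext (by
    change (hb.proj (y + z)).1 = (hb.proj y).1 + (hb.proj z).1
    rw [hb.proj_val, hb.proj_val, hb.proj_val, add_mul])
  have hsmul : ∀ (r : O) y, hb.proj (r • y) = r • hb.proj y := fun r y => Subtype.ext (by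
    change (hb.proj (r • y)).1 = r • (hb.proj y).1
    rw [hb.proj_val, hb.proj_val, smul_mul_assoc])
  have ha : hb.proj a.1 = a := Subtype.ext (by rw [hb.proj_val, hb.val_mul])
  let ψ : X →ₗ[O] Y := φ.hom.toLinearMap
  have hψ : ∀ (g : G) (x : X), ψ (groupHom hb hc (g, 1) • x) = groupHom hb hc (g, 1) • ψ x :=
    fun g x => Rep.hom_comm_apply φ (g, 1) x
  change ψ (X.left a x) = Y.left a (ψ x)
  rw [← ha]
  generalize a.1 = y
  induction y using MonoidAlgebra.induction_on with
  | of g =>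
    have hg : ∀ (Z : Bimod O hb.Alg hc.Alg) (z : Z), Z.left (hb.proj (MonoidAlgebra.of O G g)) z =
        groupHom hb hc (g, 1) • z := fun Z z => by
      change (hb.ofGroup g ⊗ₜ[O] (1 : (hc.Alg)ᵐᵒᵖ)) • z =
        (hb.ofGroup g ⊗ₜ[O] MulOpposite.op (hc.ofGroup (1 : H)⁻¹)) • z
      rw [inv_one, map_one, MulOpposite.op_one]
    rw [hg, hg, hψ]
  | add y z hy hz =>
    rw [hadd, map_add, map_add, LinearMap.add_apply, LinearMap.add_apply, map_add, hy, hz]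
  | smul r y hy =>
    rw [hsmul, map_smul, map_smul, LinearMap.smul_apply, LinearMap.smul_apply, map_smul, hy]

/-- The linearity hypothesis of `RepRestriction.hasTrivialSource` holds because scalars of `O'` act
as elements of `OGb`, by surjectivity of `blockHom`. -/
theorem hasTrivialSource_res [IsNoetherianRing O] [IsLocalRing O]
    [IsAdicComplete (IsLocalRing.maximalIdeal O) O] [Finite (IsLocalRing.ResidueField O)]
    [Module.Finite O O'] [Module.Free O O'] [Finite G] [Finite H] {p : ℕ}
    (σ : SeparabilityIdempotent O O') (hs : Function.Surjective (blockHom hb hb' h))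
    {X : Bimod O' hb'.Alg hc'.Alg} (hX : HasTrivialSource p ((toRep hb' hc').obj X)) :
    HasTrivialSource p ((toRep hb hc).obj
      ((resBimod (blockCoeffHom hb hb' h) (blockCoeffHom hc hc' k)).obj X)) := by
  refine (bimodRestriction hb hc hb' hc' h k X).hasTrivialSource σ (fun φ r x => ?_) hX
  obtain ⟨a, ha⟩ := hs (algebraMap O' hb'.Alg r)
  have hl : ∀ x : X, toRes (blockCoeffHom hb hb' h) (blockCoeffHom hc hc' k) X (r • x) =
      ((resBimod (blockCoeffHom hb hb' h) (blockCoeffHom hc hc' k)).obj X).left a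
        (toRes _ _ X x) := fun x => by
    rw [left_toRes, ← Bimod.base_smul_left, ← ha]
    rfl
  rw [AddEquiv.symm_apply_eq]
  refine (congrArg φ.hom (hl x)).trans ((toRep_hom_left hb hc φ a _).trans ?_)
  refine Eq.trans ?_ (hl _).symm
  exact congrArg _ (AddEquiv.apply_symm_apply _ _).symm

end Blocks

end BlockDescent

end

/-! ### Descent of the equivalences -/

theorem theorem6p5 (p : ℕ) [Fact p.Prime]
    -- two `p`-modular systems, given by the complete discrete valuation rings `O` and `O'`
    (O O' : Type u)
    [CommRing O] [IsDomain O] [IsDiscreteValuationRing O]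
    [IsAdicComplete (IsLocalRing.maximalIdeal O) O] [CharZero O]
    [CharP (IsLocalRing.ResidueField O) p]
    [CommRing O'] [IsDomain O'] [IsDiscreteValuationRing O']
    [IsAdicComplete (IsLocalRing.maximalIdeal O') O'] [CharZero O']
    [CharP (IsLocalRing.ResidueField O') p]
    -- `O` is a subring of `O'`, and `J(O)` is contained in `J(O')`
    [Algebra O O'] (hinj : Function.Injective (algebraMap O O')) [IsLocalHom (algebraMap O O')]
    -- the residue fields are finite, and `O` and `O'` are absolutely unramified
    [Finite (IsLocalRing.ResidueField O)] [Finite (IsLocalRing.ResidueField O')]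
    (hO : IsLocalRing.maximalIdeal O = Ideal.span {(p : O)})
    (hO' : IsLocalRing.maximalIdeal O' = Ideal.span {(p : O')})
    (G H : Type u) [Group G] [Finite G] [Group H] [Finite H]
    (b : MonoidAlgebra O G) (hb : BlockDescent.IsBlock b)
    (c : MonoidAlgebra O H) (hc : BlockDescent.IsBlock c)
    (b' : MonoidAlgebra O' G) (hb' : BlockDescent.IsBlock b')
    (c' : MonoidAlgebra O' H) (hc' : BlockDescent.IsBlock c')
    (hbb' : MonoidAlgebra.mapRingHom G (algebraMap O O') b * b' ≠ 0)
    (hcc' : MonoidAlgebra.mapRingHom H (algebraMap O O') c * c' ≠ 0)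
    (hkb' : BlockDescent.coefficientField O b' = ⊤)
    (hkc' : BlockDescent.coefficientField O c' = ⊤) :
    -- (a) Morita equivalences
    (∀ M' : BlockDescent.Bimod O' hb'.Alg hc'.Alg, BlockDescent.IsMorita M' →
      ∃ M : BlockDescent.Bimod O hb.Alg hc.Alg, BlockDescent.IsMorita M ∧
        BlockDescent.IsSummandOfExtension hb hc hb' hc' M' M ∧
        (BlockDescent.HasTrivialSource p ((BlockDescent.toRep hb' hc').obj M') →
          BlockDescent.HasTrivialSource p ((BlockDescent.toRep hb hc).obj M))) ∧
    -- (b) Rickard equivalences and splendid Rickard equivalences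
    (∀ X' : CochainComplex (BlockDescent.Bimod O' hb'.Alg hc'.Alg) ℤ, BlockDescent.IsRickard X' →
      ∃ X : CochainComplex (BlockDescent.Bimod O hb.Alg hc.Alg) ℤ, BlockDescent.IsRickard X ∧
        BlockDescent.IsSummandOfExtensionComplex hb hc hb' hc' X' X ∧
        (BlockDescent.IsSplendid p hb' hc' X' → BlockDescent.IsSplendid p hb hc X)) ∧
    -- (c) virtual Morita equivalences
    ((∃ (M' : BlockDescent.BimodK0 O' hb'.Alg hc'.Alg)
        (N' : BlockDescent.BimodK0 O' hc'.Alg hb'.Alg), BlockDescent.IsVirtualMorita M' N') →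
      ∃ (M : BlockDescent.BimodK0 O hb.Alg hc.Alg) (N : BlockDescent.BimodK0 O hc.Alg hb.Alg),
        BlockDescent.IsVirtualMorita M N) ∧
    -- (c) `p`-permutation equivalences
    ((∃ M' : BlockDescent.BimodK0 O' hb'.Alg hc'.Alg,
        BlockDescent.IsPPermutationEquivalence p hb' hc' M') →
      ∃ M : BlockDescent.BimodK0 O hb.Alg hc.Alg,
        BlockDescent.IsPPermutationEquivalence p hb hc M) := by
  -- Both maximal ideals are generated by `p`; this is the only use of absolute unramifiedness.
  have hm : (IsLocalRing.maximalIdeal O).map (algebraMap O O') = IsLocalRing.maximalIdeal O' := by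
    rw [hO, hO', Ideal.map_span, Set.image_singleton, map_natCast]
  have hfin : Module.Finite O O' := BlockDescent.finite_of_map_maximalIdeal hm
  have : Module.IsTorsionFree O O' := (Module.isTorsionFree_iff_algebraMap_injective).2 hinj
  -- A finitely generated torsion-free module over a principal ideal domain is free.
  have hfree : Module.Free O O' := inferInstance
  obtain ⟨τ, hτ⟩ := BlockDescent.exists_bijective_mul_form (O := O) (O' := O') hm
  obtain ⟨σ⟩ := BlockDescent.exists_separabilityIdempotent (O := O) (O' := O') hm
  have hf := BlockDescent.blockHom_bijective hm hinj hb hb' hbb' hkb'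
  have hg := BlockDescent.blockHom_bijective hm hinj hc hc' hcc' hkc'
  let f := BlockDescent.blockCoeffHom hb hb' hbb'
  let g := BlockDescent.blockCoeffHom hc hc' hcc'
  refine ⟨fun M' hM' => ?_, fun X' hX' => ?_, ?_, ?_⟩
  · exact ⟨(BlockDescent.resBimod f g).obj M', BlockDescent.resBimod_isMorita f g hf hg hM',
      BlockDescent.isSummandOfExtension_res hb hc hb' hc' hbb' hcc' σ M',
      BlockDescent.hasTrivialSource_res hb hc hb' hc' hbb' hcc' σ hf.2⟩
  · exact ⟨(BlockDescent.resComplex f g).obj X', hX'.res f g hf hg hτ,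
      BlockDescent.isSummandOfExtensionComplex_res hb hc hb' hc' hbb' hcc' σ X',
      fun h => ⟨hX'.res f g hf hg hτ, fun i =>
        (BlockDescent.bimodRestriction hb hc hb' hc' hbb' hcc' (X'.X i)).isPPermutation
          (h.pPermutation i)⟩⟩
  · rintro ⟨M', N', h⟩
    exact ⟨_, _, h.res f g hf hg⟩
  · rintro ⟨M', h⟩
    refine ⟨BlockDescent.resK0 f g hf.2 hg.2 M', ?_, ?_⟩
    · rw [← BlockDescent.resK0_dual f g hf.2 hg.2 hτ]
      exact h.virtualMorita.res f g hf hg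
    · obtain ⟨M₀, M₁, h₀, h₁, hp₀, hp₁, rfl⟩ := h.pPermutation
      refine ⟨_, _, BlockDescent.resBimod_isBiprojective f g hf hg h₀,
        BlockDescent.resBimod_isBiprojective f g hf hg h₁,
        (BlockDescent.bimodRestriction hb hc hb' hc' hbb' hcc' M₀).isPPermutation hp₀,
        (BlockDescent.bimodRestriction hb hc hb' hc' hbb' hcc' M₁).isPPermutation hp₁, ?_⟩
      rw [map_sub, BlockDescent.resK0_isBiprojective_cls f g hf hg h₀,
        BlockDescent.resK0_isBiprojective_cls f g hf hg h₁]
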